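/- Let $n,m\ge 2$ be integers and let $\alpha_0\ge 1$ be an integer with $\alpha_0\le \lfloor 3m/2\rfloor-1$ if $m$ is even and $\alpha_0\le\lfloor 3m/2\rfloor$ if $m$ is odd. For $x_0\in\mathbb{R}^n$ write $r=|x-x_0|$, $\mathbb{B}_R(x_0)=\{r<R\}$, $\phi(r)=\log r+\log\big((\log r)^2\big)$, and let $L^p(r^{-n}dx)$ be the Lebesgue space of the measure $r^{-n}dx$; $L^p$ without a weight refers to Lebesgue measure. For a multi-index $\alpha$ put $\beta_\alpha=\frac{3m-2|\alpha|}{2}$ and $\mu=\mu(\alpha)=\frac{2}{3m-2|\alpha|}$. Functions are complex valued. Given coefficients $V_\alpha\in L^\infty(\mathbb{B}_{R_0}(x_0))$ $(1\le|\alpha|\le\alpha_0)$ and $V_0\in L^s(\mathbb{B}_{R_0}(x_0))$, put $$Lu=\Delta^m u+\sum_{1\le|\alpha|\le\alpha_0}V_\alpha D^\alpha u+V_0u ,$$ and let $\|V_\alpha\|_{L^\infty}$, $\|V_0\|_{L^s}$ be the norms over $\mathbb{B}_{R_0}(x_0)$. For $j\in\{0,1\}$ put $$S_j(u)=\sum_{j\le|\alpha|\le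 2m-1}\tau^{\beta_\alpha}\big\|e^{-\tau\phi(r)}(\log r)^{-m}r^{|\alpha|}D^\alpha u\big\|_{L^2(r^{-n}dx)} .$$ In each of the following cases there are positive constants $C_0$, $C_1$ and $R_0<1$, depending only on $n,m,\alpha_0,s,p$ (and on $\varepsilon$ in Case II), such that for all $x_0\in\mathbb{R}^n$, all such $V_\alpha,V_0$, all $u\in C_0^\infty(\mathbb{B}_{R_0}(x_0)\setminus\{x_0\})$ and all $\tau$ satisfying the stated lower bound, the stated estimate holds. **Case I.** Let $n>4m-2$, $s\in(\frac{2n}{3m},\infty]$, $2\le p\le\frac{2n}{n-4m+2}$, $\beta_0=\frac{3mp-n(p-2)}{2p}$ and $\nu=\frac{2s}{3ms-2n}$. If $\tau>C_0\big(1+\sum_{1\le|\alpha|\le\alpha_0}\|V_\alpha\|_{L^\infty}^{\mu}+\|V_0\|_{L^s}^{\nu}\big)$, then $$\tau^{\beta_0}\|e^{-\tau\phi(r)}(\log r)^{-m}u\|_{L^p(r^{-n}dx)}+S_1(u)\le C_1\|e^{-\tau\phi(r)}r^{2m}Lu\|_{L^2(r^{-n}dx)} .$$ **Case II.** Let $n=4m-2$,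 $s\in(\frac{4(2m-1)}{3m},\infty]$, $2\le p<\infty$, and let $0<\varepsilon<1$ be so small that $3m-\frac{4(2m-1)}{s}-2(2m-1)\big(1-\frac2s\big)\varepsilon>0$. Put $\tilde\beta_0=\frac{4m-2}{p}(1-\varepsilon)-\frac{m-2}{2}$ and $\tilde\nu=\frac{2s}{3ms-4(2m-1)-2(2m-1)(s-2)\varepsilon}$. If $\tau>C_0\big(1+\sum_{1\le|\alpha|\le\alpha_0}\|V_\alpha\|_{L^\infty}^{\mu}+\|V_0\|_{L^s}^{\tilde\nu}\big)$, then $$\tau^{\tilde\beta_0}\|e^{-\tau\phi(r)}(\log r)^{-m}u\|_{L^p}+S_0(u)\le C_1\|e^{-\tau\phi(r)}r^{2m}Lu\|_{L^2(r^{-n}dx)} .$$ **Case III.** Let $2\le n<4m-2$, $s\in(\frac{4(2m-1)}{3m},\infty]$, $2\le p\le\infty$, $\bar\beta_0=\frac{4m-2}{p}-\frac{m-2}{2}$ and $\bar\nu=\frac{2s}{3ms-4(2m-1)}$. If $\tau>C_0\big(1+\sum_{1\le|\alpha|\le\alpha_0}\|V_\alpha\|_{L^\infty}^{\mu}+\|V_0\|_{L^s}^{\bar\nu}\big)$,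 then $$\tau^{\bar\beta_0}\|e^{-\tau\phi(r)}(\log r)^{-m}u\|_{L^p}+S_0(u)\le C_1\|e^{-\tau\phi(r)}r^{2m}Lu\|_{L^2(r^{-n}dx)} .$$ Here $1/s$ and $1/p$ are read as $0$ when $s=\infty$ or $p=\infty$, and $\nu,\tilde\nu,\bar\nu$ take their limiting values at $s=\infty$. -/

import Mathlib

open MeasureTheory
open scoped ENNReal ContDiff

namespace Polyharmonic

/-- Euclidean space `ℝⁿ`. -/
abbrev Space (n : ℕ) : Type := EuclideanSpace ℝ (Fin n)

/-- The multi-indices `α ∈ ℕⁿ` of length `|α| = k`. -/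
def multiIndices (n k : ℕ) : Finset (Fin n → ℕ) :=
  (Finset.univ : Finset (Fin n)).piAntidiag k

/-- The partial derivative `∂f/∂xᵢ`. -/
noncomputable def partialDeriv {n : ℕ} (i : Fin n) (f : Space n → ℂ) : Space n → ℂ :=
  fun x => fderiv ℝ f x (EuclideanSpace.single i 1)

/-- `D^α f = ∂₁^{α₁} ⋯ ∂ₙ^{αₙ} f`. -/
noncomputable def multiDeriv {n : ℕ} (α : Fin n → ℕ) (f : Space n → ℂ) : Space n → ℂ :=
  (List.finRange n).foldr (fun i g => (partialDeriv i)^[α i] g) f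

/-- `Δ^m f`, the `m`-fold iterate of the Laplacian. -/
noncomputable def polyLaplacian {n : ℕ} (m : ℕ) (f : Space n → ℂ) : Space n → ℂ :=
  (Laplacian.laplacian : (Space n → ℂ) → (Space n → ℂ))^[m] f

/-- `Δ^m u + ∑_{1 ≤ |α| ≤ α₀} V_α D^α u + V₀ u`. -/
noncomputable def fullOperator {n : ℕ} (m α₀ : ℕ) (V : (Fin n → ℕ) → Space n → ℂ)
    (V₀ : Space n → ℂ) (u : Space n → ℂ) : Space n → ℂ :=
  fun x => polyLaplacian m u x
    + (∑ k ∈ Finset.Icc 1 α₀, ∑ α ∈ multiIndices n k, V α x * multiDeriv α u x)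
    + V₀ x * u x

/-- `φ(r) = log r + log ((log r)²)`. -/
noncomputable def phi (r : ℝ) : ℝ := Real.log r + Real.log (Real.log r ^ 2)

/-- The measure `r^{-n} dx` with `r = |x - x₀|`. -/
noncomputable def radialMeasure {n : ℕ} (x₀ : Space n) : Measure (Space n) :=
  volume.withDensity fun x => ENNReal.ofReal ((‖x - x₀‖ ^ n)⁻¹)

/-- `e^{-τ φ(r)} (log r)^{-m} r^k f` with `r = |x - x₀|`. -/
noncomputable def leftWeighted {n : ℕ} (m : ℕ) (x₀ : Space n) (τ : ℝ) (k : ℕ)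
    (f : Space n → ℂ) : Space n → ℂ :=
  fun x => (Real.exp (-τ * phi ‖x - x₀‖) * (Real.log ‖x - x₀‖ ^ m)⁻¹ * ‖x - x₀‖ ^ k) • f x

/-- `e^{-τ φ(r)} r^{2m} f` with `r = |x - x₀|`. -/
noncomputable def rightWeighted {n : ℕ} (m : ℕ) (x₀ : Space n) (τ : ℝ)
    (f : Space n → ℂ) : Space n → ℂ :=
  fun x => (Real.exp (-τ * phi ‖x - x₀‖) * ‖x - x₀‖ ^ (2 * m)) • f x

/-- `∑_{j ≤ |α| ≤ 2m-1} τ^{(3m-2|α|)/2} ‖e^{-τφ(r)} (log r)^{-m} r^{|α|} D^α u‖_{L²(r^{-n}dx)}`. -/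
noncomputable def derivSum {n : ℕ} (j m : ℕ) (x₀ : Space n) (τ : ℝ) (u : Space n → ℂ) : ℝ≥0∞ :=
  ∑ k ∈ Finset.Icc j (2 * m - 1), ∑ α ∈ multiIndices n k,
    ENNReal.ofReal (τ ^ ((3 * m - 2 * k : ℝ) / 2))
      * eLpNorm (leftWeighted m x₀ τ k (multiDeriv α u)) 2 (radialMeasure x₀)

/-- `‖e^{-τφ(r)} r^{2m} (Δ^m u + ∑ V_α D^α u + V₀ u)‖_{L²(r^{-n}dx)}`. -/
noncomputable def operatorNorm {n : ℕ} (m α₀ : ℕ) (V : (Fin n → ℕ) → Space n → ℂ)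
    (V₀ : Space n → ℂ) (x₀ : Space n) (τ : ℝ) (u : Space n → ℂ) : ℝ≥0∞ :=
  eLpNorm (rightWeighted m x₀ τ (fullOperator m α₀ V V₀ u)) 2 (radialMeasure x₀)

/-- `u ∈ C₀^∞(B_R(x₀) \ {x₀})`. -/
def IsTestFunction {n : ℕ} (x₀ : Space n) (R : ℝ) (u : Space n → ℂ) : Prop :=
  ContDiff ℝ ∞ u ∧ HasCompactSupport u ∧ tsupport u ⊆ Metric.ball x₀ R \ {x₀}

/-- `V_α ∈ L^∞(B_R(x₀))` for `1 ≤ |α| ≤ α₀`, and `V₀ ∈ L^s(B_R(x₀))`. -/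
def AdmissibleCoeffs {n : ℕ} (α₀ : ℕ) (s : ℝ≥0∞) (x₀ : Space n) (R : ℝ)
    (V : (Fin n → ℕ) → Space n → ℂ) (V₀ : Space n → ℂ) : Prop :=
  (∀ k ∈ Finset.Icc 1 α₀, ∀ α ∈ multiIndices n k,
      MemLp (V α) ∞ (volume.restrict (Metric.ball x₀ R)))
    ∧ MemLp V₀ s (volume.restrict (Metric.ball x₀ R))

/-- `1 + ∑_{1 ≤ |α| ≤ α₀} ‖V_α‖_{L^∞}^μ + ‖V₀‖_{L^s}^ν`, where `μ = 2 / (3m - 2|α|)`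
and the norms are taken over `B_R(x₀)`. -/
noncomputable def coeffSize {n : ℕ} (m α₀ : ℕ) (s : ℝ≥0∞) (ν : ℝ) (x₀ : Space n) (R : ℝ)
    (V : (Fin n → ℕ) → Space n → ℂ) (V₀ : Space n → ℂ) : ℝ :=
  1 + (∑ k ∈ Finset.Icc 1 α₀, ∑ α ∈ multiIndices n k,
        (eLpNorm (V α) ∞ (volume.restrict (Metric.ball x₀ R))).toReal
          ^ (2 / (3 * m - 2 * k : ℝ)))
    + (eLpNorm V₀ s (volume.restrict (Metric.ball x₀ R))).toReal ^ ν

/-- `1 / s` for an exponent `s ∈ [1, ∞]`, with `1 / ∞ = 0`. -/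
noncomputable def recip (s : ℝ≥0∞) : ℝ := (s⁻¹).toReal

/-- `2s / (3ms - 2n)`, with value `2 / (3m)` at `s = ∞`. -/
noncomputable def nuHigh (n m : ℕ) (s : ℝ≥0∞) : ℝ := 2 / (3 * m - 2 * n * recip s)

/-- `3m - 4(2m-1)/s - 2(2m-1)(1-2/s)ε`, which is
`(3ms - 4(2m-1) - 2(2m-1)(s-2)ε) / s` when `s < ∞`. -/
noncomputable def critGap (m : ℕ) (s : ℝ≥0∞) (ε : ℝ) : ℝ :=
  3 * m - 4 * (2 * m - 1) * recip s - 2 * (2 * m - 1) * (1 - 2 * recip s) * ε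

/-- `2s / (3ms - 4(2m-1) - 2(2m-1)(s-2)ε)`, with value `2 / (3m - 2(2m-1)ε)` at `s = ∞`. -/
noncomputable def nuCrit (m : ℕ) (s : ℝ≥0∞) (ε : ℝ) : ℝ := 2 / critGap m s ε

/-- `2s / (3ms - 4(2m-1))`, with value `2 / (3m)` at `s = ∞`. -/
noncomputable def nuLow (m : ℕ) (s : ℝ≥0∞) : ℝ := 2 / (3 * m - 4 * (2 * m - 1) * recip s)

end Polyharmonic

open Polyharmonic

/-! Since `φ = log r + 2 log|log r|`, the factor `e^{-τφ}` is `r^{-τ} (-log r)^{-2τ}`. The whole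
argument runs on the two-parameter weights `wt x₀ σ ρ`, and the measure `r^{-n} dx` in an `L^p` norm
merely shifts `σ` by `n/p`.

The `L²` estimate. In `t = log r` the operator `r²Δ` is `∂ₜ² + (n-2)∂ₜ` plus the spherical
Laplacian. Conjugation by `wt x₀ σ ρ` splits it into a symmetric part `S` and a skew part `A = c ∂ₜ
+ c'/2`, with `c = 2σ + n - 2 + 2ρ/t`. In `|Sv + Av|²` the cross term integrates to `-2c'(∂ₜv)² +
½(c''' - c²c')v²`. The double logarithm in `φ` makes `c' = -2ρ/t²` negative, so this controls `σ³
v²/t²`: one Laplacian gains `τ^{3/2}` and costs one power of `log r` (`carleman_lap`). Iterating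
over the powers of the Laplacian gives `τ^{3m/2}` and `(log r)^{-m}` (`carleman_lap_iterate`). The
logarithmic derivative of the weight is `O(τ)`, so weighted elliptic estimates recover each
derivative at the price of one factor `τ` (`elliptic_estimate`, `carleman_wordDeriv`). This is the
sum `S_j`.

The `L^p` estimate. A second endpoint comes from trading `2m-1` derivatives for integrability. For
`n > 4m-2` it is iterated Sobolev (`sobolev_chain`). For `n < 4m-2` it is a pointwise bound
(`carleman_sup`), from a local Sobolev inequality on balls of radius `r/(2τ)`, where the weight is
constant up to a factor. For `n = 4m-2` the embedding is borderline and only finite exponents are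
reached, whence the loss `ε`. Interpolation with `L²` gives all exponents, in the form
`CarlemanBound`.

The lower order terms. `V_α D^α u` costs `‖V_α‖ τ^{-β_α}`, and by Hölder `V₀ u` costs `‖V₀‖
τ^{-e'}`, where `e'` is the gain at the exponent `1/p' = 1/2 - 1/s`; thus `ν = 1/e'`. The power of
`log r` lost on the left is paid by a spare power of `r`. The lower bound on `τ` makes these terms
at most half of the finite norm of `Δ^m u`, which absorbs them (`polyLapNorm_le_operatorNorm`). -/

namespace Polyharmonic

/-! ### Partial derivatives, radial functions and compactly supported test functions. -/

section

variable {n : ℕ}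

/-- The partial derivative of a real function. -/
noncomputable def pd (i : Fin n) (f : Space n → ℝ) : Space n → ℝ :=
  fun x => fderiv ℝ f x (EuclideanSpace.single i 1)

/-- `f` is differentiable at `x` with partial derivative `d` in direction `i`. -/
def HasPD (i : Fin n) (f : Space n → ℝ) (d : ℝ) (x : Space n) : Prop :=
  DifferentiableAt ℝ f x ∧ pd i f x = d

namespace HasPD

variable {i : Fin n} {f g : Space n → ℝ} {a b : ℝ} {x : Space n}

theorem add (hf : HasPD i f a x) (hg : HasPD i g b x) :
    HasPD i (fun y => f y + g y) (a + b) x := by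
  refine ⟨hf.1.add hg.1, ?_⟩
  rw [← hf.2, ← hg.2, pd, fderiv_fun_add hf.1 hg.1]
  rfl

theorem mul (hf : HasPD i f a x) (hg : HasPD i g b x) :
    HasPD i (fun y => f y * g y) (a * g x + f x * b) x := by
  refine ⟨hf.1.mul hg.1, ?_⟩
  rw [← hf.2, ← hg.2, pd, fderiv_fun_mul hf.1 hg.1]
  simp [pd]
  ring

theorem sub (hf : HasPD i f a x) (hg : HasPD i g b x) :
    HasPD i (fun y => f y - g y) (a - b) x := by
  refine ⟨hf.1.sub hg.1, ?_⟩
  rw [← hf.2, ← hg.2, pd, fderiv_fun_sub hf.1 hg.1]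
  rfl

theorem const_mul (c : ℝ) (hf : HasPD i f a x) : HasPD i (fun y => c * f y) (c * a) x := by
  refine ⟨hf.1.const_mul c, ?_⟩
  rw [← hf.2, pd, fderiv_const_mul hf.1]
  rfl

theorem sum {ι : Type*} (s : Finset ι) {f : ι → Space n → ℝ} {a : ι → ℝ}
    (hf : ∀ k ∈ s, HasPD i (f k) (a k) x) :
    HasPD i (fun y => ∑ k ∈ s, f k y) (∑ k ∈ s, a k) x := by
  refine ⟨DifferentiableAt.fun_sum fun k hk => (hf k hk).1, ?_⟩
  rw [pd, fderiv_fun_sum fun k hk => (hf k hk).1]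
  simp only [_root_.sum_apply]
  exact Finset.sum_congr rfl fun k hk => (hf k hk).2

theorem congr_deriv (hf : HasPD i f a x) (h : a = b) : HasPD i f b x := h ▸ hf

theorem comp_hasDerivAt {φ : ℝ → ℝ} {φ' : ℝ} (hφ : HasDerivAt φ φ' (f x)) (hf : HasPD i f a x) :
    HasPD i (fun y => φ (f y)) (φ' * a) x := by
  have h := hφ.comp_hasFDerivAt x hf.1.hasFDerivAt
  refine ⟨h.differentiableAt, ?_⟩
  have h' : fderiv ℝ (fun y => φ (f y)) x = φ' • fderiv ℝ f x := h.fderiv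
  rw [← hf.2, pd, h']
  rfl

end HasPD

theorem hasPD_coord (x₀ : Space n) (i j : Fin n) (x : Space n) :
    HasPD i (fun y => y j - x₀ j) (if j = i then 1 else 0) x := by
  have h : HasFDerivAt (fun y : Space n => y j - x₀ j)
      (EuclideanSpace.proj j : Space n →L[ℝ] ℝ) x :=
    ((EuclideanSpace.proj j : Space n →L[ℝ] ℝ).hasFDerivAt).sub_const _
  refine ⟨h.differentiableAt, ?_⟩
  rw [pd, h.fderiv]
  simp

/-- The unit ball around `x₀` without its centre. -/
def punctured (x₀ : Space n) : Set (Space n) := Metric.ball x₀ 1 \ {x₀}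

theorem isOpen_punctured (x₀ : Space n) : IsOpen (punctured x₀) :=
  Metric.isOpen_ball.sdiff isClosed_singleton

theorem norm_pos_of_mem {x₀ x : Space n} (hx : x ∈ punctured x₀) : 0 < ‖x - x₀‖ :=
  norm_pos_iff.2 (sub_ne_zero.2 hx.2)

theorem norm_lt_one_of_mem {x₀ x : Space n} (hx : x ∈ punctured x₀) : ‖x - x₀‖ < 1 := by
  simpa [dist_eq_norm] using hx.1

theorem log_neg_of_mem {x₀ x : Space n} (hx : x ∈ punctured x₀) : Real.log ‖x - x₀‖ < 0 :=
  Real.log_neg (norm_pos_of_mem hx) (norm_lt_one_of_mem hx)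

/-- The radial function with profile `h` in the variable `log |x - x₀|`. -/
noncomputable def rad (x₀ : Space n) (h : ℝ → ℝ) : Space n → ℝ :=
  fun x => h (Real.log ‖x - x₀‖)

theorem norm_sub_sq (x₀ x : Space n) : ‖x - x₀‖ ^ 2 = ∑ i, (x i - x₀ i) ^ 2 := by
  rw [EuclideanSpace.real_norm_sq_eq]
  rfl

theorem hasPD_rad {x₀ x : Space n} (hx : x ∈ punctured x₀) {h : ℝ → ℝ} {h' : ℝ}
    (hh : HasDerivAt h h' (Real.log ‖x - x₀‖)) (i : Fin n) :
    HasPD i (rad x₀ h) (h' * ((x i - x₀ i) / ‖x - x₀‖ ^ 2)) x := by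
  have h0 := norm_pos_of_mem hx
  -- `log r` is differentiated as half the logarithm of the polynomial `r²`, so the norm itself is
  -- never differentiated.
  have hs : HasPD i (fun y : Space n => ∑ j, (y j - x₀ j) * (y j - x₀ j))
      (2 * (x i - x₀ i)) x := by
    refine (HasPD.sum Finset.univ fun j _ =>
      (hasPD_coord x₀ i j x).mul (hasPD_coord x₀ i j x)).congr_deriv ?_
    simp [Finset.sum_add_distrib]
    ring
  have hl : HasDerivAt (fun s : ℝ => Real.log s / 2) ((‖x - x₀‖ ^ 2)⁻¹ / 2)
      (∑ j, (x j - x₀ j) * (x j - x₀ j)) := by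
    have e : ∑ j, (x j - x₀ j) * (x j - x₀ j) = ‖x - x₀‖ ^ 2 := by
      rw [norm_sub_sq]
      exact Finset.sum_congr rfl fun j _ => (sq _).symm
    rw [e]
    exact (Real.hasDerivAt_log (by positivity)).div_const 2
  have e2 : ∀ y : Space n, Real.log (∑ j, (y j - x₀ j) * (y j - x₀ j)) / 2
      = Real.log ‖y - x₀‖ := by
    intro y
    have : ∑ j, (y j - x₀ j) * (y j - x₀ j) = ‖y - x₀‖ ^ 2 := by
      rw [norm_sub_sq]
      exact Finset.sum_congr rfl fun j _ => (sq _).symm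
    rw [this, Real.log_pow]
    push_cast
    ring
  have h1 := HasPD.comp_hasDerivAt hl hs
  simp only [e2] at h1
  refine (HasPD.comp_hasDerivAt hh h1).congr_deriv ?_
  field_simp

theorem contDiffOn_rad (x₀ : Space n) {h : ℝ → ℝ} (hh : ContDiffOn ℝ ∞ h (Set.Iio 0)) :
    ContDiffOn ℝ ∞ (rad x₀ h) (punctured x₀) := by
  refine hh.comp (t := Set.Iio 0) (f := fun x => Real.log ‖x - x₀‖) ?_
    fun x hx => log_neg_of_mem hx
  intro x hx
  have h0 : x - x₀ ≠ 0 := sub_ne_zero.2 hx.2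
  exact (((contDiff_id.sub contDiff_const).contDiffAt.norm ℝ h0).log
    (norm_pos_of_mem hx).ne').contDiffWithinAt

/-- Smooth real functions that vanish outside `K`. -/
structure Test (K : Set (Space n)) (f : Space n → ℝ) : Prop where
  smooth : ContDiff ℝ ∞ f
  zero : ∀ x ∉ K, f x = 0

namespace Test

variable {K : Set (Space n)} {f g : Space n → ℝ} {x₀ : Space n}

theorem hasPD (hf : Test K f) (i : Fin n) (x : Space n) : HasPD i f (pd i f x) x :=
  ⟨hf.smooth.differentiable (by simp) x, rfl⟩

theorem pd (hK : IsClosed K) (hf : Test K f) (i : Fin n) : Test K (pd i f) := by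
  refine ⟨(hf.smooth.fderiv_right (m := ∞) (by simp)).clm_apply contDiff_const, fun x hx => ?_⟩
  have : f =ᶠ[nhds x] fun _ => 0 := by
    filter_upwards [hK.isOpen_compl.mem_nhds hx] with y hy using hf.zero y hy
  simp [Polyharmonic.pd, this.fderiv_eq]

theorem add (hf : Test K f) (hg : Test K g) : Test K (fun x => f x + g x) :=
  ⟨hf.smooth.add hg.smooth, fun x hx => by simp [hf.zero x hx, hg.zero x hx]⟩

theorem sub (hf : Test K f) (hg : Test K g) : Test K (fun x => f x - g x) :=
  ⟨hf.smooth.sub hg.smooth, fun x hx => by simp [hf.zero x hx, hg.zero x hx]⟩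

theorem mul (hf : Test K f) (hg : Test K g) : Test K (fun x => f x * g x) :=
  ⟨hf.smooth.mul hg.smooth, fun x hx => by simp [hf.zero x hx]⟩

theorem smooth_mul (hg : ContDiff ℝ ∞ g) (hf : Test K f) : Test K (fun x => g x * f x) :=
  ⟨hg.mul hf.smooth, fun x hx => by simp [hf.zero x hx]⟩

theorem const_mul (c : ℝ) (hf : Test K f) : Test K (fun x => c * f x) :=
  smooth_mul contDiff_const hf

theorem sum {ι : Type*} (s : Finset ι) {f : ι → Space n → ℝ} (hf : ∀ k ∈ s, Test K (f k)) :
    Test K (fun x => ∑ k ∈ s, f k x) :=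
  ⟨ContDiff.sum fun k hk => (hf k hk).smooth,
    fun x hx => Finset.sum_eq_zero fun k hk => (hf k hk).zero x hx⟩

theorem coord_mul (j : Fin n) (hf : Test K f) : Test K (fun x => (x j - x₀ j) * f x) :=
  smooth_mul (((EuclideanSpace.proj j : Space n →L[ℝ] ℝ).contDiff).sub contDiff_const) hf

/-- The weights are singular at the centre and at `r = 1`, but `K` stays away from both, and off `K`
the product vanishes near each point. -/
theorem weight_mul {w : Space n → ℝ} {U : Set (Space n)} (hU : IsOpen U)
    (hw : ContDiffOn ℝ ∞ w U) (hK : IsClosed K) (hKU : K ⊆ U) (hf : Test K f) :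
    Test K (fun x => w x * f x) := by
  refine ⟨contDiff_iff_contDiffAt.2 fun x => ?_, fun x hx => by simp [hf.zero x hx]⟩
  by_cases hx : x ∈ K
  · exact (hw.contDiffAt (hU.mem_nhds (hKU hx))).mul hf.smooth.contDiffAt
  · have : (fun x => w x * f x) =ᶠ[nhds x] fun _ => 0 := by
      filter_upwards [hK.isOpen_compl.mem_nhds hx] with y hy
      simp [hf.zero y hy]
    exact contDiffAt_const.congr_of_eventuallyEq this

theorem rad_mul {h : ℝ → ℝ} (hh : ContDiffOn ℝ ∞ h (Set.Iio 0)) (hK : IsClosed K)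
    (hKU : K ⊆ punctured x₀) (hf : Test K f) : Test K (fun x => rad x₀ h x * f x) :=
  hf.weight_mul (isOpen_punctured x₀) (contDiffOn_rad x₀ hh) hK hKU

theorem hasCompactSupport (hK : IsCompact K) (hf : Test K f) : HasCompactSupport f :=
  HasCompactSupport.intro hK hf.zero

theorem integrable (hK : IsCompact K) (hf : Test K f) : Integrable f :=
  hf.smooth.continuous.integrable_of_hasCompactSupport (hf.hasCompactSupport hK)

theorem integral_pd (hK : IsCompact K) (hf : Test K f) (i : Fin n) :
    ∫ x, Polyharmonic.pd i f x = 0 := by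
  have h := integral_mul_fderiv_eq_neg_fderiv_mul_of_integrable (μ := (volume : Measure (Space n)))
    (f := fun _ => (1 : ℝ)) (g := f) (v := EuclideanSpace.single i 1) (by simp)
    (by simpa [Polyharmonic.pd, Function.comp_def] using! (hf.pd hK.isClosed i).integrable hK) (by simpa using hf.integrable hK)
    (fun _ _ => differentiableAt_const _) (fun x _ => hf.smooth.differentiable (by simp) x)
  simpa [Polyharmonic.pd] using h

end Test

theorem pd_comm {f : Space n → ℝ} (hf : ContDiff ℝ ∞ f) (i j : Fin n) (x : Space n) :
    pd i (pd j f) x = pd j (pd i f) x := by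
  have hs : IsSymmSndFDerivAt ℝ f x := hf.contDiffAt.isSymmSndFDerivAt (by
    simpa using (WithTop.coe_le_coe.2 le_top : ((2 : ℕ∞) : WithTop ℕ∞) ≤ ((⊤ : ℕ∞) : WithTop ℕ∞)))
  have hd : DifferentiableAt ℝ (fderiv ℝ f) x :=
    (hf.fderiv_right (m := ∞) (by simp)).differentiable (by simp) x
  have key : ∀ a b : Space n, fderiv ℝ (fun y => fderiv ℝ f y a) x b
      = fderiv ℝ (fderiv ℝ f) x b a := by
    intro a b
    rw [fderiv_clm_apply hd (differentiableAt_const _)]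
    simp
  change fderiv ℝ (fun y => fderiv ℝ f y (EuclideanSpace.single j 1)) x _
    = fderiv ℝ (fun y => fderiv ℝ f y (EuclideanSpace.single i 1)) x _
  rw [key, key]
  exact hs.eq _ _

/-- The Laplacian of a real function, as the sum of the pure second derivatives. -/
noncomputable def lap (f : Space n → ℝ) : Space n → ℝ := fun x => ∑ i, pd i (pd i f) x

theorem Test.lap {K : Set (Space n)} {f : Space n → ℝ} (hK : IsClosed K) (hf : Test K f) :
    Test K (lap f) :=
  Test.sum _ fun i _ => (hf.pd hK i).pd hK i

/-- The Euler derivative `(x - x₀) · ∇ f`. -/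
noncomputable def euler (x₀ : Space n) (f : Space n → ℝ) : Space n → ℝ :=
  fun x => ∑ i, (x i - x₀ i) * pd i f x

theorem Test.euler {K : Set (Space n)} {f : Space n → ℝ} (x₀ : Space n) (hK : IsClosed K)
    (hf : Test K f) : Test K (euler x₀ f) :=
  Test.sum _ fun i _ => (hf.pd hK i).coord_mul i

end

/-! ### The Euler field, integration by parts for `r^{-n} dx`, and the weights. -/

section

variable {n : ℕ}

theorem euler_eq_fderiv (x₀ : Space n) (f : Space n → ℝ) (x : Space n) :
    euler x₀ f x = fderiv ℝ f x (x - x₀) := by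
  have h : x - x₀ = ∑ i, (x i - x₀ i) • (EuclideanSpace.single i (1 : ℝ) : Space n) := by
    ext j
    simp [Finset.sum_apply, Pi.single_apply]
  conv_rhs => rw [h]
  simp [euler, pd]

/-- `f` is differentiable at `x` with Euler derivative `d`. -/
def HasEuler (x₀ : Space n) (f : Space n → ℝ) (d : ℝ) (x : Space n) : Prop :=
  DifferentiableAt ℝ f x ∧ euler x₀ f x = d

namespace HasEuler

variable {x₀ : Space n} {f g : Space n → ℝ} {a b : ℝ} {x : Space n}

theorem sub (hf : HasEuler x₀ f a x) (hg : HasEuler x₀ g b x) :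
    HasEuler x₀ (fun y => f y - g y) (a - b) x := by
  refine ⟨hf.1.sub hg.1, ?_⟩
  rw [← hf.2, ← hg.2, euler_eq_fderiv, fderiv_fun_sub hf.1 hg.1]
  simp [euler_eq_fderiv]

theorem mul (hf : HasEuler x₀ f a x) (hg : HasEuler x₀ g b x) :
    HasEuler x₀ (fun y => f y * g y) (a * g x + f x * b) x := by
  refine ⟨hf.1.mul hg.1, ?_⟩
  rw [← hf.2, ← hg.2, euler_eq_fderiv, fderiv_fun_mul hf.1 hg.1]
  simp [euler_eq_fderiv]
  ring

theorem sum {ι : Type*} (s : Finset ι) {f : ι → Space n → ℝ} {a : ι → ℝ}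
    (hf : ∀ k ∈ s, HasEuler x₀ (f k) (a k) x) :
    HasEuler x₀ (fun y => ∑ k ∈ s, f k y) (∑ k ∈ s, a k) x := by
  refine ⟨DifferentiableAt.fun_sum fun k hk => (hf k hk).1, ?_⟩
  rw [euler_eq_fderiv, fderiv_fun_sum fun k hk => (hf k hk).1]
  simp only [_root_.sum_apply]
  exact Finset.sum_congr rfl fun k hk => by rw [← (hf k hk).2, euler_eq_fderiv]

theorem congr_deriv (hf : HasEuler x₀ f a x) (h : a = b) : HasEuler x₀ f b x := h ▸ hf

end HasEuler

theorem hasEuler_coord (x₀ : Space n) (j : Fin n) (x : Space n) :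
    HasEuler x₀ (fun y => y j - x₀ j) (x j - x₀ j) x := by
  refine ⟨(hasPD_coord x₀ j j x).1, ?_⟩
  simp [euler, (hasPD_coord x₀ _ j x).2]

theorem hasEuler_rad {x₀ x : Space n} (hx : x ∈ punctured x₀) {h : ℝ → ℝ} {h' : ℝ}
    (hh : HasDerivAt h h' (Real.log ‖x - x₀‖)) : HasEuler x₀ (rad x₀ h) h' x := by
  have h0 := norm_pos_of_mem hx
  have hd : DifferentiableAt ℝ (rad x₀ h) x :=
    hh.differentiableAt.comp x (f := fun y => Real.log ‖y - x₀‖)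
      ((((differentiableAt_id).sub_const x₀).norm ℝ (sub_ne_zero.2 hx.2)).log h0.ne')
  refine ⟨hd, ?_⟩
  have e : ∀ i : Fin n, (x i - x₀ i) * pd i (rad x₀ h) x
      = h' / ‖x - x₀‖ ^ 2 * (x i - x₀ i) ^ 2 := by
    intro i
    rw [(hasPD_rad hx hh i).2]
    ring
  simp only [euler, e, ← Finset.mul_sum, ← norm_sub_sq]
  field_simp

theorem Test.hasEuler {K : Set (Space n)} {f : Space n → ℝ} (x₀ : Space n) (hf : Test K f)
    (x : Space n) : HasEuler x₀ f (Polyharmonic.euler x₀ f x) x :=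
  ⟨hf.smooth.differentiable (by simp) x, rfl⟩

theorem contDiff_exp_mul (a : ℝ) : ContDiff ℝ ∞ fun t : ℝ => Real.exp (a * t) :=
  Real.contDiff_exp.comp (contDiff_const.mul contDiff_id)

theorem hasDerivAt_exp_mul (a t : ℝ) :
    HasDerivAt (fun t : ℝ => Real.exp (a * t)) (a * Real.exp (a * t)) t := by
  have := ((hasDerivAt_id t).const_mul a).exp
  simp only [id, mul_one] at this
  rwa [mul_comm] at this

theorem rad_exp_mul_nat {x₀ x : Space n} (hx : x ∈ punctured x₀) (k : ℕ) :
    Real.exp (k * Real.log ‖x - x₀‖) = ‖x - x₀‖ ^ k := by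
  rw [← Real.log_pow, Real.exp_log (pow_pos (norm_pos_of_mem hx) k)]

variable {K : Set (Space n)} {x₀ : Space n}

theorem integral_sum_pd {F : Fin n → Space n → ℝ} (hK : IsCompact K) (hF : ∀ i, Test K (F i)) :
    ∫ x, ∑ i, pd i (F i) x = 0 := by
  rw [integral_finsetSum _ fun i _ => ((hF i).pd hK.isClosed i).integrable hK]
  exact Finset.sum_eq_zero fun i _ => (hF i).integral_pd hK i

/-- The Euler field is divergence free for `r^{-n} dx`. -/
theorem integral_euler {H : Space n → ℝ} (hK : IsCompact K) (hKU : K ⊆ punctured x₀)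
    (hH : Test K H) :
    ∫ x, rad x₀ (fun t => Real.exp (-(n : ℝ) * t)) x * euler x₀ H x = 0 := by
  have hq : ContDiffOn ℝ ∞ (fun t : ℝ => Real.exp (-(n : ℝ) * t)) (Set.Iio 0) :=
    (contDiff_exp_mul _).contDiffOn
  -- The field is `r^{-n} (x - x₀) H`. Since `r^{-n} (x - x₀)` is divergence free off the centre,
  -- only the Euler derivative of `H` survives.
  have hF : ∀ i : Fin n, Test K (fun x => rad x₀ (fun t => Real.exp (-(n : ℝ) * t)) x
      * ((x i - x₀ i) * H x)) := fun i => (hH.coord_mul i).rad_mul hq hK.isClosed hKU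
  rw [← integral_sum_pd hK hF]
  congr 1
  ext x
  by_cases hx : x ∈ K
  · have h0 := norm_pos_of_mem (hKU hx)
    have e : ∀ i, pd i (fun x => rad x₀ (fun t => Real.exp (-(n : ℝ) * t)) x
        * ((x i - x₀ i) * H x)) x
        = rad x₀ (fun t => Real.exp (-(n : ℝ) * t)) x *
          (-(n : ℝ) * H x / ‖x - x₀‖ ^ 2 * (x i - x₀ i) ^ 2 + H x
            + (x i - x₀ i) * pd i H x) := by
      intro i
      rw [((hasPD_rad (hKU hx) (hasDerivAt_exp_mul (-(n : ℝ)) _) i).mul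
        ((hasPD_coord x₀ i i x).mul (hH.hasPD i x))).2]
      simp only [rad, if_true]
      ring
    simp only [e, ← Finset.mul_sum, Finset.sum_add_distrib, ← norm_sub_sq, euler]
    congr 1
    simp
    field_simp
    ring
  · rw [(hH.euler x₀ hK.isClosed).zero x hx, mul_zero]
    exact (Finset.sum_eq_zero fun i _ => ((hF i).pd hK.isClosed i).zero x hx).symm

/-- Green's identity for `r² Δ` and the measure `r^{-n} dx`. -/
theorem integral_green {v A : Space n → ℝ} (hK : IsCompact K) (hKU : K ⊆ punctured x₀)
    (hv : Test K v) (hA : Test K A) :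
    ∫ x, rad x₀ (fun t => Real.exp (-(n : ℝ) * t)) x *
      (‖x - x₀‖ ^ 2 * lap v x * A x - (n - 2) * euler x₀ v x * A x
        + ‖x - x₀‖ ^ 2 * ∑ i, pd i v x * pd i A x) = 0 := by
  have hq : ContDiffOn ℝ ∞ (fun t : ℝ => Real.exp ((2 - n : ℝ) * t)) (Set.Iio 0) :=
    (contDiff_exp_mul _).contDiffOn
  -- The field is `r^{2-n} A ∇v`; differentiating `r^{2-n}` produces the first order term with
  -- factor `n - 2`.
  have hF : ∀ i : Fin n, Test K (fun x => rad x₀ (fun t => Real.exp ((2 - n : ℝ) * t)) x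
      * (pd i v x * A x)) := fun i =>
    ((hv.pd hK.isClosed i).mul hA).rad_mul hq hK.isClosed hKU
  rw [← integral_sum_pd hK hF]
  congr 1
  ext x
  by_cases hx : x ∈ K
  · have h0 := norm_pos_of_mem (hKU hx)
    have eq : rad x₀ (fun t => Real.exp ((2 - n : ℝ) * t)) x
        = rad x₀ (fun t => Real.exp (-(n : ℝ) * t)) x * ‖x - x₀‖ ^ 2 := by
      rw [← rad_exp_mul_nat (hKU hx) 2]
      simp only [rad, ← Real.exp_add]
      congr 1
      push_cast
      ring
    have e : ∀ i, pd i (fun x => rad x₀ (fun t => Real.exp ((2 - n : ℝ) * t)) x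
        * (pd i v x * A x)) x
        = rad x₀ (fun t => Real.exp (-(n : ℝ) * t)) x *
          ((2 - n) * A x * ((x i - x₀ i) * pd i v x)
            + ‖x - x₀‖ ^ 2 * A x * pd i (pd i v) x
            + ‖x - x₀‖ ^ 2 * (pd i v x * pd i A x)) := by
      intro i
      rw [((hasPD_rad (hKU hx) (hasDerivAt_exp_mul (2 - n : ℝ) _) i).mul
        (((hv.pd hK.isClosed i).hasPD i x).mul (hA.hasPD i x))).2]
      change (2 - n : ℝ) * rad x₀ (fun t => Real.exp ((2 - n : ℝ) * t)) x * _ * _ + _ = _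
      rw [eq]
      field_simp
      ring
    simp only [e, ← Finset.mul_sum, Finset.sum_add_distrib, euler, lap]
    ring
  · have h1 := (hv.euler x₀ hK.isClosed).zero x hx
    have h2 := hA.zero x hx
    have h3 : ∀ i, pd i v x = 0 := fun i => (hv.pd hK.isClosed i).zero x hx
    rw [Finset.sum_eq_zero fun i _ => ((hF i).pd hK.isClosed i).zero x hx]
    simp [h1, h2, h3]

/-- The weight profile `t ↦ e^{-σ t} (-t)^{-ρ}`, which is `r^{-σ} (-log r)^{-ρ}` for `t = log r`. -/
noncomputable def profile (σ ρ t : ℝ) : ℝ := Real.exp (-σ * t) * (-t) ^ (-ρ)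

theorem contDiffOn_profile (σ ρ : ℝ) : ContDiffOn ℝ ∞ (profile σ ρ) (Set.Iio 0) := by
  refine (contDiff_exp_mul (-σ)).contDiffOn.mul ?_
  exact contDiffOn_id.neg.rpow_const_of_ne fun t ht => by
    have : t < 0 := ht
    simp [this.ne]

theorem hasDerivAt_profile (σ ρ : ℝ) {t : ℝ} (ht : t < 0) :
    HasDerivAt (profile σ ρ) (-(σ + ρ / t) * profile σ ρ t) t := by
  have h1 : HasDerivAt (fun t : ℝ => (-t) ^ (-ρ)) (-1 * (-ρ) * (-t) ^ (-ρ - 1)) t :=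
    (hasDerivAt_neg t).rpow_const (Or.inl (by linarith))
  refine ((hasDerivAt_exp_mul (-σ) t).mul h1).congr_deriv ?_
  rw [Real.rpow_sub_one (by linarith), profile]
  field_simp
  ring

theorem profile_pos (σ ρ : ℝ) {t : ℝ} (ht : t < 0) : 0 < profile σ ρ t :=
  mul_pos (Real.exp_pos _) (Real.rpow_pos_of_pos (by linarith) _)

/-- The weight `r^{-σ} (-log r)^{-ρ}` with `r = |x - x₀|`. -/
noncomputable def wt (x₀ : Space n) (σ ρ : ℝ) : Space n → ℝ := rad x₀ (profile σ ρ)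

theorem Test.wt_mul {f : Space n → ℝ} (hK : IsClosed K)
    (hKU : K ⊆ punctured x₀) (σ ρ : ℝ) (hf : Test K f) : Test K (fun x => wt x₀ σ ρ x * f x) :=
  hf.rad_mul (contDiffOn_profile σ ρ) hK hKU

theorem wt_pos {x : Space n} (hx : x ∈ punctured x₀) (σ ρ : ℝ) : 0 < wt x₀ σ ρ x :=
  profile_pos σ ρ (log_neg_of_mem hx)

theorem hasPD_wt {x : Space n} (hx : x ∈ punctured x₀) (σ ρ : ℝ) (i : Fin n) :
    HasPD i (wt x₀ σ ρ) (-(σ + ρ / Real.log ‖x - x₀‖) * ((x i - x₀ i) / ‖x - x₀‖ ^ 2)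
      * wt x₀ σ ρ x) x := by
  refine (hasPD_rad hx (hasDerivAt_profile σ ρ (log_neg_of_mem hx)) i).congr_deriv ?_
  rw [wt, rad]
  ring

theorem wt_sub_nat {x : Space n} (hx : x ∈ punctured x₀) (σ ρ : ℝ) (k : ℕ) :
    wt x₀ (σ - k) ρ x = wt x₀ σ ρ x * ‖x - x₀‖ ^ k := by
  rw [← rad_exp_mul_nat hx]
  simp only [wt, rad, profile]
  rw [mul_right_comm, ← Real.exp_add]
  congr 2
  ring

theorem wt_add_one_right {x : Space n} (hx : x ∈ punctured x₀) (σ ρ : ℝ) :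
    wt x₀ σ (ρ + 1) x = wt x₀ σ ρ x / -Real.log ‖x - x₀‖ := by
  have h := log_neg_of_mem hx
  simp only [wt, rad, profile]
  rw [neg_add, ← sub_eq_add_neg, Real.rpow_sub_one (by linarith)]
  ring

/-- This turns `L²(r^{-n} dx)` into unweighted `L²` at the price of `σ ↦ σ + n/2`. -/
theorem rad_exp_mul_wt_sq {x : Space n} (σ ρ : ℝ) :
    rad x₀ (fun t => Real.exp (-(n : ℝ) * t)) x * wt x₀ σ ρ x ^ 2
      = wt x₀ (σ + n / 2) ρ x ^ 2 := by
  simp only [wt, rad, profile, mul_pow, ← Real.exp_nat_mul]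
  rw [← mul_assoc, ← Real.exp_add]
  congr 2
  push_cast
  ring

end

/-! ### The Carleman estimate for one Laplacian. -/

section

variable {n : ℕ} {K : Set (Space n)} {x₀ : Space n}

/-- An identity of functions and not only at points of `K`, so that it can be differentiated once
more in `wt_mul_lap`. -/
theorem pd_wt_mul {u : Space n → ℝ} (hK : IsClosed K) (hKU : K ⊆ punctured x₀) (hu : Test K u)
    (σ ρ : ℝ) (i : Fin n) :
    pd i (fun x => wt x₀ σ ρ x * u x) = fun x => wt x₀ σ ρ x * pd i u x
      - rad x₀ (fun t => (σ + ρ / t) * Real.exp (-2 * t)) x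
        * ((x i - x₀ i) * (wt x₀ σ ρ x * u x)) := by
  ext x
  by_cases hx : x ∈ K
  · have h0 := norm_pos_of_mem (hKU hx)
    have h2 : Real.exp (-2 * Real.log ‖x - x₀‖) = (‖x - x₀‖ ^ 2)⁻¹ := by
      rw [← rad_exp_mul_nat (hKU hx), ← Real.exp_neg]
      push_cast
      ring_nf
    rw [((hasPD_wt (hKU hx) σ ρ i).mul (hu.hasPD i x)).2]
    simp only [rad]
    rw [h2]
    field_simp
    ring
  · rw [((hu.wt_mul hK hKU σ ρ).pd hK i).zero x hx, hu.zero x hx, (hu.pd hK i).zero x hx]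
    ring

/-- Conjugation of `r² Δ` with a radial weight. -/
theorem wt_mul_lap {u : Space n → ℝ} (hK : IsClosed K) (hKU : K ⊆ punctured x₀) (hu : Test K u)
    (σ ρ : ℝ) {x : Space n} (hx : x ∈ K) :
    ‖x - x₀‖ ^ 2 * (wt x₀ σ ρ x * lap u x) =
      ‖x - x₀‖ ^ 2 * lap (fun x => wt x₀ σ ρ x * u x) x
      + 2 * (σ + ρ / Real.log ‖x - x₀‖) * euler x₀ (fun x => wt x₀ σ ρ x * u x) x
      + ((σ + ρ / Real.log ‖x - x₀‖) ^ 2 - ρ / Real.log ‖x - x₀‖ ^ 2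
        + (n - 2) * (σ + ρ / Real.log ‖x - x₀‖)) * (wt x₀ σ ρ x * u x) := by
  have hU := hKU hx
  have h0 := norm_pos_of_mem hU
  have ht := log_neg_of_mem hU
  have h2 : Real.exp (-2 * Real.log ‖x - x₀‖) = (‖x - x₀‖ ^ 2)⁻¹ := by
    rw [← rad_exp_mul_nat hU, ← Real.exp_neg]
    push_cast
    ring_nf
  set v : Space n → ℝ := fun x => wt x₀ σ ρ x * u x with hv
  have hvT : Test K v := hu.wt_mul hK hKU σ ρ
  set r := ‖x - x₀‖ with hr
  set t := Real.log r with htdef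
  set W := wt x₀ σ ρ x with hW
  have hprof : HasDerivAt (fun t => (σ + ρ / t) * Real.exp (-2 * t))
      ((-(ρ / t ^ 2) - 2 * (σ + ρ / t)) * Real.exp (-2 * t)) t := by
    have h1 : HasDerivAt (fun t : ℝ => σ + ρ / t) (-(ρ / t ^ 2)) t := by
      refine (((hasDerivAt_inv ht.ne).const_mul ρ).const_add σ).congr_deriv ?_
      ring
    refine (h1.mul (hasDerivAt_exp_mul (-2) t)).congr_deriv ?_
    ring
  have e1 : ∀ i, W * pd i u x = pd i v x + (σ + ρ / t) / r ^ 2 * (x i - x₀ i) * v x := by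
    intro i
    rw [hv, pd_wt_mul hK hKU hu]
    simp only [rad]
    rw [← hr, ← htdef, h2]
    field_simp
    ring
  have e2 : ∀ i, pd i (pd i v) x = -(σ + ρ / t) / r ^ 2 * ((x i - x₀ i) * (W * pd i u x))
      + W * pd i (pd i u) x
      - ((-(ρ / t ^ 2) - 2 * (σ + ρ / t)) / r ^ 4 * v x * (x i - x₀ i) ^ 2
        + (σ + ρ / t) / r ^ 2 * v x + (σ + ρ / t) / r ^ 2 * ((x i - x₀ i) * pd i v x)) := by
    intro i
    conv_lhs => rw [hv, pd_wt_mul hK hKU hu]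
    rw [(((hasPD_wt hU σ ρ i).mul ((hu.pd hK i).hasPD i x)).sub
      ((hasPD_rad hU hprof i).mul ((hasPD_coord x₀ i i x).mul (hvT.hasPD i x)))).2]
    simp only [rad, if_true]
    rw [← hr, ← htdef, h2, ← hW]
    field_simp
    ring
  have e3 : ∑ i, (x i - x₀ i) * (W * pd i u x) = euler x₀ v x + (σ + ρ / t) * v x := by
    have : ∀ i, (x i - x₀ i) * (W * pd i u x)
        = (x i - x₀ i) * pd i v x + (σ + ρ / t) / r ^ 2 * v x * (x i - x₀ i) ^ 2 := by
      intro i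
      rw [e1]
      ring
    simp only [this, Finset.sum_add_distrib, ← Finset.mul_sum, ← norm_sub_sq, euler]
    rw [← hr]
    field_simp
  have e4 : lap v x = -(σ + ρ / t) / r ^ 2 * (euler x₀ v x + (σ + ρ / t) * v x) + W * lap u x
      - ((-(ρ / t ^ 2) - 2 * (σ + ρ / t)) / r ^ 4 * v x * r ^ 2
        + n * ((σ + ρ / t) / r ^ 2 * v x) + (σ + ρ / t) / r ^ 2 * euler x₀ v x) := by
    rw [← e3]
    simp only [lap, e2, Finset.sum_add_distrib, Finset.sum_sub_distrib, ← Finset.mul_sum,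
      ← norm_sub_sq, euler]
    simp
    ring
  rw [e4]
  field_simp
  ring

theorem integral_mono_test {F G : Space n → ℝ} (hK : IsCompact K) (hF : Test K F)
    (hG : Test K G) (h : ∀ x ∈ K, F x ≤ G x) : ∫ x, F x ≤ ∫ x, G x := by
  refine integral_mono (hF.integrable hK) (hG.integrable hK) fun x => ?_
  by_cases hx : x ∈ K
  · exact h x hx
  · simp [hF.zero x hx, hG.zero x hx]

theorem hasDerivAt_inv_pow {t : ℝ} (ht : t ≠ 0) (a : ℝ) (k : ℕ) :
    HasDerivAt (fun t : ℝ => a / t ^ k) (-(k * a) / t ^ (k + 1)) t := by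
  have h := ((hasDerivAt_pow k t).fun_inv (pow_ne_zero k ht)).const_mul a
  refine (h.congr_deriv ?_)
  rcases k with _ | k
  · simp
  · simp
    field_simp
    ring

/-- The right side is `ρ (c² - 6/t²) y²/t²` for the coefficient `c` of the skew part. From `ρ ≤ 4σ`
and `t ≤ -8` one gets `2ρ/|t| ≤ σ`, hence `c ≥ σ`, and `6/t² ≤ 1/2` is absorbed. This fixes the
radius `e^{-8}` used throughout. -/
theorem carleman_coefficient {σ ρ t N : ℝ} (ht : t ≤ -8) (hσ : 1 ≤ σ) (hσρ : σ ≤ ρ)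
    (hρσ : ρ ≤ 4 * σ) (hN : 0 ≤ N) (y : ℝ) :
    σ ^ 3 / 2 * (y ^ 2 / t ^ 2) ≤ 1 / 2 * (-(12 * ρ) / t ^ 4
      - (2 * σ + N + 2 * ρ / t ^ 1) ^ 2 * (-(2 * ρ) / t ^ 2)) * y ^ 2 := by
  have ht0 : t < 0 := by linarith
  have hcσ : σ ≤ 2 * σ + N + 2 * ρ / t ^ 1 := by
    have h1 : 2 * ρ / t ^ 1 ≥ -σ := by
      rw [pow_one, ge_iff_le, le_div_iff_of_neg ht0]
      nlinarith
    linarith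
  generalize 2 * σ + N + 2 * ρ / t ^ 1 = c at *
  have h1 : 1 / 2 * (-(12 * ρ) / t ^ 4 - c ^ 2 * (-(2 * ρ) / t ^ 2)) * y ^ 2
      = ρ * (c ^ 2 - 6 / t ^ 2) * (y ^ 2 / t ^ 2) := by
    have := ht0.ne
    field_simp
    ring
  rw [h1]
  refine mul_le_mul_of_nonneg_right ?_ (by positivity)
  have h2 : 6 / t ^ 2 ≤ 1 / 2 := by
    rw [div_le_iff₀ (by nlinarith)]
    nlinarith
  have h3 : σ ^ 2 ≤ c ^ 2 := by gcongr
  have h4 : σ ^ 2 / 2 ≤ c ^ 2 - 6 / t ^ 2 := by nlinarith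
  calc σ ^ 3 / 2 = σ * (σ ^ 2 / 2) := by ring
    _ ≤ ρ * (σ ^ 2 / 2) := by gcongr
    _ ≤ _ := mul_le_mul_of_nonneg_left h4 (by linarith)

set_option maxHeartbeats 1000000 in
/-- The Carleman estimate of order zero for the Laplacian and the weight
`r^{-σ} (-log r)^{-ρ}`. -/
theorem carleman_lap (hn : 2 ≤ n) {u : Space n → ℝ} (hK : IsCompact K)
    (hKR : K ⊆ Metric.ball x₀ (Real.exp (-8)) \ {x₀}) (hu : Test K u) {σ ρ : ℝ} (hσ : 1 ≤ σ)
    (hσρ : σ ≤ ρ) (hρσ : ρ ≤ 4 * σ) :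
    σ ^ 3 / 2 * ∫ x, (wt x₀ (σ + n / 2) (ρ + 1) x * u x) ^ 2
      ≤ ∫ x, (wt x₀ (σ + n / 2 - 2) ρ x * lap u x) ^ 2 := by
  have hKU : K ⊆ punctured x₀ := hKR.trans
    (Set.sdiff_subset_sdiff_left (Metric.ball_subset_ball (by rw [Real.exp_le_one_iff]; norm_num)))
  have hKc := hK.isClosed
  have ht8 : ∀ x ∈ K, Real.log ‖x - x₀‖ ≤ -8 := by
    intro x hx
    have h1 : ‖x - x₀‖ < Real.exp (-8) := by simpa [dist_eq_norm] using (hKR hx).1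
    have := Real.log_le_log (norm_pos_of_mem (hKU hx)) h1.le
    rwa [Real.log_exp] at this
  set v : Space n → ℝ := fun x => wt x₀ σ ρ x * u x with hv
  have hvT : Test K v := hu.wt_mul hKc hKU σ ρ
  set N : ℝ := n - 2 with hN
  have hN0 : 0 ≤ N := by
    have : (2 : ℝ) ≤ n := by exact_mod_cast hn
    linarith
  -- the coefficient `c` of the skew part and its derivatives
  set c : ℝ → ℝ := fun t => 2 * σ + N + 2 * ρ / t ^ 1 with hc
  set c1 : ℝ → ℝ := fun t => -(2 * ρ) / t ^ 2 with hc1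
  set c2 : ℝ → ℝ := fun t => 4 * ρ / t ^ 3 with hc2
  have dc : ∀ t < 0, HasDerivAt c (c1 t) t := fun t ht => by
    refine ((hasDerivAt_inv_pow (ne_of_lt ht) (2 * ρ) 1).const_add _).congr_deriv ?_
    simp [hc1]
  have dc1 : ∀ t < 0, HasDerivAt c1 (c2 t) t := fun t ht => by
    refine (hasDerivAt_inv_pow (ne_of_lt ht) (-(2 * ρ)) 2).congr_deriv ?_
    simp only [hc2]
    push_cast
    ring
  have dc2 : ∀ t < 0, HasDerivAt c2 (-(12 * ρ) / t ^ 4) t := fun t ht => by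
    refine (hasDerivAt_inv_pow (ne_of_lt ht) (4 * ρ) 3).congr_deriv ?_
    push_cast
    ring
  have sp : ∀ (a : ℝ) (k : ℕ), ContDiffOn ℝ ∞ (fun t : ℝ => a / t ^ k) (Set.Iio 0) :=
    fun a k => contDiffOn_const.div (contDiffOn_id.pow k) fun t ht => pow_ne_zero k (ne_of_lt ht)
  have sc : ContDiffOn ℝ ∞ c (Set.Iio 0) := contDiffOn_const.add (sp _ _)
  have sc1 : ContDiffOn ℝ ∞ c1 (Set.Iio 0) := sp _ _
  -- With `S v = r²Δv - N Ev + (c² - N²)/4 · v` and `E` the Euler derivative, apply Green's identity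
  -- to `2 Sv · Av`. All that remains, except `-2c'(Ev)²` and `½(c''' - c²c')v²`, is the Euler
  -- derivative of `l v² - c r²|∇v|²`. The profile `l` is chosen for this.
  set l : ℝ → ℝ := fun t => -(1 / 2) * c2 t + 1 / 4 * ((c t * c t - N ^ 2) * c t) with hl
  have sl : ContDiffOn ℝ ∞ l (Set.Iio 0) :=
    (contDiffOn_const.mul (sp _ _)).add
      (contDiffOn_const.mul (((sc.mul sc).sub contDiffOn_const).mul sc))
  have dl : ∀ t < 0, HasDerivAt l (-(1 / 2) * (-(12 * ρ) / t ^ 4)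
      + 1 / 4 * ((c1 t * c t + c t * c1 t) * c t + (c t * c t - N ^ 2) * c1 t)) t := fun t ht =>
    ((dc2 t ht).const_mul _).add
      (((((dc t ht).mul (dc t ht)).sub_const _).mul (dc t ht)).const_mul _)
  -- the skew part
  set A : Space n → ℝ := fun x => rad x₀ c x * euler x₀ v x
    + 1 / 2 * (rad x₀ c1 x * v x) with hA
  have heT : Test K (euler x₀ v) := hvT.euler x₀ hKc
  have hAT : Test K A := (heT.rad_mul sc hKc hKU).add
    ((hvT.rad_mul sc1 hKc hKU).const_mul _)
  -- This is `r²|∇v|²`, with `r²` written as a sum of squares so that the product rule for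
  -- `HasEuler` applies termwise.
  set M : Space n → ℝ := fun x => (∑ j, (x j - x₀ j) * (x j - x₀ j))
    * ∑ i, pd i v x * pd i v x with hM
  have hMT : Test K M := by
    have h1 : Test K fun x => ∑ i, pd i v x * pd i v x :=
      Test.sum _ fun i _ => (hvT.pd hKc i).mul (hvT.pd hKc i)
    refine h1.smooth_mul (ContDiff.sum fun j _ => ?_)
    have : ContDiff ℝ ∞ fun x : Space n => x j - x₀ j :=
      ((EuclideanSpace.proj j : Space n →L[ℝ] ℝ).contDiff).sub contDiff_const
    exact this.mul this
  set H : Space n → ℝ := fun x => rad x₀ l x * (v x * v x) - rad x₀ c x * M x with hH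
  have hHT : Test K H := ((hvT.mul hvT).rad_mul sl hKc hKU).sub (hMT.rad_mul sc hKc hKU)
  set q : Space n → ℝ := rad x₀ (fun t => Real.exp (-(n : ℝ) * t)) with hq
  have hqs : ContDiffOn ℝ ∞ (fun t : ℝ => Real.exp (-(n : ℝ) * t)) (Set.Iio 0) :=
    (contDiff_exp_mul _).contDiffOn
  set D : Space n → ℝ := fun x => q x * (‖x - x₀‖ ^ 2 * lap v x * A x - (n - 2) * euler x₀ v x * A x
        + ‖x - x₀‖ ^ 2 * ∑ i, pd i v x * pd i A x) with hD
  have hDT : Test K D := by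
    have hr : ContDiff ℝ ∞ fun x : Space n => ‖x - x₀‖ ^ 2 :=
      (contDiff_id.sub contDiff_const).norm_sq ℝ
    refine Test.rad_mul (x₀ := x₀) hqs hKc hKU ?_
    refine ((((hvT.lap hKc).smooth_mul hr).mul hAT).sub
      ((heT.const_mul _).mul hAT)).add (Test.smooth_mul hr ?_)
    exact Test.sum _ fun i _ => (hvT.pd hKc i).mul (hAT.pd hKc i)
  have hDint : ∫ x, D x = 0 := integral_green hK hKU hvT hAT
  have hHint := integral_euler hK hKU hHT
  have hET : Test K fun x => q x * euler x₀ H x := (hHT.euler x₀ hKc).rad_mul hqs hKc hKU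
  have hLT : Test K fun x => σ ^ 3 / 2 * (wt x₀ (σ + n / 2) (ρ + 1) x * u x) ^ 2 := by
    have h1 := hu.wt_mul hKc hKU (σ + n / 2) (ρ + 1)
    simpa only [sq] using (h1.mul h1).const_mul (σ ^ 3 / 2)
  have hRT : Test K fun x => (wt x₀ (σ + n / 2 - 2) ρ x * lap u x) ^ 2 := by
    have h1 := (hu.lap hKc).wt_mul hKc hKU (σ + n / 2 - 2) ρ
    simpa only [sq] using h1.mul h1
  -- A pointwise inequality with two exact terms: `D` and `q` times the Euler derivative of `H` both
  -- integrate to zero.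
  have key : ∀ x ∈ K, 2 * D x + q x * euler x₀ H x
      + σ ^ 3 / 2 * (wt x₀ (σ + n / 2) (ρ + 1) x * u x) ^ 2
      ≤ (wt x₀ (σ + n / 2 - 2) ρ x * lap u x) ^ 2 := by
    intro x hx
    have hU := hKU hx
    have h0 := norm_pos_of_mem hU
    have ht := log_neg_of_mem hU
    have hconj := wt_mul_lap hKc hKU hu σ ρ hx
    have e1 : (wt x₀ (σ + n / 2 - 2) ρ x * lap u x) ^ 2
        = q x * (‖x - x₀‖ ^ 2 * (wt x₀ σ ρ x * lap u x)) ^ 2 := by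
      have := wt_sub_nat hU (σ + n / 2) ρ 2
      push_cast at this
      rw [this, mul_pow, mul_pow, ← rad_exp_mul_wt_sq]
      ring
    have e2 : (wt x₀ (σ + n / 2) (ρ + 1) x * u x) ^ 2
        = q x * (v x ^ 2 / Real.log ‖x - x₀‖ ^ 2) := by
      rw [wt_add_one_right hU, mul_pow, div_pow, ← rad_exp_mul_wt_sq]
      simp only [hv]
      ring
    have hqpos : 0 < q x := Real.exp_pos _
    rw [e1, e2, hconj]
    simp only [hD]
    rw [← hN]
    have eS : ∀ i, ∑ j, (x j - x₀ j) * pd i (pd j v) x = ∑ j, (x j - x₀ j) * pd j (pd i v) x :=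
      fun i => Finset.sum_congr rfl fun j _ => by rw [pd_comm hvT.smooth]
    -- derivatives of `A` and of `M`
    have ePA : ∀ i, pd i A x = c1 (Real.log ‖x - x₀‖) * ((x i - x₀ i) / ‖x - x₀‖ ^ 2)
          * euler x₀ v x
        + c (Real.log ‖x - x₀‖) * (pd i v x + euler x₀ (pd i v) x)
        + 1 / 2 * (c2 (Real.log ‖x - x₀‖) * ((x i - x₀ i) / ‖x - x₀‖ ^ 2) * v x
          + c1 (Real.log ‖x - x₀‖) * pd i v x) := by
      intro i
      have hE : HasPD i (euler x₀ v) (pd i v x + euler x₀ (pd i v) x) x := by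
        refine (HasPD.sum Finset.univ fun j _ =>
          (hasPD_coord x₀ i j x).mul ((hvT.pd hKc j).hasPD i x)).congr_deriv ?_
        rw [Finset.sum_add_distrib, eS]
        simp [euler]
      exact (((hasPD_rad hU (dc _ ht) i).mul hE).add
        (((hasPD_rad hU (dc1 _ ht) i).mul (hvT.hasPD i x)).const_mul _)).2
    have eM : HasEuler x₀ M (2 * ‖x - x₀‖ ^ 2 * ∑ i, pd i v x * pd i v x
        + ‖x - x₀‖ ^ 2 * (2 * ∑ i, pd i v x * euler x₀ (pd i v) x)) x := by
      refine ((HasEuler.sum Finset.univ fun j _ =>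
        (hasEuler_coord x₀ j x).mul (hasEuler_coord x₀ j x)).mul
        (HasEuler.sum Finset.univ fun i _ => ((hvT.pd hKc i).hasEuler x₀ x).mul
          ((hvT.pd hKc i).hasEuler x₀ x))).congr_deriv ?_
      rw [norm_sub_sq]
      simp only [Finset.sum_add_distrib, ← sq, mul_comm (euler x₀ _ x)]
      ring
    have eMx : M x = ‖x - x₀‖ ^ 2 * ∑ i, pd i v x * pd i v x := by
      rw [norm_sub_sq]
      simp only [hM, sq]
    have eG : ‖x - x₀‖ ^ 2 * ∑ i, pd i v x * pd i A x
        = c1 (Real.log ‖x - x₀‖) * euler x₀ v x ^ 2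
        + c (Real.log ‖x - x₀‖) * ‖x - x₀‖ ^ 2 * (∑ i, pd i v x * pd i v x
          + ∑ i, pd i v x * euler x₀ (pd i v) x)
        + 1 / 2 * (c2 (Real.log ‖x - x₀‖) * v x * euler x₀ v x
          + c1 (Real.log ‖x - x₀‖) * ‖x - x₀‖ ^ 2 * ∑ i, pd i v x * pd i v x) := by
      have : ∀ i, pd i v x * pd i A x
          = (c1 (Real.log ‖x - x₀‖) * euler x₀ v x + 1 / 2 * c2 (Real.log ‖x - x₀‖) * v x)
            / ‖x - x₀‖ ^ 2 * ((x i - x₀ i) * pd i v x)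
          + (c (Real.log ‖x - x₀‖) + 1 / 2 * c1 (Real.log ‖x - x₀‖)) * (pd i v x * pd i v x)
          + c (Real.log ‖x - x₀‖) * (pd i v x * euler x₀ (pd i v) x) := by
        intro i
        rw [ePA]
        ring
      simp only [this, Finset.sum_add_distrib, ← Finset.mul_sum]
      rw [show ∑ i, (x i - x₀ i) * pd i v x = euler x₀ v x from rfl]
      field_simp
      ring
    have eH := (((hasEuler_rad hU (dl _ ht)).mul
      ((hvT.hasEuler x₀ x).mul (hvT.hasEuler x₀ x))).sub ((hasEuler_rad hU (dc _ ht)).mul eM)).2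
    rw [show euler x₀ H x = _ from eH, eG, eMx]
    have hlast : σ ^ 3 / 2 * (v x ^ 2 / Real.log ‖x - x₀‖ ^ 2)
        ≤ 1 / 2 * (-(12 * ρ) / Real.log ‖x - x₀‖ ^ 4
          - c (Real.log ‖x - x₀‖) ^ 2 * c1 (Real.log ‖x - x₀‖)) * v x ^ 2 :=
      carleman_coefficient (ht8 x hx) hσ hσρ hρσ hN0 _
    have hc1neg : c1 (Real.log ‖x - x₀‖) ≤ 0 := by
      simp only [hc1]
      refine div_nonpos_of_nonpos_of_nonneg (by linarith) (by positivity)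
    have hκ : σ + ρ / Real.log ‖x - x₀‖ = (c (Real.log ‖x - x₀‖) - N) / 2 := by
      simp only [hc, pow_one]
      ring
    have hκ' : ρ / Real.log ‖x - x₀‖ ^ 2 = -c1 (Real.log ‖x - x₀‖) / 2 := by
      simp only [hc1]
      ring
    have hAx : A x = c (Real.log ‖x - x₀‖) * euler x₀ v x
        + 1 / 2 * (c1 (Real.log ‖x - x₀‖) * v x) := rfl
    have hlx : rad x₀ l x = -(1 / 2) * c2 (Real.log ‖x - x₀‖)
        + 1 / 4 * ((c (Real.log ‖x - x₀‖) * c (Real.log ‖x - x₀‖) - N ^ 2)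
          * c (Real.log ‖x - x₀‖)) := rfl
    have hcx : rad x₀ c x = c (Real.log ‖x - x₀‖) := rfl
    rw [hκ, hκ', hAx, hlx, hcx]
    rw [show (fun x => wt x₀ σ ρ x * u x) = v from rfl, show wt x₀ σ ρ x * u x = v x from rfl]
    generalize -(12 * ρ) / Real.log ‖x - x₀‖ ^ 4 = c3 at *
    generalize c (Real.log ‖x - x₀‖) = C at *
    generalize c1 (Real.log ‖x - x₀‖) = C1 at *
    generalize c2 (Real.log ‖x - x₀‖) = C2 at *
    generalize ∑ i, pd i v x * pd i v x = G at *
    generalize ∑ i, pd i v x * euler x₀ (pd i v) x = Z at *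
    generalize euler x₀ v x = E at *
    generalize lap v x = L at *
    generalize v x ^ 2 / Real.log ‖x - x₀‖ ^ 2 = Y at *
    generalize v x = y at *
    generalize ‖x - x₀‖ = r at *
    -- The three nonnegative quantities that are discarded: the radial term, good because `c' ≤ 0`,
    -- and the squares of the symmetric and skew parts.
    have h5 : 0 ≤ -2 * C1 * E ^ 2 := by nlinarith [sq_nonneg E]
    have h6 := sq_nonneg (r ^ 2 * L - N * E + (C ^ 2 - N ^ 2) / 4 * y)
    have h7 := sq_nonneg (C * E + 1 / 2 * (C1 * y))
    rw [show ∀ a b : ℝ, 2 * (q x * a) + q x * b + σ ^ 3 / 2 * (q x * Y)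
      = q x * (2 * a + b + σ ^ 3 / 2 * Y) from fun a b => by ring]
    refine mul_le_mul_of_nonneg_left ?_ hqpos.le
    linear_combination hlast + h5 + h6 + h7
  have hsum := integral_mono_test hK (((hDT.const_mul 2).add hET).add hLT) hRT key
  rw [integral_add (((hDT.const_mul 2).add hET).integrable hK) (hLT.integrable hK),
    integral_add ((hDT.const_mul 2).integrable hK) (hET.integrable hK),
    integral_const_mul, integral_const_mul, hDint, hHint] at hsum
  linarith

end

/-! ### Weighted elliptic estimates for first and second derivatives. -/

section

variable {n : ℕ} {K : Set (Space n)} {x₀ : Space n}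

theorem subset_punctured (hKR : K ⊆ Metric.ball x₀ (Real.exp (-8)) \ {x₀}) :
    K ⊆ punctured x₀ :=
  hKR.trans (Set.sdiff_subset_sdiff_left
    (Metric.ball_subset_ball (by rw [Real.exp_le_one_iff]; norm_num)))

theorem log_le_of_mem {x : Space n} (hx : x ∈ Metric.ball x₀ (Real.exp (-8)) \ {x₀}) :
    Real.log ‖x - x₀‖ ≤ -8 := by
  have h1 : ‖x - x₀‖ < Real.exp (-8) := by simpa [dist_eq_norm] using hx.1
  have := Real.log_le_log (norm_pos_iff.2 (sub_ne_zero.2 hx.2)) h1.le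
  rwa [Real.log_exp] at this

theorem abs_add_div_log_le {x : Space n} (hx : x ∈ Metric.ball x₀ (Real.exp (-8)) \ {x₀})
    (σ ρ : ℝ) : |σ + ρ / Real.log ‖x - x₀‖| ≤ |σ| + |ρ| := by
  have ht := log_le_of_mem hx
  refine (abs_add_le _ _).trans (add_le_add le_rfl ?_)
  rw [abs_div]
  exact div_le_self (abs_nonneg _) (by rw [abs_of_neg (by linarith)]; linarith)

theorem hasPD_wt_mul {f : Space n → ℝ} {x : Space n} (hx : x ∈ punctured x₀) (hf : Test K f)
    (σ ρ : ℝ) (i : Fin n) :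
    HasPD i (fun x => wt x₀ σ ρ x * f x) (wt x₀ σ ρ x * pd i f x
      - (σ + ρ / Real.log ‖x - x₀‖) * ((x i - x₀ i) / ‖x - x₀‖ ^ 2) * (wt x₀ σ ρ x * f x)) x :=
  ((hasPD_wt hx σ ρ i).mul (hf.hasPD i x)).congr_deriv (by ring)

theorem wt_add_one {x : Space n} (hx : x ∈ punctured x₀) (σ ρ : ℝ) :
    wt x₀ (σ + 1) ρ x = wt x₀ σ ρ x / ‖x - x₀‖ := by
  have := wt_sub_nat hx (σ + 1) ρ 1
  have h0 := norm_pos_of_mem hx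
  rw [eq_div_iff h0.ne']
  simpa using this.symm

theorem sum_coord_div_sq {x : Space n} (hx : x ∈ punctured x₀) :
    ∑ i, ((x i - x₀ i) / ‖x - x₀‖) ^ 2 = 1 := by
  have h0 := norm_pos_of_mem hx
  simp only [div_pow, ← Finset.sum_div, ← norm_sub_sq]
  field_simp

theorem abs_coord_div_le {x : Space n} (hx : x ∈ punctured x₀) (i : Fin n) :
    |(x i - x₀ i) / ‖x - x₀‖| ≤ 1 := by
  rw [← sq_le_one_iff_abs_le_one, ← sum_coord_div_sq hx]
  exact Finset.single_le_sum (f := fun i => ((x i - x₀ i) / ‖x - x₀‖) ^ 2)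
    (fun _ _ => sq_nonneg _) (Finset.mem_univ i)

/-- The factor `e` is kept squared: for `e = (xᵢ - x₀ᵢ)/r` its squares sum to `1`, so the constants
do not depend on the dimension. -/
theorem young_weight {κ M e X Y : ℝ} (hκ : |κ| ≤ M) :
    2 * κ * e * X * Y ≤ X ^ 2 / 2 + 2 * M ^ 2 * (e ^ 2 * Y ^ 2) := by
  have h1 : κ ^ 2 ≤ M ^ 2 := sq_le_sq' (abs_le.1 hκ).1 (abs_le.1 hκ).2
  have h2 : κ ^ 2 * (e ^ 2 * Y ^ 2) ≤ M ^ 2 * (e ^ 2 * Y ^ 2) := by gcongr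
  nlinarith [sq_nonneg (X - 2 * κ * e * Y)]

/-- Weighted `L²` bound of the gradient by the Laplacian and the function. -/
theorem gradient_le_lap {f : Space n → ℝ} (hK : IsCompact K)
    (hKR : K ⊆ Metric.ball x₀ (Real.exp (-8)) \ {x₀}) (hf : Test K f) {σ ρ τ L : ℝ}
    (hL : |σ| + |ρ| + 1 ≤ L * τ) :
    τ ^ 2 * ∫ x, ∑ j, (wt x₀ (σ + 1) ρ x * pd j f x) ^ 2
      ≤ (∫ x, (wt x₀ σ ρ x * lap f x) ^ 2)
        + (1 + 4 * L ^ 2) * τ ^ 4 * ∫ x, (wt x₀ (σ + 2) ρ x * f x) ^ 2 := by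
  have hKU := subset_punctured hKR
  have hKc := hK.isClosed
  have hb : ∀ a : ℝ, ∀ {g : Space n → ℝ}, Test K g → Test K fun x => wt x₀ a ρ x * g x :=
    fun a g hg => hg.wt_mul hKc hKU a ρ
  have hsq : ∀ {g : Space n → ℝ}, Test K g → Test K fun x => g x ^ 2 := fun hg => by
    simpa only [sq] using hg.mul hg
  -- The divergence of `w² f ∇f` is `w²|∇f|² + w² f Δf` plus a term from `∇(w²)`, which is bounded
  -- by `Lτ/r` times `w² |f| |∇f|`, up to a constant, and absorbed by Young's inequality.
  have hF : ∀ j, Test K fun x => (wt x₀ (σ + 1) ρ x * f x) * (wt x₀ (σ + 1) ρ x * pd j f x) :=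
    fun j => (hb _ hf).mul (hb _ (hf.pd hKc j))
  have hX : Test K fun x => ∑ j, (wt x₀ (σ + 1) ρ x * pd j f x) ^ 2 :=
    Test.sum _ fun j _ => hsq (hb _ (hf.pd hKc j))
  have hP := hsq (hb σ (hf.lap hKc))
  have hY := hsq (hb (σ + 2) hf)
  have hD : Test K fun x => ∑ j, pd j
      (fun x => (wt x₀ (σ + 1) ρ x * f x) * (wt x₀ (σ + 1) ρ x * pd j f x)) x :=
    Test.sum _ fun j _ => (hF j).pd hKc j
  have hDint := integral_sum_pd hK hF
  have key : ∀ x ∈ K, τ ^ 2 * ∑ j, (wt x₀ (σ + 1) ρ x * pd j f x) ^ 2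
      ≤ 2 * τ ^ 2 * (∑ j, pd j
        (fun x => (wt x₀ (σ + 1) ρ x * f x) * (wt x₀ (σ + 1) ρ x * pd j f x)) x)
      + (wt x₀ σ ρ x * lap f x) ^ 2
      + (1 + 4 * L ^ 2) * τ ^ 4 * (wt x₀ (σ + 2) ρ x * f x) ^ 2 := by
    intro x hx
    have hU := hKU hx
    have h0 := norm_pos_of_mem hU
    have hκ : |σ + 1 + ρ / Real.log ‖x - x₀‖| ≤ L * τ := by
      refine (abs_add_div_log_le (hKR hx) _ _).trans (le_trans ?_ hL)
      have := abs_add_le σ 1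
      rw [abs_one] at this
      linarith
    have e2 : wt x₀ (σ + 2) ρ x = wt x₀ (σ + 1) ρ x / ‖x - x₀‖ := by
      rw [← wt_add_one hU]
      ring_nf
    have e0 : wt x₀ σ ρ x = wt x₀ (σ + 1) ρ x * ‖x - x₀‖ := by
      rw [wt_add_one hU]
      field_simp
    have e : ∀ j, pd j
        (fun x => (wt x₀ (σ + 1) ρ x * f x) * (wt x₀ (σ + 1) ρ x * pd j f x)) x
        = (wt x₀ (σ + 1) ρ x * pd j f x) ^ 2
          - 2 * (σ + 1 + ρ / Real.log ‖x - x₀‖) * ((x j - x₀ j) / ‖x - x₀‖)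
            * (wt x₀ (σ + 1) ρ x * pd j f x) * (wt x₀ (σ + 2) ρ x * f x)
          + (wt x₀ σ ρ x * pd j (pd j f) x) * (wt x₀ (σ + 2) ρ x * f x) := by
      intro j
      rw [((hasPD_wt_mul hU hf _ _ j).mul (hasPD_wt_mul hU (hf.pd hKc j) _ _ j)).2, e2, e0]
      field_simp
      ring
    have hsum := Finset.sum_le_sum fun j (_ : j ∈ Finset.univ) =>
      young_weight (e := (x j - x₀ j) / ‖x - x₀‖) (X := wt x₀ (σ + 1) ρ x * pd j f x)
        (Y := wt x₀ (σ + 2) ρ x * f x) hκ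
    rw [Finset.sum_add_distrib, ← Finset.sum_div, ← Finset.mul_sum,
      ← Finset.sum_mul (f := fun i => ((x i - x₀ i) / ‖x - x₀‖) ^ 2),
      sum_coord_div_sq hU] at hsum
    simp only [e, Finset.sum_add_distrib, Finset.sum_sub_distrib]
    have hl : ∑ j, wt x₀ σ ρ x * pd j (pd j f) x * (wt x₀ (σ + 2) ρ x * f x)
        = wt x₀ σ ρ x * lap f x * (wt x₀ (σ + 2) ρ x * f x) := by
      rw [← Finset.sum_mul, ← Finset.mul_sum]
      rfl
    rw [hl]
    generalize wt x₀ σ ρ x * lap f x = P at *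
    generalize wt x₀ (σ + 2) ρ x * f x = Y at *
    generalize ∑ j, (wt x₀ (σ + 1) ρ x * pd j f x) ^ 2 = X at *
    generalize ∑ j, 2 * (σ + 1 + ρ / Real.log ‖x - x₀‖) * ((x j - x₀ j) / ‖x - x₀‖)
            * (wt x₀ (σ + 1) ρ x * pd j f x) * Y = Z at *
    have h1 := mul_le_mul_of_nonneg_left hsum (by positivity : 0 ≤ 2 * τ ^ 2)
    nlinarith [sq_nonneg (P + τ ^ 2 * Y)]
  have hs := integral_mono_test hK (hX.const_mul _)
    (((hD.const_mul _).add hP).add (hY.const_mul _)) key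
  rw [integral_add (((hD.const_mul _).add hP).integrable hK) ((hY.const_mul _).integrable hK),
    integral_add ((hD.const_mul _).integrable hK) (hP.integrable hK),
    integral_const_mul, integral_const_mul, integral_const_mul, hDint] at hs
  linarith

theorem pd_lap {f : Space n → ℝ} (hK : IsClosed K) (hf : Test K f) (j : Fin n) (x : Space n) :
    pd j (lap f) x = ∑ i, pd i (pd i (pd j f)) x := by
  have h : HasPD j (lap f) _ x :=
    HasPD.sum Finset.univ fun i _ => ((hf.pd hK i).pd hK i).hasPD j x
  rw [h.2]
  refine Finset.sum_congr rfl fun i _ => ?_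
  rw [pd_comm (hf.pd hK i).smooth]
  congr 1
  ext y
  exact pd_comm hf.smooth _ _ _

/-- Weighted `L²` bound of the Hessian by the Laplacian and the gradient. -/
theorem hessian_le_lap {f : Space n → ℝ} (hK : IsCompact K)
    (hKR : K ⊆ Metric.ball x₀ (Real.exp (-8)) \ {x₀}) (hf : Test K f) {σ ρ τ L : ℝ}
    (hL : |σ| + |ρ| ≤ L * τ) :
    ∫ x, ∑ i, ∑ j, (wt x₀ σ ρ x * pd i (pd j f) x) ^ 2
      ≤ 4 * (∫ x, (wt x₀ σ ρ x * lap f x) ^ 2)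
        + 8 * (L * τ) ^ 2 * ∫ x, ∑ j, (wt x₀ (σ + 1) ρ x * pd j f x) ^ 2 := by
  have hKU := subset_punctured hKR
  have hKc := hK.isClosed
  have hb : ∀ a : ℝ, ∀ {g : Space n → ℝ}, Test K g → Test K fun x => wt x₀ a ρ x * g x :=
    fun a g hg => hg.wt_mul hKc hKU a ρ
  have hsq : ∀ {g : Space n → ℝ}, Test K g → Test K fun x => g x ^ 2 := fun hg => by
    simpa only [sq] using hg.mul hg
  -- Bochner's field `w² (½∇|∇f|² - Δf ∇f)`: without the weight its divergence is `|D²f|² - (Δf)²`.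
  have hF : ∀ i, Test K fun x => (∑ j, (wt x₀ σ ρ x * pd j f x) * (wt x₀ σ ρ x * pd i (pd j f) x))
      - (wt x₀ σ ρ x * pd i f x) * (wt x₀ σ ρ x * lap f x) := fun i =>
    (Test.sum _ fun j _ => (hb _ (hf.pd hKc j)).mul (hb _ ((hf.pd hKc j).pd hKc i))).sub
      ((hb _ (hf.pd hKc i)).mul (hb _ (hf.lap hKc)))
  have hX : Test K fun x => ∑ j, (wt x₀ (σ + 1) ρ x * pd j f x) ^ 2 :=
    Test.sum _ fun j _ => hsq (hb _ (hf.pd hKc j))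
  have hH : Test K fun x => ∑ i, ∑ j, (wt x₀ σ ρ x * pd i (pd j f) x) ^ 2 :=
    Test.sum _ fun i _ => Test.sum _ fun j _ => hsq (hb _ ((hf.pd hKc j).pd hKc i))
  have hP := hsq (hb σ (hf.lap hKc))
  have hD := Test.sum Finset.univ fun i (_ : i ∈ Finset.univ) => (hF i).pd hKc i
  have hDint := integral_sum_pd hK hF
  have key : ∀ x ∈ K, ∑ i, ∑ j, (wt x₀ σ ρ x * pd i (pd j f) x) ^ 2
      ≤ 2 * (∑ i, pd i (fun x =>
        (∑ j, (wt x₀ σ ρ x * pd j f x) * (wt x₀ σ ρ x * pd i (pd j f) x))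
          - (wt x₀ σ ρ x * pd i f x) * (wt x₀ σ ρ x * lap f x)) x)
      + 4 * (wt x₀ σ ρ x * lap f x) ^ 2
      + 8 * (L * τ) ^ 2 * ∑ j, (wt x₀ (σ + 1) ρ x * pd j f x) ^ 2 := by
    intro x hx
    have hU := hKU hx
    have h0 := norm_pos_of_mem hU
    have hκ : |σ + ρ / Real.log ‖x - x₀‖| ≤ L * τ :=
      (abs_add_div_log_le (hKR hx) _ _).trans hL
    have e1 : wt x₀ (σ + 1) ρ x = wt x₀ σ ρ x / ‖x - x₀‖ := wt_add_one hU _ _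
    have e : ∀ i, pd i (fun x =>
        (∑ j, (wt x₀ σ ρ x * pd j f x) * (wt x₀ σ ρ x * pd i (pd j f) x))
          - (wt x₀ σ ρ x * pd i f x) * (wt x₀ σ ρ x * lap f x)) x
        = (∑ j, (wt x₀ σ ρ x * pd i (pd j f) x) ^ 2
          - ∑ j, 2 * (σ + ρ / Real.log ‖x - x₀‖) * ((x i - x₀ i) / ‖x - x₀‖)
            * (wt x₀ σ ρ x * pd i (pd j f) x) * (wt x₀ (σ + 1) ρ x * pd j f x)
          + ∑ j, wt x₀ σ ρ x ^ 2 * (pd j f x * pd i (pd i (pd j f)) x))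
          - ((wt x₀ σ ρ x * lap f x) * (wt x₀ σ ρ x * pd i (pd i f) x)
          - 2 * (σ + ρ / Real.log ‖x - x₀‖) * ((x i - x₀ i) / ‖x - x₀‖)
            * (wt x₀ (σ + 1) ρ x * pd i f x) * (wt x₀ σ ρ x * lap f x)
          + wt x₀ σ ρ x ^ 2 * (pd i f x * pd i (lap f) x)) := by
      intro i
      rw [((HasPD.sum Finset.univ fun j _ => (hasPD_wt_mul hU (hf.pd hKc j) _ _ i).mul
        (hasPD_wt_mul hU ((hf.pd hKc j).pd hKc i) _ _ i)).sub
        ((hasPD_wt_mul hU (hf.pd hKc i) _ _ i).mul (hasPD_wt_mul hU (hf.lap hKc) _ _ i))).2, e1,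
        ← Finset.sum_sub_distrib, ← Finset.sum_add_distrib]
      congr 1
      · refine Finset.sum_congr rfl fun j _ => ?_
        field_simp
        ring
      · field_simp
        ring
    have h1 := Finset.sum_le_sum fun i (_ : i ∈ Finset.univ) =>
      Finset.sum_le_sum fun j (_ : j ∈ Finset.univ) =>
      (young_weight (e := (x i - x₀ i) / ‖x - x₀‖) (X := wt x₀ σ ρ x * pd i (pd j f) x)
        (Y := wt x₀ (σ + 1) ρ x * pd j f x) hκ)
    have h2 := Finset.sum_le_sum fun i (_ : i ∈ Finset.univ) =>
      (young_weight (κ := -(σ + ρ / Real.log ‖x - x₀‖)) (M := L * τ) (e := 1)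
        (X := ((x i - x₀ i) / ‖x - x₀‖) * (wt x₀ σ ρ x * lap f x))
        (Y := wt x₀ (σ + 1) ρ x * pd i f x) (by rwa [abs_neg]))
    -- The third derivatives of the two halves of the field cancel, because `Δ` commutes with `∂ⱼ`.
    have hT : ∑ i, ∑ j, wt x₀ σ ρ x ^ 2 * (pd j f x * pd i (pd i (pd j f)) x)
        = ∑ i, wt x₀ σ ρ x ^ 2 * (pd i f x * pd i (lap f) x) := by
      rw [Finset.sum_comm]
      refine Finset.sum_congr rfl fun j _ => ?_
      rw [pd_lap hKc hf, ← Finset.mul_sum, ← Finset.mul_sum]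
    have h3 : ∑ i, ∑ j, (((x i - x₀ i) / ‖x - x₀‖) ^ 2 * (wt x₀ (σ + 1) ρ x * pd j f x) ^ 2)
        = ∑ j, (wt x₀ (σ + 1) ρ x * pd j f x) ^ 2 := by
      rw [← Finset.sum_mul_sum, sum_coord_div_sq hU, one_mul]
    have h4 : ∑ i, (((x i - x₀ i) / ‖x - x₀‖) * (wt x₀ σ ρ x * lap f x)) ^ 2
        = (wt x₀ σ ρ x * lap f x) ^ 2 := by
      simp only [mul_pow _ (wt x₀ σ ρ x * lap f x)]
      rw [← Finset.sum_mul, sum_coord_div_sq hU, one_mul]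
    have h5 : ∑ i, 2 * (-(σ + ρ / Real.log ‖x - x₀‖)) * 1
        * (((x i - x₀ i) / ‖x - x₀‖) * (wt x₀ σ ρ x * lap f x))
        * (wt x₀ (σ + 1) ρ x * pd i f x)
        = -∑ i, 2 * (σ + ρ / Real.log ‖x - x₀‖) * ((x i - x₀ i) / ‖x - x₀‖)
            * (wt x₀ (σ + 1) ρ x * pd i f x) * (wt x₀ σ ρ x * lap f x) := by
      rw [← Finset.sum_neg_distrib]
      exact Finset.sum_congr rfl fun i _ => by ring
    have h6 : ∑ i, (wt x₀ σ ρ x * lap f x) * (wt x₀ σ ρ x * pd i (pd i f) x)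
        = (wt x₀ σ ρ x * lap f x) ^ 2 := by
      rw [← Finset.mul_sum, ← Finset.mul_sum, sq]
      rfl
    simp only [Finset.sum_add_distrib, ← Finset.sum_div] at h1
    rw [Finset.sum_add_distrib, ← Finset.sum_div, h4, h5] at h2
    simp only [← Finset.mul_sum _ _ (2 * (L * τ) ^ 2), h3, one_pow, one_mul] at h1 h2
    simp only [e, Finset.sum_add_distrib, Finset.sum_sub_distrib, hT, h6]
    generalize wt x₀ σ ρ x * lap f x = P at *
    generalize ∑ j, (wt x₀ (σ + 1) ρ x * pd j f x) ^ 2 = X at *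
    linarith [sq_nonneg P]
  have hs := integral_mono_test hK hH
    (((hD.const_mul _).add (hP.const_mul _)).add (hX.const_mul _)) key
  rw [integral_add (((hD.const_mul _).add (hP.const_mul _)).integrable hK)
      ((hX.const_mul _).integrable hK),
    integral_add ((hD.const_mul _).integrable hK) ((hP.const_mul _).integrable hK),
    integral_const_mul, integral_const_mul, integral_const_mul, hDint] at hs
  linarith

/-- Weighted `L²` bounds of the first and second derivatives by the Laplacian. -/
theorem elliptic_estimate {f : Space n → ℝ} (hK : IsCompact K)
    (hKR : K ⊆ Metric.ball x₀ (Real.exp (-8)) \ {x₀}) (hf : Test K f) {σ ρ τ L : ℝ}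
    (hL : |σ| + |ρ| + 1 ≤ L * τ) (i j : Fin n) :
    (∫ x, (wt x₀ σ ρ x * pd i (pd j f) x) ^ 2)
        + τ ^ 2 * ∫ x, (wt x₀ (σ + 1) ρ x * pd j f x) ^ 2
      ≤ (5 + 8 * L ^ 2) * (1 + 4 * L ^ 2) * ((∫ x, (wt x₀ σ ρ x * lap f x) ^ 2)
        + τ ^ 4 * ∫ x, (wt x₀ (σ + 2) ρ x * f x) ^ 2) := by
  have hKU := subset_punctured hKR
  have hKc := hK.isClosed
  have hb : ∀ a : ℝ, ∀ {g : Space n → ℝ}, Test K g → Test K fun x => (wt x₀ a ρ x * g x) ^ 2 :=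
    fun a g hg => by
      have := hg.wt_mul hKc hKU a ρ
      simpa only [sq] using this.mul this
  have h1 := gradient_le_lap hK hKR hf hL
  have h2 := hessian_le_lap hK hKR hf (σ := σ) (ρ := ρ) (τ := τ) (L := L) (by linarith)
  have h3 : ∫ x, (wt x₀ (σ + 1) ρ x * pd j f x) ^ 2
      ≤ ∫ x, ∑ j, (wt x₀ (σ + 1) ρ x * pd j f x) ^ 2 :=
    integral_mono_test hK (hb _ (hf.pd hKc j)) (Test.sum _ fun j _ => hb _ (hf.pd hKc j))
      fun x _ => Finset.single_le_sum (f := fun j => (wt x₀ (σ + 1) ρ x * pd j f x) ^ 2)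
        (fun _ _ => sq_nonneg _) (Finset.mem_univ j)
  have h4 : ∫ x, (wt x₀ σ ρ x * pd i (pd j f) x) ^ 2
      ≤ ∫ x, ∑ i, ∑ j, (wt x₀ σ ρ x * pd i (pd j f) x) ^ 2 := by
    refine integral_mono_test hK (hb _ ((hf.pd hKc j).pd hKc i))
      (Test.sum _ fun i _ => Test.sum _ fun j _ => hb _ ((hf.pd hKc j).pd hKc i)) fun x _ => ?_
    refine (Finset.single_le_sum (f := fun j => (wt x₀ σ ρ x * pd i (pd j f) x) ^ 2)
      (fun _ _ => sq_nonneg _) (Finset.mem_univ j)).trans ?_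
    exact Finset.single_le_sum (f := fun i => ∑ j, (wt x₀ σ ρ x * pd i (pd j f) x) ^ 2)
      (fun _ _ => Finset.sum_nonneg fun _ _ => sq_nonneg _) (Finset.mem_univ i)
  have hP : 0 ≤ ∫ x, (wt x₀ σ ρ x * lap f x) ^ 2 := integral_nonneg fun _ => sq_nonneg _
  have hY : 0 ≤ τ ^ 4 * ∫ x, (wt x₀ (σ + 2) ρ x * f x) ^ 2 :=
    mul_nonneg (by positivity) (integral_nonneg fun _ => sq_nonneg _)
  generalize ∫ x, (wt x₀ σ ρ x * lap f x) ^ 2 = P at *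
  generalize ∫ x, (wt x₀ (σ + 1) ρ x * pd j f x) ^ 2 = X at *
  generalize ∫ x, ∑ j, (wt x₀ (σ + 1) ρ x * pd j f x) ^ 2 = X' at *
  generalize ∫ x, (wt x₀ (σ + 2) ρ x * f x) ^ 2 = Y at *
  have h5 := mul_le_mul_of_nonneg_left h3 (sq_nonneg τ)
  have h6 := mul_le_mul_of_nonneg_left h1 (by positivity : 0 ≤ 1 + 8 * L ^ 2)
  have h7 : 0 ≤ L ^ 2 * P := mul_nonneg (sq_nonneg L) hP
  have h8 : 0 ≤ L ^ 2 * (τ ^ 4 * Y) := mul_nonneg (sq_nonneg L) hY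
  have h9 : 0 ≤ L ^ 2 * (L ^ 2 * P) := mul_nonneg (sq_nonneg L) h7
  nlinarith

end

/-! ### Iteration to all powers of the Laplacian and all derivatives in `L²`. -/

section

variable {n : ℕ} {K : Set (Space n)} {x₀ : Space n}

/-- The iterated partial derivative along a word. -/
noncomputable def wordDeriv (I : List (Fin n)) (f : Space n → ℝ) : Space n → ℝ := I.foldr pd f

theorem Test.wordDeriv {f : Space n → ℝ} (hK : IsClosed K) (hf : Test K f) (I : List (Fin n)) :
    Test K (wordDeriv I f) := by
  induction I with
  | nil => exact hf
  | cons i I ih => exact ih.pd hK i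

theorem Test.lap_iterate {f : Space n → ℝ} (hK : IsClosed K) (hf : Test K f) (k : ℕ) :
    Test K (Polyharmonic.lap^[k] f) := by
  induction k with
  | zero => exact hf
  | succ k ih =>
    rw [Function.iterate_succ_apply']
    exact ih.lap hK

theorem lap_wordDeriv {f : Space n → ℝ} (hK : IsClosed K) (hf : Test K f) (I : List (Fin n)) :
    lap (wordDeriv I f) = wordDeriv I (lap f) := by
  induction I with
  | nil => rfl
  | cons i I ih =>
    change lap (pd i (wordDeriv I f)) = pd i (wordDeriv I (lap f))
    rw [← ih]
    ext x
    rw [pd_lap hK (hf.wordDeriv hK I)]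
    rfl

/-- Weighted `L²` bounds of the derivatives of order at most `2l` by powers of the Laplacian. -/
theorem wordDeriv_le_of_lap_iterate (n l : ℕ) (L : ℝ) :
    ∃ C : ℝ, 0 ≤ C ∧ ∀ (x₀ : Space n) (K : Set (Space n)), IsCompact K →
      K ⊆ Metric.ball x₀ (Real.exp (-8)) \ {x₀} → ∀ f, Test K f → ∀ σ ρ τ B : ℝ, 1 ≤ τ →
      |σ| + |ρ| + 4 * l + 4 ≤ L * τ →
      (∀ i ≤ l, ∫ x, (wt x₀ (σ - 2 * i) ρ x * lap^[i] f x) ^ 2 ≤ τ ^ (4 * i) * B) →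
      ∀ I : List (Fin n), I.length ≤ 2 * l →
        ∫ x, (wt x₀ (σ - I.length) ρ x * wordDeriv I f x) ^ 2 ≤ C * τ ^ (2 * I.length) * B := by
  induction l with
  | zero =>
    refine ⟨1, zero_le_one, fun x₀ K _ _ f _ σ ρ τ B _ _ hB I hI => ?_⟩
    obtain rfl : I = [] := List.length_eq_zero_iff.1 (by omega)
    simpa [wordDeriv] using hB 0 le_rfl
  | succ l ih =>
    obtain ⟨C, hC0, hC⟩ := ih
    refine ⟨C + (5 + 8 * L ^ 2) * (1 + 4 * L ^ 2) * (2 * C), by positivity,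
      fun x₀ K hK hKR f hf σ ρ τ B hτ hL hB I hI => ?_⟩
    push_cast at hL
    have hKc := hK.isClosed
    have hB0 : 0 ≤ B := by
      have := hB 0 (by omega)
      simp only [mul_zero, pow_zero, one_mul] at this
      exact (integral_nonneg fun _ => sq_nonneg _).trans this
    have hτ0 : 0 < τ := by linarith
    have hE : 0 ≤ (5 + 8 * L ^ 2) * (1 + 4 * L ^ 2) * (2 * C) := by positivity
    by_cases hI2 : I.length ≤ 2 * l
    · refine (hC x₀ K hK hKR f hf σ ρ τ B hτ (by linarith) (fun i hi => hB i (by omega)) I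
        hI2).trans ?_
      gcongr
      linarith
    -- the bounds for words of length `2 l`
    have h1 : ∀ J : List (Fin n), J.length = 2 * l →
        ∫ x, (wt x₀ (σ - 2 * l) ρ x * wordDeriv J f x) ^ 2 ≤ C * τ ^ (4 * l) * B := by
      intro J hJ
      have := hC x₀ K hK hKR f hf σ ρ τ B hτ (by linarith) (fun i hi => hB i (by omega)) J hJ.le
      rw [hJ] at this
      push_cast at this
      rwa [← mul_assoc] at this
    -- The Laplacian commutes with the word, so the induction hypothesis is applied to `lap f`, with
    -- `σ - 2` for `σ` and `τ⁴ B` for `B`. The term `4 * l` in the hypothesis on `L` leaves room for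
    -- this shift.
    have h2 : ∀ J : List (Fin n), J.length = 2 * l →
        ∫ x, (wt x₀ (σ - 2 * l - 2) ρ x * lap (wordDeriv J f) x) ^ 2
          ≤ C * τ ^ (4 * l) * (τ ^ 4 * B) := by
      intro J hJ
      rw [lap_wordDeriv hKc hf]
      have hσ : |σ - 2| ≤ |σ| + 2 := by
        have := abs_sub σ 2
        rwa [abs_two] at this
      have := hC x₀ K hK hKR (lap f) (hf.lap hKc) (σ - 2) ρ τ (τ ^ 4 * B) hτ (by linarith)
        (fun i hi => by
          have := hB (i + 1) (by omega)
          rw [Function.iterate_succ_apply] at this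
          refine (le_of_eq ?_).trans (this.trans (le_of_eq ?_))
          · congr 1
            ext x
            congr 3
            push_cast
            ring
          · ring) J hJ.le
      rw [hJ] at this
      push_cast at this
      rwa [show σ - 2 - 2 * (l : ℝ) = σ - 2 * l - 2 by ring,
        show 2 * (2 * l) = 4 * l by ring] at this
    -- One elliptic step from words of length `2l` bounds lengths `2l + 1` and `2l + 2` together.
    have hell : ∀ (J : List (Fin n)), J.length = 2 * l → ∀ i j : Fin n,
        (∫ x, (wt x₀ (σ - 2 * l - 2) ρ x * pd i (pd j (wordDeriv J f)) x) ^ 2)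
          + τ ^ 2 * ∫ x, (wt x₀ (σ - 2 * l - 1) ρ x * pd j (wordDeriv J f) x) ^ 2
        ≤ (5 + 8 * L ^ 2) * (1 + 4 * L ^ 2) * (2 * C) * τ ^ (4 * l + 4) * B := by
      intro J hJ i j
      have hσ : |σ - 2 * l - 2| ≤ |σ| + 2 * l + 2 := by
        have h3 := abs_sub (σ - 2 * l) 2
        have h4 := abs_sub σ (2 * l : ℝ)
        rw [abs_two] at h3
        rw [abs_of_nonneg (by positivity : (0 : ℝ) ≤ 2 * l)] at h4
        linarith
      have h3 := elliptic_estimate hK hKR (hf.wordDeriv hKc J) (σ := σ - 2 * l - 2) (ρ := ρ)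
        (τ := τ) (L := L) (by
          have : (0 : ℝ) ≤ l := by positivity
          linarith) i j
      rw [show σ - 2 * l - 2 + 1 = σ - 2 * l - 1 by ring,
        show σ - 2 * l - 2 + 2 = σ - 2 * l by ring] at h3
      refine h3.trans ?_
      rw [mul_assoc _ (2 * C), mul_assoc _ _ B]
      refine mul_le_mul_of_nonneg_left ?_ (by positivity)
      calc _ ≤ C * τ ^ (4 * l) * (τ ^ 4 * B) + τ ^ 4 * (C * τ ^ (4 * l) * B) :=
            add_le_add (h2 J hJ) (mul_le_mul_of_nonneg_left (h1 J hJ) (by positivity))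
        _ = _ := by ring
    have hle : ∀ k : ℕ, (5 + 8 * L ^ 2) * (1 + 4 * L ^ 2) * (2 * C) * τ ^ k * B
        ≤ (C + (5 + 8 * L ^ 2) * (1 + 4 * L ^ 2) * (2 * C)) * τ ^ k * B := fun k => by
      gcongr
      linarith
    obtain hI1 | hI1 : I.length = 2 * l + 1 ∨ I.length = 2 * l + 2 := by omega
    · obtain ⟨j, J, rfl⟩ := List.exists_cons_of_length_eq_add_one hI1
      simp only [List.length_cons, Nat.add_right_cancel_iff] at hI1
      refine le_trans ?_ (hle _)
      have h3 := hell J hI1 j j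
      have h4 : 0 ≤ ∫ x, (wt x₀ (σ - 2 * l - 2) ρ x * pd j (pd j (wordDeriv J f)) x) ^ 2 :=
        integral_nonneg fun _ => sq_nonneg _
      refine le_of_mul_le_mul_left (a := τ ^ 2) ?_ (by positivity)
      simp only [List.length_cons, hI1]
      push_cast
      rw [show σ - (2 * (l : ℝ) + 1) = σ - 2 * l - 1 by ring]
      change τ ^ 2 * ∫ x, (wt x₀ (σ - 2 * l - 1) ρ x * pd j (wordDeriv J f) x) ^ 2 ≤ _
      refine (le_of_add_le_of_nonneg_right h3 h4).trans (le_of_eq ?_)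
      ring
    · obtain ⟨i, I', rfl⟩ := List.exists_cons_of_length_eq_add_one hI1
      simp only [List.length_cons, Nat.add_right_cancel_iff] at hI1
      obtain ⟨j, J, rfl⟩ := List.exists_cons_of_length_eq_add_one hI1
      simp only [List.length_cons, Nat.add_right_cancel_iff] at hI1
      refine le_trans ?_ (hle _)
      have h3 := hell J hI1 i j
      have h4 : 0 ≤ τ ^ 2 * ∫ x, (wt x₀ (σ - 2 * l - 1) ρ x * pd j (wordDeriv J f) x) ^ 2 :=
        mul_nonneg (by positivity) (integral_nonneg fun _ => sq_nonneg _)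
      simp only [List.length_cons, hI1]
      push_cast
      rw [show σ - (2 * (l : ℝ) + 1 + 1) = σ - 2 * l - 2 by ring,
        show 2 * (2 * l + 1 + 1) = 4 * l + 4 by ring]
      change ∫ x, (wt x₀ (σ - 2 * l - 2) ρ x * pd i (pd j (wordDeriv J f)) x) ^ 2 ≤ _
      linarith

theorem wt_le_wt_right {x : Space n} (hx : x ∈ Metric.ball x₀ (Real.exp (-8)) \ {x₀})
    (σ : ℝ) {ρ ρ' : ℝ} (h : ρ ≤ ρ') : wt x₀ σ ρ' x ≤ wt x₀ σ ρ x := by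
  have := log_le_of_mem hx
  simp only [wt, rad, profile]
  gcongr
  linarith

/-- The iterated Carleman estimate for the powers of the Laplacian. -/
theorem carleman_lap_iterate (hn : 2 ≤ n) {m : ℕ} {f : Space n → ℝ} (hK : IsCompact K)
    (hKR : K ⊆ Metric.ball x₀ (Real.exp (-8)) \ {x₀}) (hf : Test K f) {τ : ℝ}
    (hτ : 10 * m ≤ τ) (hτ1 : 1 ≤ τ) (d : ℕ) : ∀ i, i + d = m →
    (τ ^ 3 / 16) ^ d * ∫ x, (wt x₀ (τ + n / 2 - 2 * i) (2 * τ + d) x * lap^[i] f x) ^ 2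
      ≤ ∫ x, (wt x₀ (τ + n / 2 - 2 * m) (2 * τ) x * lap^[m] f x) ^ 2 := by
  induction d with
  | zero =>
    rintro i rfl
    simp
  | succ d ih =>
    intro i hi
    have him : (i : ℝ) + d + 1 = m := by exact_mod_cast hi
    have hi0 : (0 : ℝ) ≤ i := by positivity
    have hd0 : (0 : ℝ) ≤ d := by positivity
    -- The condition `10 m ≤ τ` keeps `σ = τ - 2i` at least `τ/2` and `ρ = 2τ + d` between `σ` and
    -- `4σ`. The gain per step is then `(τ/2)³/2 = τ³/16`.
    have hσ : τ / 2 ≤ τ - 2 * i := by linarith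
    refine le_trans ?_ (ih (i + 1) (by omega))
    rw [pow_succ, mul_assoc]
    refine mul_le_mul_of_nonneg_left ?_ (by positivity)
    have h1 := carleman_lap hn hK hKR (hf.lap_iterate hK.isClosed i) (σ := τ - 2 * i)
      (ρ := 2 * τ + d) (by linarith) (by linarith) (by linarith)
    rw [← Function.iterate_succ_apply' lap] at h1
    rw [show τ + n / 2 - 2 * (i : ℝ) = τ - 2 * i + n / 2 by ring,
      show 2 * τ + ((d + 1 : ℕ) : ℝ) = 2 * τ + d + 1 by push_cast; ring,
      show τ + n / 2 - 2 * ((i + 1 : ℕ) : ℝ) = τ - 2 * i + n / 2 - 2 by push_cast; ring]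
    refine le_trans (mul_le_mul_of_nonneg_right ?_ (integral_nonneg fun _ => sq_nonneg _)) h1
    calc τ ^ 3 / 16 = (τ / 2) ^ 3 / 2 := by ring
      _ ≤ _ := by gcongr

/-- The `L²` Carleman estimate for `Δ^m` with all derivatives up to order `2m`. -/
theorem carleman_wordDeriv (n m : ℕ) (hn : 2 ≤ n) :
    ∃ C : ℝ, 0 ≤ C ∧ ∀ (x₀ : Space n) (K : Set (Space n)), IsCompact K →
      K ⊆ Metric.ball x₀ (Real.exp (-8)) \ {x₀} → ∀ f, Test K f → ∀ τ : ℝ, 1 ≤ τ → 10 * m ≤ τ →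
      ∀ I : List (Fin n), I.length ≤ 2 * m →
        ∫ x, (wt x₀ (τ + n / 2 - I.length) (2 * τ + m) x * wordDeriv I f x) ^ 2
          ≤ C * τ ^ (2 * I.length) * ((τ ^ (3 * m))⁻¹ *
            ∫ x, (wt x₀ (τ + n / 2 - 2 * m) (2 * τ) x * lap^[m] f x) ^ 2) := by
  -- The constant covers `|τ + n/2| + |2τ + m| + 4m + 4`, which is at most `(n + 5m + 7) τ` for `τ ≥
  -- 1`.
  obtain ⟨C, hC0, hC⟩ := wordDeriv_le_of_lap_iterate n m (n + 5 * m + 7)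
  refine ⟨C * 16 ^ m, by positivity, fun x₀ K hK hKR f hf τ hτ1 hτ I hI => ?_⟩
  have hKU := subset_punctured hKR
  have hKc := hK.isClosed
  have hτ0 : 0 < τ := by linarith
  set Q := ∫ x, (wt x₀ (τ + n / 2 - 2 * m) (2 * τ) x * lap^[m] f x) ^ 2 with hQ
  have hQ0 : 0 ≤ Q := integral_nonneg fun _ => sq_nonneg _
  have hb : ∀ a b : ℝ, ∀ {g : Space n → ℝ}, Test K g → Test K fun x => (wt x₀ a b x * g x) ^ 2 :=
    fun a b g hg => by
      have := hg.wt_mul hKc hKU a b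
      simpa only [sq] using this.mul this
  have key := hC x₀ K hK hKR f hf (τ + n / 2) (2 * τ + m) τ (16 ^ m * ((τ ^ (3 * m))⁻¹ * Q)) hτ1
    (by
      rw [abs_of_nonneg (by positivity), abs_of_nonneg (by positivity)]
      have h1 : (0 : ℝ) ≤ (n + 5 * m + 4) * (τ - 1) :=
        mul_nonneg (by positivity) (by linarith)
      have h2 : (0 : ℝ) ≤ n := by positivity
      nlinarith)
    (fun i hi => by
      obtain ⟨d, rfl⟩ := Nat.exists_eq_add_of_le hi
      have h1 := carleman_lap_iterate hn hK hKR hf hτ hτ1 d i rfl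
      rw [← hQ] at h1
      have h2 : ∫ x, (wt x₀ (τ + n / 2 - 2 * i) (2 * τ + ((i + d : ℕ) : ℝ)) x * lap^[i] f x) ^ 2
          ≤ ∫ x, (wt x₀ (τ + n / 2 - 2 * i) (2 * τ + d) x * lap^[i] f x) ^ 2 := by
        refine integral_mono_test hK (hb _ _ (hf.lap_iterate hKc i))
          (hb _ _ (hf.lap_iterate hKc i)) fun x hx => ?_
        have h3 := wt_le_wt_right (hKR hx) (τ + n / 2 - 2 * i)
          (show 2 * τ + (d : ℝ) ≤ 2 * τ + ((i + d : ℕ) : ℝ) by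
            push_cast
            linarith [(Nat.cast_nonneg i : (0 : ℝ) ≤ i)])
        have h4 := (wt_pos (hKU hx) (τ + n / 2 - 2 * i) (2 * τ + ((i + d : ℕ) : ℝ))).le
        rw [mul_pow, mul_pow]
        gcongr
      refine h2.trans ?_
      refine le_of_mul_le_mul_left (a := (τ ^ 3 / 16) ^ d) (h1.trans ?_) (by positivity)
      -- With `i + d = m` the Carleman gain is `τ^{3d}`, while the interpolation lemma only asks for
      -- `τ^{3m - 4i}`; the surplus is `16^i τ^i ≥ 1`.
      have h5 : (τ ^ 3 / 16) ^ d * (τ ^ (4 * i) * (16 ^ (i + d) * ((τ ^ (3 * (i + d)))⁻¹ * Q)))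
          = 16 ^ i * τ ^ i * Q := by
        rw [div_pow, pow_add, mul_add, pow_add τ, ← pow_mul, show 4 * i = 3 * i + i by ring,
          pow_add τ (3 * i) i]
        field_simp
      rw [h5]
      exact le_mul_of_one_le_left hQ0
        (one_le_mul_of_one_le_of_one_le (one_le_pow₀ (by norm_num)) (one_le_pow₀ hτ1))) I hI
  refine key.trans (le_of_eq ?_)
  ring

theorem Test.eLpNorm_two {f : Space n → ℝ} (hK : IsCompact K) (hf : Test K f) :
    eLpNorm f 2 volume = ENNReal.ofReal (√(∫ x, f x ^ 2)) := by
  have h2 : Test K fun x => f x ^ 2 := by simpa only [sq] using hf.mul hf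
  rw [eLpNorm_eq_lintegral_rpow_enorm_toReal (by norm_num) (by norm_num), Real.sqrt_eq_rpow,
    ← ENNReal.ofReal_rpow_of_nonneg (integral_nonneg fun _ => sq_nonneg _) (by norm_num),
    ofReal_integral_eq_lintegral_ofReal (h2.integrable hK)
      (Filter.Eventually.of_forall fun _ => sq_nonneg _)]
  simp only [ENNReal.toReal_ofNat]
  congr 2
  ext x
  rw [← sq_abs, ENNReal.ofReal_pow (abs_nonneg _), ← Real.enorm_eq_ofReal_abs]
  norm_cast

theorem eLpNorm_two_le_of_integral_sq {f g : Space n → ℝ} (hK : IsCompact K) (hf : Test K f)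
    (hg : Test K g) {a : ℝ} (ha : 0 ≤ a) (h : ∫ x, f x ^ 2 ≤ a ^ 2 * ∫ x, g x ^ 2) :
    eLpNorm f 2 volume ≤ ENNReal.ofReal a * eLpNorm g 2 volume := by
  rw [hf.eLpNorm_two hK, hg.eLpNorm_two hK, ← ENNReal.ofReal_mul ha]
  refine ENNReal.ofReal_le_ofReal ?_
  rw [← Real.sqrt_sq ha, ← Real.sqrt_mul (sq_nonneg a)]
  exact Real.sqrt_le_sqrt h

/-- The norm of `e^{-τ φ} r^{2m} Δ^m f` in `L²(r^{-n} dx)`. -/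
noncomputable def lapNorm (m : ℕ) (x₀ : Space n) (τ : ℝ) (f : Space n → ℝ) : ℝ≥0∞ :=
  eLpNorm (fun x => wt x₀ (τ + n / 2 - 2 * m) (2 * τ) x * lap^[m] f x) 2 volume

/-- The square root of `carleman_wordDeriv`: each derivative costs `τ` against the total gain
`τ^{3m/2}`. -/
theorem carleman_eLpNorm (n m : ℕ) (hn : 2 ≤ n) :
    ∃ C : ℝ, 0 ≤ C ∧ ∀ (x₀ : Space n) (K : Set (Space n)), IsCompact K →
      K ⊆ Metric.ball x₀ (Real.exp (-8)) \ {x₀} → ∀ f, Test K f → ∀ τ : ℝ, 1 ≤ τ → 10 * m ≤ τ →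
      ∀ I : List (Fin n), I.length ≤ 2 * m →
        eLpNorm (fun x => wt x₀ (τ + n / 2 - I.length) (2 * τ + m) x * wordDeriv I f x) 2 volume
          ≤ ENNReal.ofReal (C * τ ^ (I.length - 3 * m / 2 : ℝ)) * lapNorm m x₀ τ f := by
  obtain ⟨C, hC0, hC⟩ := carleman_wordDeriv n m hn
  refine ⟨√C, Real.sqrt_nonneg _, fun x₀ K hK hKR f hf τ hτ1 hτ I hI => ?_⟩
  have hKU := subset_punctured hKR
  have hKc := hK.isClosed
  have hτ0 : 0 < τ := by linarith
  refine eLpNorm_two_le_of_integral_sq hK ((hf.wordDeriv hKc I).wt_mul hKc hKU _ _)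
    ((hf.lap_iterate hKc m).wt_mul hKc hKU _ _) (by positivity) ?_
  refine (hC x₀ K hK hKR f hf τ hτ1 hτ I hI).trans (le_of_eq ?_)
  rw [mul_pow, Real.sq_sqrt hC0, ← Real.rpow_natCast (τ ^ _) 2, ← Real.rpow_mul hτ0.le,
    show ((I.length : ℝ) - 3 * m / 2) * ((2 : ℕ) : ℝ)
      = ((2 * I.length : ℕ) : ℝ) - ((3 * m : ℕ) : ℝ) by push_cast; ring,
    Real.rpow_sub hτ0, Real.rpow_natCast, Real.rpow_natCast]
  ring

end

/-! ### Weighted Sobolev inequalities. -/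

section

open scoped NNReal

variable {n : ℕ} {K : Set (Space n)} {x₀ : Space n}

theorem norm_fderiv_le_sum_pd (f : Space n → ℝ) (x : Space n) :
    ‖fderiv ℝ f x‖ ≤ ∑ i, |pd i f x| := by
  refine ContinuousLinearMap.opNorm_le_bound _ (Finset.sum_nonneg fun _ _ => abs_nonneg _)
    fun v => ?_
  have h : v = ∑ i, v i • (EuclideanSpace.single i (1 : ℝ) : Space n) := by
    ext j
    simp [Finset.sum_apply, Pi.single_apply]
  calc ‖fderiv ℝ f x v‖ = |∑ i, v i * pd i f x| := by
        conv_lhs => rw [h]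
        simp [pd]
    _ ≤ ∑ i, |v i * pd i f x| := Finset.abs_sum_le_sum_abs _ _
    _ ≤ ∑ i, |pd i f x| * ‖v‖ := by
        refine Finset.sum_le_sum fun i _ => ?_
        rw [abs_mul, mul_comm]
        exact mul_le_mul_of_nonneg_left (PiLp.norm_apply_le v i) (abs_nonneg _)
    _ = _ := (Finset.sum_mul ..).symm

/-- One Sobolev step between weighted Lebesgue spaces. -/
theorem sobolev_step (n : ℕ) (hn : 0 < n) {p q q' : ℝ≥0} (hp : 1 ≤ p) (hpq : p ≤ q)
    (hq' : (q' : ℝ)⁻¹ = (p : ℝ)⁻¹ - (n : ℝ)⁻¹) :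
    ∃ C : ℝ, 0 ≤ C ∧ ∀ (x₀ : Space n) (K : Set (Space n)), IsCompact K →
      K ⊆ Metric.ball x₀ (Real.exp (-8)) \ {x₀} → ∀ g, Test K g → ∀ (σ ρ M : ℝ) (B : ℝ≥0∞),
      |σ| + |ρ| ≤ M →
      (∀ i, eLpNorm (fun x => wt x₀ σ ρ x * pd i g x) q volume ≤ B) →
      ENNReal.ofReal M * eLpNorm (fun x => wt x₀ (σ + 1) ρ x * g x) q volume ≤ B →
      eLpNorm (fun x => wt x₀ σ ρ x * g x) q' volume ≤ ENNReal.ofReal C * B := by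
  set V : ℝ≥0∞ := volume (Metric.ball (0 : Space n) 1)
  set e : ℝ := 1 / (p : ℝ≥0∞).toReal - 1 / (q : ℝ≥0∞).toReal with he
  have hp0 : 0 < (p : ℝ) := by exact_mod_cast zero_lt_one.trans_le hp
  have he0 : 0 ≤ e := sub_nonneg.2 (one_div_le_one_div_of_le hp0 (by exact_mod_cast hpq))
  have hV : V ^ e ≠ (⊤ : ℝ≥0∞) := ENNReal.rpow_ne_top_of_nonneg he0 measure_ball_lt_top.ne
  refine ⟨eLpNormLESNormFDerivOfEqInnerConst (volume : Measure (Space n)) p *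
    ((V ^ e).toReal * (2 * n)), by positivity,
    fun x₀ K hK hKR g hg σ ρ M B hM hB1 hB2 => ?_⟩
  have hKU := subset_punctured hKR
  have hKc := hK.isClosed
  have hh := hg.wt_mul hKc hKU σ ρ
  set h : Space n → ℝ := fun x => wt x₀ σ ρ x * g x with hhdef
  have hfr : Module.finrank ℝ (Space n) = n := by simp
  have hM0 : 0 ≤ M := (add_nonneg (abs_nonneg _) (abs_nonneg _)).trans hM
  have h1 : eLpNorm h q' volume
      ≤ eLpNormLESNormFDerivOfEqInnerConst (volume : Measure (Space n)) p
        * eLpNorm (fderiv ℝ h) p volume :=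
    eLpNorm_le_eLpNorm_fderiv_of_eq_inner volume (hh.smooth.of_le (by simp))
      (hh.hasCompactSupport hK) hp (by rwa [hfr]) (by rwa [hfr])
  have hcont : Continuous (fderiv ℝ h) := hh.smooth.continuous_fderiv (by simp)
  have hsupp : Function.support (fun x => ‖fderiv ℝ h x‖) ⊆ Metric.ball x₀ 1 := by
    intro x hx
    by_contra hx'
    refine hx (le_antisymm ((norm_fderiv_le_sum_pd h x).trans (le_of_eq ?_)) (norm_nonneg _))
    refine Finset.sum_eq_zero fun i _ => ?_
    rw [(hh.pd hKc i).zero x fun hxK => hx' (hKU hxK).1, abs_zero]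
  -- Hölder on the unit ball lowers `q` to `p`. The freedom `p < q` serves the critical dimension,
  -- where the last step starts from `L^n` and must leave the borderline exponent.
  have h2 : eLpNorm (fderiv ℝ h) p volume ≤ eLpNorm (fderiv ℝ h) q volume * V ^ e := by
    have := eLpNorm_le_eLpNorm_mul_rpow_measure_univ (μ := volume.restrict (Metric.ball x₀ 1))
      (ENNReal.coe_le_coe.2 hpq) hcont.norm.aestronglyMeasurable
    rwa [eLpNorm_restrict_eq_of_support_subset hsupp, eLpNorm_restrict_eq_of_support_subset hsupp,
      eLpNorm_norm, eLpNorm_norm,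
      Measure.restrict_apply_univ, Measure.addHaar_ball_center] at this
  have hT1 : ∀ i, Test K fun x => wt x₀ σ ρ x * pd i g x := fun i =>
    (hg.pd hKc i).wt_mul hKc hKU σ ρ
  have hT2 : Test K fun x => wt x₀ (σ + 1) ρ x * g x := hg.wt_mul hKc hKU _ ρ
  -- Differentiating the weight costs `M/r`, and the `1/r` turns `σ` into `σ + 1`.
  have hpt : ∀ x i, |pd i h x| ≤ |wt x₀ σ ρ x * pd i g x| + M * |wt x₀ (σ + 1) ρ x * g x| := by
    intro x i
    by_cases hx : x ∈ K
    · have hU := hKU hx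
      have h0 := norm_pos_of_mem hU
      rw [hhdef, (hasPD_wt_mul hU hg σ ρ i).2]
      refine (abs_sub _ _).trans (add_le_add le_rfl ?_)
      have e1 : (σ + ρ / Real.log ‖x - x₀‖) * ((x i - x₀ i) / ‖x - x₀‖ ^ 2) * (wt x₀ σ ρ x * g x)
          = (σ + ρ / Real.log ‖x - x₀‖) * ((x i - x₀ i) / ‖x - x₀‖)
            * (wt x₀ (σ + 1) ρ x * g x) := by
        rw [wt_add_one hU]
        field_simp
      rw [e1, abs_mul, abs_mul]
      refine mul_le_mul_of_nonneg_right ?_ (abs_nonneg _)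
      calc _ ≤ M * 1 := mul_le_mul ((abs_add_div_log_le (hKR hx) σ ρ).trans hM)
            (abs_coord_div_le hU i) (abs_nonneg _) hM0
        _ = M := mul_one M
    · rw [(hh.pd hKc i).zero x hx, abs_zero]
      positivity
  have hq1 : (1 : ℝ≥0∞) ≤ q := by exact_mod_cast hp.trans hpq
  have h3 : eLpNorm (fderiv ℝ h) q volume ≤ ENNReal.ofReal (2 * n) * B := by
    have ha1 : ∀ i, AEStronglyMeasurable (fun x => ‖wt x₀ σ ρ x * pd i g x‖) volume := fun i =>
      (hT1 i).smooth.continuous.norm.aestronglyMeasurable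
    have ha2 : AEStronglyMeasurable (M • fun x => ‖wt x₀ (σ + 1) ρ x * g x‖) volume :=
      hT2.smooth.continuous.norm.aestronglyMeasurable.const_smul M
    calc eLpNorm (fderiv ℝ h) q volume
        ≤ eLpNorm (∑ i : Fin n, ((fun x => ‖wt x₀ σ ρ x * pd i g x‖)
          + M • fun x => ‖wt x₀ (σ + 1) ρ x * g x‖)) q volume := by
          refine eLpNorm_mono_real fun x => (norm_fderiv_le_sum_pd h x).trans ?_
          rw [Finset.sum_apply]
          exact Finset.sum_le_sum fun i _ => hpt x i
      _ ≤ ∑ i : Fin n, (B + B) := by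
          refine (eLpNorm_sum_le (fun i _ => (ha1 i).add ha2) hq1).trans
            (Finset.sum_le_sum fun i _ => (eLpNorm_add_le (ha1 i) ha2 hq1).trans ?_)
          refine add_le_add ?_ ?_
          · rw [eLpNorm_norm]
            exact hB1 i
          · refine eLpNorm_const_smul_le.trans ?_
            rw [eLpNorm_norm, Real.enorm_of_nonneg hM0]
            exact hB2
      _ = _ := by
          rw [Finset.sum_const, Finset.card_univ, Fintype.card_fin, nsmul_eq_mul, ← two_mul,
            ← mul_assoc, ENNReal.ofReal_mul zero_le_two]
          simp [mul_comm]
  calc eLpNorm h q' volume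
      ≤ eLpNormLESNormFDerivOfEqInnerConst (volume : Measure (Space n)) p *
        (ENNReal.ofReal (2 * n) * B * V ^ e) := h1.trans (by gcongr; exact h2.trans (by gcongr))
    _ = _ := by
        rw [ENNReal.ofReal_mul (NNReal.coe_nonneg _), ENNReal.ofReal_mul ENNReal.toReal_nonneg,
          ENNReal.ofReal_toReal hV, ENNReal.ofReal_coe_nnreal]
        ring

/-- Scale invariant Sobolev estimates: `j` derivatives are traded for integrability. -/
theorem sobolev_chain (n m : ℕ) (hn : 2 ≤ n) (j : ℕ) : 2 * j < n → j ≤ 2 * m →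
    ∀ q : ℝ≥0, (q : ℝ)⁻¹ = 1 / 2 - j / n →
    ∃ C : ℝ, 0 ≤ C ∧ ∀ (x₀ : Space n) (K : Set (Space n)), IsCompact K →
      K ⊆ Metric.ball x₀ (Real.exp (-8)) \ {x₀} → ∀ f, Test K f → ∀ τ : ℝ, 1 ≤ τ → 10 * m ≤ τ →
      ∀ I : List (Fin n), I.length + j ≤ 2 * m →
        eLpNorm (fun x => wt x₀ (τ + n / 2 - j - I.length) (2 * τ + m) x * wordDeriv I f x) q volume
          ≤ ENNReal.ofReal (C * τ ^ (I.length + j - 3 * m / 2 : ℝ)) * lapNorm m x₀ τ f := by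
  have hn0 : (0 : ℝ) < n := by exact_mod_cast (by omega : 0 < n)
  induction j with
  | zero =>
    intro _ _ q hq
    obtain rfl : q = 2 := by
      have : (q : ℝ) = 2 := by
        rw [← inv_inj, hq]
        norm_num
      exact_mod_cast this
    obtain ⟨C, hC0, hC⟩ := carleman_eLpNorm n m hn
    refine ⟨C, hC0, fun x₀ K hK hKR f hf τ hτ1 hτ I hI => ?_⟩
    simpa using hC x₀ K hK hKR f hf τ hτ1 hτ I (by omega)
  | succ j ih =>
    intro hjn hjm q' hq'
    push_cast at hq'
    have hpos : (0 : ℝ) < 1 / 2 - j / n := by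
      have : 2 * (j : ℝ) < n := by exact_mod_cast (by omega : 2 * j < n)
      rw [sub_pos, div_lt_div_iff₀ hn0 two_pos]
      linarith
    obtain ⟨q, hq⟩ : ∃ q : ℝ≥0, (q : ℝ)⁻¹ = 1 / 2 - j / n :=
      ⟨⟨(1 / 2 - j / n)⁻¹, (inv_pos.2 hpos).le⟩, inv_inv _⟩
    have hq1 : 1 ≤ q := by
      rw [← NNReal.coe_le_coe, NNReal.coe_one, ← inv_inv (q : ℝ), hq]
      refine (one_le_inv₀ hpos).2 ?_
      have : (0 : ℝ) ≤ j / n := by positivity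
      linarith
    obtain ⟨C, hC0, hC⟩ := ih (by omega) (by omega) q hq
    obtain ⟨D, hD0, hD⟩ := sobolev_step n (by omega) (p := q) (q := q) (q' := q') hq1 le_rfl (by
      rw [hq', hq]
      field_simp
      ring)
    refine ⟨D * ((n + 5 * m + 3) * C), by positivity, fun x₀ K hK hKR f hf τ hτ1 hτ I hI => ?_⟩
    have hτ0 : 0 < τ := by linarith
    have hKc := hK.isClosed
    have hIj : (I.length : ℝ) + j + 1 ≤ 2 * m := by exact_mod_cast hI
    -- With `M` a multiple of `τ`, both hypotheses of the Sobolev step have the same size `τ^{|I| +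
    -- j + 1 - 3m/2}`: the gradient through one more letter in the word, the zeroth order term
    -- through the factor `M`.
    have key := hD x₀ K hK hKR (wordDeriv I f) (hf.wordDeriv hKc I)
      (τ + n / 2 - (j + 1 : ℕ) - I.length) (2 * τ + m) ((n + 5 * m + 3) * τ)
      (ENNReal.ofReal ((n + 5 * m + 3) * C * τ ^ (I.length + (j + 1 : ℕ) - 3 * m / 2 : ℝ))
        * lapNorm m x₀ τ f) ?_ ?_ ?_
    · refine key.trans (le_of_eq ?_)
      rw [← mul_assoc, ← ENNReal.ofReal_mul hD0]
      congr 2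
      ring
    · have h1 : |τ + n / 2 - (j + 1 : ℕ) - I.length| ≤ τ + n / 2 + 2 * m := by
        push_cast
        have : (0 : ℝ) ≤ (I.length : ℝ) + j := by positivity
        rw [abs_le]
        constructor <;> linarith
      rw [abs_of_nonneg (by positivity : 0 ≤ 2 * τ + (m : ℝ))]
      have h2 : (0 : ℝ) ≤ (n + 5 * m) * (τ - 1) := mul_nonneg (by positivity) (by linarith)
      have h3 : (0 : ℝ) ≤ m := by positivity
      nlinarith
    · intro i
      have := hC x₀ K hK hKR f hf τ hτ1 hτ (i :: I) (by simp only [List.length_cons]; omega)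
      simp only [List.length_cons] at this
      push_cast at this ⊢
      rw [show τ + n / 2 - ((j : ℝ) + 1) - I.length = τ + n / 2 - j - (I.length + 1) by ring]
      refine this.trans ?_
      gcongr ENNReal.ofReal ?_ * _
      rw [show (I.length : ℝ) + 1 + j - 3 * m / 2 = I.length + (j + 1) - 3 * m / 2 by ring]
      gcongr
      refine le_mul_of_one_le_left hC0 ?_
      have h3 : (0 : ℝ) ≤ m := by positivity
      linarith
    · have := hC x₀ K hK hKR f hf τ hτ1 hτ I (by omega)
      push_cast
      rw [show τ + n / 2 - ((j : ℝ) + 1) - I.length + 1 = τ + n / 2 - j - I.length by ring]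
      calc _ ≤ _ := mul_le_mul_right this _
        _ = _ := by
          rw [← mul_assoc, ← ENNReal.ofReal_mul (by positivity)]
          congr 2
          rw [show (I.length : ℝ) + (j + 1) - 3 * m / 2 = (I.length + j - 3 * m / 2) + 1 by ring,
            Real.rpow_add_one hτ0.ne']
          ring

end

/-! ### Pointwise values controlled by integrals over rays. -/

section

variable {n : ℕ}

/-- A Hardy inequality on an interval. -/
theorem integral_pow_mul_abs_le {F F' : ℝ → ℝ} (hF : ∀ s, HasDerivAt F (F' s) s)
    (hF' : Continuous F') {δ : ℝ} (hδ : 0 < δ) (h0 : F δ = 0) (a : ℕ) :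
    ∫ s in (0 : ℝ)..δ, s ^ a * |F s| ≤ ∫ s in (0 : ℝ)..δ, s ^ (a + 1) * |F' s| := by
  have hFc : Continuous F := continuous_iff_continuousAt.2 fun s => (hF s).continuousAt
  -- `Φ` dominates `|F|` on `[0, δ]` because `F δ = 0`, and `s^{a+1} Φ` vanishes at both ends, so
  -- its derivative integrates to zero. The sharper factor `a + 1` on the left is dropped at the
  -- end.
  set Φ : ℝ → ℝ := fun s => ∫ t in s..δ, |F' t| with hΦ
  have hΦd : ∀ s, HasDerivAt Φ (-|F' s|) s := fun s =>
    intervalIntegral.integral_hasDerivAt_left (hF'.abs.intervalIntegrable _ _)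
      hF'.abs.stronglyMeasurable.stronglyMeasurableAtFilter hF'.abs.continuousAt
  have hΦc : Continuous Φ := continuous_iff_continuousAt.2 fun s => (hΦd s).continuousAt
  have hFΦ : ∀ s ∈ Set.Icc 0 δ, |F s| ≤ Φ s := by
    intro s hs
    have h1 : ∫ t in s..δ, F' t = F δ - F s :=
      intervalIntegral.integral_eq_sub_of_hasDerivAt (fun t _ => hF t) (hF'.intervalIntegrable _ _)
    have h2 := intervalIntegral.abs_integral_le_integral_abs (f := F') (μ := volume) hs.2
    rwa [h1, h0, zero_sub, abs_neg] at h2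
  have hd : ∀ s, HasDerivAt (fun s => s ^ (a + 1) * Φ s)
      ((a + 1) * (s ^ a * Φ s) - s ^ (a + 1) * |F' s|) s := fun s => by
    refine ((hasDerivAt_pow (a + 1) s).mul (hΦd s)).congr_deriv ?_
    push_cast
    simp
    ring
  have i1 : IntervalIntegrable (fun s => (a + 1 : ℝ) * (s ^ a * Φ s)) volume 0 δ :=
    Continuous.intervalIntegrable (by fun_prop) _ _
  have i2 : IntervalIntegrable (fun s => s ^ (a + 1) * |F' s|) volume 0 δ :=
    Continuous.intervalIntegrable (by fun_prop) _ _
  have h3 := intervalIntegral.integral_eq_sub_of_hasDerivAt (fun s _ => hd s) (i1.sub i2)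
  rw [intervalIntegral.integral_sub i1 i2, intervalIntegral.integral_const_mul] at h3
  have hΦδ : Φ δ = 0 := intervalIntegral.integral_same
  rw [hΦδ] at h3
  simp only [mul_zero, ne_eq, Nat.add_eq_zero_iff, one_ne_zero, and_false, not_false_eq_true,
    zero_pow, zero_mul, sub_zero] at h3
  have h4 : ∫ s in (0 : ℝ)..δ, s ^ a * |F s| ≤ ∫ s in (0 : ℝ)..δ, s ^ a * Φ s := by
    refine intervalIntegral.integral_mono_on hδ.le
      (Continuous.intervalIntegrable (by fun_prop) _ _)
      (Continuous.intervalIntegrable (by fun_prop) _ _) fun s hs => ?_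
    exact mul_le_mul_of_nonneg_left (hFΦ s hs) (pow_nonneg hs.1 a)
  have h5 : 0 ≤ ∫ s in (0 : ℝ)..δ, s ^ a * Φ s :=
    intervalIntegral.integral_nonneg hδ.le fun s hs =>
      mul_nonneg (pow_nonneg hs.1 a) ((abs_nonneg _).trans (hFΦ s hs))
  have h6 : 0 ≤ (a : ℝ) * ∫ s in (0 : ℝ)..δ, s ^ a * Φ s := mul_nonneg (by positivity) h5
  linarith

/-- The integral of `s^a (1 - s/δ)^b |g|` along the segment from `x` to `x + δ z`. -/
noncomputable def rayIntegral (δ : ℝ) (a b : ℕ) (g : Space n → ℝ) (x z : Space n) : ℝ :=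
  ∫ s in (0 : ℝ)..δ, s ^ a * (1 - s / δ) ^ b * |g (x + s • z)|

theorem continuous_rayIntegral {g : Space n → ℝ} (hg : Continuous g) (δ : ℝ) (a b : ℕ)
    (x : Space n) : Continuous (rayIntegral δ a b g x) := by
  unfold rayIntegral
  refine intervalIntegral.continuous_parametric_intervalIntegral_of_continuous' ?_ _ _
  fun_prop

theorem hasDerivAt_ray {g : Space n → ℝ} (hg : ContDiff ℝ ∞ g) (x z : Space n) (s : ℝ) :
    HasDerivAt (fun s : ℝ => g (x + s • z)) (∑ j, z j * pd j g (x + s • z)) s := by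
  have h1 : HasDerivAt (fun s : ℝ => x + s • z) z s := by
    simpa using ((hasDerivAt_id s).smul_const z).const_add x
  refine (((hg.differentiable (by simp) _).hasFDerivAt).comp_hasDerivAt s h1).congr_deriv ?_
  have h : z = ∑ i, z i • (EuclideanSpace.single i (1 : ℝ) : Space n) := by
    ext j
    simp [Finset.sum_apply, Pi.single_apply]
  conv_lhs => rw [h]
  simp only [map_sum, map_smul, smul_eq_mul, pd]
  rw [← h]

theorem continuous_pd {g : Space n → ℝ} (hg : ContDiff ℝ ∞ g) (j : Fin n) :
    Continuous (pd j g) :=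
  (hg.continuous_fderiv (by simp)).clm_apply continuous_const

section ray

variable {g : Space n → ℝ} {x z : Space n} {δ : ℝ}

/-- The power `b + 1` of the cutoff makes the function vanish at `s = δ`, so no boundary term arises
there, and one power remains after differentiating the cutoff. -/
theorem hasDerivAt_cutoff_ray (hg : ContDiff ℝ ∞ g) (x z : Space n) (δ : ℝ) (b : ℕ) (s : ℝ) :
    HasDerivAt (fun s : ℝ => (1 - s / δ) ^ (b + 1) * g (x + s • z))
      ((1 - s / δ) ^ (b + 1) * ∑ j, z j * pd j g (x + s • z)
        - (b + 1) / δ * ((1 - s / δ) ^ b * g (x + s • z))) s := by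
  have h1 : HasDerivAt (fun s : ℝ => 1 - s / δ) (-(1 / δ)) s := by
    simpa using ((hasDerivAt_id s).div_const δ).const_sub 1
  refine ((h1.pow (b + 1)).mul (hasDerivAt_ray hg x z s)).congr_deriv ?_
  simp
  ring

theorem abs_deriv_cutoff_ray_le (hz : ‖z‖ ≤ 1) (hδ : 0 < δ) (b : ℕ) {s : ℝ}
    (hs : s ∈ Set.Icc 0 δ) :
    |(1 - s / δ) ^ (b + 1) * ∑ j, z j * pd j g (x + s • z)
        - (b + 1) / δ * ((1 - s / δ) ^ b * g (x + s • z))|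
      ≤ ∑ j, (1 - s / δ) ^ b * |pd j g (x + s • z)|
        + (b + 1) / δ * ((1 - s / δ) ^ b * |g (x + s • z)|) := by
  have h0 : 0 ≤ 1 - s / δ := by
    rw [sub_nonneg, div_le_one hδ]
    exact hs.2
  have h1 : 1 - s / δ ≤ 1 := by
    have := div_nonneg hs.1 hδ.le
    linarith
  refine (abs_sub _ _).trans (add_le_add ?_ ?_)
  · rw [abs_mul, abs_of_nonneg (pow_nonneg h0 _), ← Finset.mul_sum]
    refine mul_le_mul (pow_le_pow_of_le_one h0 h1 (Nat.le_succ b)) ?_ (abs_nonneg _)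
      (pow_nonneg h0 _)
    refine (Finset.abs_sum_le_sum_abs _ _).trans (Finset.sum_le_sum fun j _ => ?_)
    rw [abs_mul]
    exact mul_le_of_le_one_left (abs_nonneg _) ((PiLp.norm_apply_le z j).trans hz)
  · rw [abs_mul, abs_mul, abs_of_nonneg (pow_nonneg h0 b), abs_of_nonneg (by positivity)]

theorem integral_deriv_cutoff_ray_le (hg : ContDiff ℝ ∞ g) (hz : ‖z‖ ≤ 1) (hδ : 0 < δ)
    (a b : ℕ) :
    ∫ s in (0 : ℝ)..δ, s ^ a * |(1 - s / δ) ^ (b + 1) * ∑ j, z j * pd j g (x + s • z)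
        - (b + 1) / δ * ((1 - s / δ) ^ b * g (x + s • z))|
      ≤ ∑ j, rayIntegral δ a b (pd j g) x z + (b + 1) / δ * rayIntegral δ a b g x z := by
  have hgc := hg.continuous
  have hpc := fun j => continuous_pd hg j
  have i1 : ∀ h : Space n → ℝ, Continuous h → IntervalIntegrable
      (fun s : ℝ => s ^ a * (1 - s / δ) ^ b * |h (x + s • z)|) volume 0 δ := fun h hh =>
    Continuous.intervalIntegrable (by fun_prop) _ _
  have h1 : ∑ j, rayIntegral δ a b (pd j g) x z + (b + 1) / δ * rayIntegral δ a b g x z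
      = ∫ s in (0 : ℝ)..δ, (∑ j, s ^ a * (1 - s / δ) ^ b * |pd j g (x + s • z)|
        + (b + 1) / δ * (s ^ a * (1 - s / δ) ^ b * |g (x + s • z)|)) := by
    rw [intervalIntegral.integral_add
      (Continuous.intervalIntegrable (by fun_prop) _ _)
      ((i1 g hgc).const_mul _), intervalIntegral.integral_const_mul,
      intervalIntegral.integral_finsetSum fun j _ => i1 _ (hpc j)]
    rfl
  rw [h1]
  refine intervalIntegral.integral_mono_on hδ.le (Continuous.intervalIntegrable (by fun_prop) _ _)
    (Continuous.intervalIntegrable (by fun_prop) _ _) fun s hs => ?_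
  refine (mul_le_mul_of_nonneg_left (abs_deriv_cutoff_ray_le hz hδ b hs)
    (pow_nonneg hs.1 a)).trans (le_of_eq ?_)
  rw [mul_add, Finset.mul_sum]
  congr 1
  · exact Finset.sum_congr rfl fun j _ => by ring
  · ring

/-- Hardy's inequality for the cutoff function along the ray: one power of the cutoff is exchanged
for one power of `s`, at the cost of a derivative or of a factor `1/δ`. -/
theorem rayIntegral_succ_le (hg : ContDiff ℝ ∞ g) (hz : ‖z‖ ≤ 1) (hδ : 0 < δ) (a b : ℕ) :
    rayIntegral δ a (b + 1) g x z ≤ ∑ j, rayIntegral δ (a + 1) b (pd j g) x z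
      + (b + 1) / δ * rayIntegral δ (a + 1) b g x z := by
  have hgc := hg.continuous
  have hpc := fun j => continuous_pd hg j
  refine le_trans (le_of_eq ?_) ((integral_pow_mul_abs_le
    (fun s => hasDerivAt_cutoff_ray hg x z δ b s) (by fun_prop) hδ (by simp [hδ.ne']) a).trans
    (integral_deriv_cutoff_ray_le hg hz hδ (a + 1) b))
  refine intervalIntegral.integral_congr fun s hs => ?_
  rw [Set.uIcc_of_le hδ.le] at hs
  have h0 : 0 ≤ 1 - s / δ := by
    rw [sub_nonneg, div_le_one hδ]
    exact hs.2
  rw [abs_mul, abs_of_nonneg (pow_nonneg h0 _), mul_assoc]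

/-- The fundamental theorem of calculus on `[0, δ]`: the cutoff function equals `g x` at `0` and
vanishes at `δ`. -/
theorem abs_le_rayIntegral (hg : ContDiff ℝ ∞ g) (hz : ‖z‖ ≤ 1) (hδ : 0 < δ) (b : ℕ) :
    |g x| ≤ ∑ j, rayIntegral δ 0 b (pd j g) x z + (b + 1) / δ * rayIntegral δ 0 b g x z := by
  have hgc := hg.continuous
  have hpc := fun j => continuous_pd hg j
  refine le_trans ?_ (integral_deriv_cutoff_ray_le hg hz hδ 0 b)
  have h1 := intervalIntegral.integral_eq_sub_of_hasDerivAt (a := 0) (b := δ)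
    (fun s _ => hasDerivAt_cutoff_ray hg x z δ b s)
    (Continuous.intervalIntegrable (by fun_prop) _ _)
  have h2 := intervalIntegral.abs_integral_le_integral_abs (μ := volume)
    (f := fun s : ℝ => (1 - s / δ) ^ (b + 1) * ∑ j, z j * pd j g (x + s • z)
        - (b + 1) / δ * ((1 - s / δ) ^ b * g (x + s • z))) hδ.le
  rw [h1] at h2
  simpa [hδ.ne'] using h2

end ray

/-- The average over directions of `rayIntegral`. -/
noncomputable def coneIntegral (δ : ℝ) (a b : ℕ) (g : Space n → ℝ) (x : Space n) : ℝ :=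
  ∫ z in Metric.closedBall (0 : Space n) 1, rayIntegral δ a b g x z

theorem coneIntegral_mono {g : Space n → ℝ} (hg : ContDiff ℝ ∞ g) {x : Space n} {δ : ℝ}
    {a b : ℕ} {c : ℝ} {φ : Space n → ℝ} (hφ : Continuous φ)
    (h : ∀ z : Space n, ‖z‖ ≤ 1 → φ z ≤ ∑ j, rayIntegral δ a b (pd j g) x z
      + c * rayIntegral δ a b g x z) :
    ∫ z in Metric.closedBall (0 : Space n) 1, φ z
      ≤ ∑ j, coneIntegral δ a b (pd j g) x + c * coneIntegral δ a b g x := by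
  have hc : ∀ h : Space n → ℝ, Continuous h →
      IntegrableOn (rayIntegral δ a b h x) (Metric.closedBall (0 : Space n) 1) := fun h hh =>
    (continuous_rayIntegral hh δ a b x).continuousOn.integrableOn_compact
      (isCompact_closedBall 0 1)
  have h1 : IntegrableOn (fun z => ∑ j, rayIntegral δ a b (pd j g) x z)
      (Metric.closedBall (0 : Space n) 1) :=
    integrable_finsetSum _ fun j _ => hc _ (continuous_pd hg j)
  unfold coneIntegral
  rw [← integral_finsetSum _ fun j _ => hc _ (continuous_pd hg j), ← integral_const_mul,
    ← integral_add h1 ((hc _ hg.continuous).const_mul c)]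
  refine setIntegral_mono_on (hφ.continuousOn.integrableOn_compact (isCompact_closedBall 0 1))
    (h1.add ((hc _ hg.continuous).const_mul c)) Metric.isClosed_closedBall.measurableSet
    fun z hz => h z (by simpa using hz)

theorem contDiff_wordDeriv {f : Space n → ℝ} (hf : ContDiff ℝ ∞ f) (I : List (Fin n)) :
    ContDiff ℝ ∞ (wordDeriv I f) := by
  have h : Test Set.univ f := ⟨hf, fun x hx => (hx trivial).elim⟩
  exact (h.wordDeriv isClosed_univ I).smooth

/-- Along the induction `a + b = k - 1` is constant: `rayIntegral_succ_le` moves powers from the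
cutoff to `s` until the kernel is `s^{k-1}`. A derivative taken and a factor `1/δ` have the same
homogeneity, which is why a single `X` suffices. -/
theorem coneIntegral_wordDeriv_le (n k : ℕ) (b : ℕ) : ∃ C : ℝ, 0 ≤ C ∧
    ∀ (f : Space n → ℝ), ContDiff ℝ ∞ f → ∀ (x : Space n) (δ X : ℝ), 0 < δ →
      (∀ J : List (Fin n), J.length ≤ k →
        coneIntegral δ (k - 1) 0 (wordDeriv J f) x ≤ δ ^ (k - J.length) * X) →
      ∀ a, a + b = k - 1 → ∀ I : List (Fin n), I.length + b ≤ k →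
        coneIntegral δ a b (wordDeriv I f) x ≤ C * δ ^ (k - b - I.length) * X := by
  induction b with
  | zero =>
    refine ⟨1, zero_le_one, fun f _ x δ X _ hX a ha I hI => ?_⟩
    obtain rfl : a = k - 1 := ha
    simpa using hX I (by omega)
  | succ b ih =>
    obtain ⟨C, hC0, hC⟩ := ih
    refine ⟨(n + (b + 1)) * C, by positivity, fun f hf x δ X hδ hX a ha I hI => ?_⟩
    have hI' := contDiff_wordDeriv hf I
    refine (coneIntegral_mono hI' (continuous_rayIntegral hI'.continuous δ a (b + 1) x)
      (fun z hz => rayIntegral_succ_le hI' hz hδ a b)).trans ?_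
    have h1 : ∀ j, coneIntegral δ (a + 1) b (pd j (wordDeriv I f)) x
        ≤ C * δ ^ (k - (b + 1) - I.length) * X := fun j => by
      have := hC f hf x δ X hδ hX (a + 1) (by omega) (j :: I)
        (by simp only [List.length_cons]; omega)
      rwa [List.length_cons, show k - b - (I.length + 1) = k - (b + 1) - I.length by omega] at this
    have h2 := hC f hf x δ X hδ hX (a + 1) (by omega) I (by omega)
    rw [show k - b - I.length = k - (b + 1) - I.length + 1 by omega] at h2
    calc _ ≤ ∑ _j : Fin n, C * δ ^ (k - (b + 1) - I.length) * X
          + (b + 1) / δ * (C * δ ^ (k - (b + 1) - I.length + 1) * X) := by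
          gcongr with j _
          exact h1 j
      _ = _ := by
          rw [Finset.sum_const, Finset.card_univ, Fintype.card_fin, nsmul_eq_mul, pow_succ]
          field_simp

/-- The kernel starts at `a = 0`, `b = k - 1` and ends as `s^{k-1}`. After averaging in the
direction this is essentially the potential kernel `|y - x|^{k-n}`, square integrable near `x` when
`n < 2k`. -/
theorem abs_le_of_coneIntegral (n k : ℕ) (hk : 1 ≤ k) : ∃ C : ℝ, 0 ≤ C ∧
    ∀ (f : Space n → ℝ), ContDiff ℝ ∞ f → ∀ (x : Space n) (δ X : ℝ), 0 < δ →
      (∀ J : List (Fin n), J.length ≤ k →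
        coneIntegral δ (k - 1) 0 (wordDeriv J f) x ≤ δ ^ (k - J.length) * X) →
      |f x| ≤ C * X := by
  obtain ⟨C, hC0, hC⟩ := coneIntegral_wordDeriv_le n k (k - 1)
  set v : ℝ := volume.real (Metric.closedBall (0 : Space n) 1)
  have hv : 0 < v := ENNReal.toReal_pos
    (Metric.measure_closedBall_pos volume _ one_pos).ne' measure_closedBall_lt_top.ne
  refine ⟨v⁻¹ * ((n + k) * C), by positivity, fun f hf x δ X hδ hX => ?_⟩
  have h1 := coneIntegral_mono (x := x) (δ := δ) hf (φ := fun _ => |f x|) continuous_const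
    (fun z hz => abs_le_rayIntegral hf hz hδ (k - 1))
  rw [setIntegral_const, smul_eq_mul] at h1
  have h2 : ∀ j, coneIntegral δ 0 (k - 1) (pd j f) x ≤ C * X := fun j => by
    have := hC f hf x δ X hδ hX 0 (by omega) [j] (by simp only [List.length_singleton]; omega)
    rwa [List.length_singleton, show k - (k - 1) - 1 = 0 by omega, pow_zero, mul_one] at this
  have h3 := hC f hf x δ X hδ hX 0 (by omega) [] (by simp)
  rw [List.length_nil, show k - (k - 1) - 0 = 1 by omega, pow_one] at h3
  have h4 : v * |f x| ≤ (n + k) * C * X := by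
    refine h1.trans ?_
    calc _ ≤ ∑ _j : Fin n, C * X + ((k - 1 : ℕ) + 1) / δ * (C * δ * X) := by
          gcongr with j _
          · exact h2 j
          · exact h3
      _ = _ := by
          rw [Finset.sum_const, Finset.card_univ, Fintype.card_fin, nsmul_eq_mul,
            Nat.cast_sub hk]
          field_simp
          push_cast
          ring
  rw [mul_assoc, ← div_eq_inv_mul, le_div_iff₀' hv]
  exact h4

end

/-! ### The local Sobolev inequality and the pointwise Carleman estimate. -/

section

variable {n : ℕ}

theorem coneIntegral_eq {g : Space n → ℝ} (hg : Continuous g) (δ : ℝ) (a : ℕ) (x : Space n) :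
    coneIntegral δ a 0 g x
      = ∫ s in (0 : ℝ)..δ, s ^ a * ∫ z in Metric.closedBall (0 : Space n) 1, |g (x + s • z)| := by
  unfold coneIntegral rayIntegral
  rw [← intervalIntegral_integral_swap]
  · refine intervalIntegral.integral_congr fun s _ => ?_
    simp only [pow_zero, mul_one]
    exact integral_const_mul _ _
  · rw [Measure.prod_restrict]
    have hc : Continuous (Function.uncurry fun (s : ℝ) (z : Space n) =>
        s ^ a * (1 - s / δ) ^ 0 * |g (x + s • z)|) := by
      unfold Function.uncurry
      fun_prop
    have h : IntegrableOn (Function.uncurry fun (s : ℝ) (z : Space n) =>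
        s ^ a * (1 - s / δ) ^ 0 * |g (x + s • z)|)
        (Set.uIcc 0 δ ×ˢ Metric.closedBall (0 : Space n) 1) (volume.prod volume) :=
      hc.continuousOn.integrableOn_compact (isCompact_uIcc.prod (isCompact_closedBall 0 1))
    exact h.mono_set (Set.prod_mono Set.uIoc_subset_uIcc subset_rfl)

theorem integral_closedBall_comp_smul {g : Space n → ℝ} (x : Space n) {s : ℝ} (hs : 0 < s) :
    ∫ z in Metric.closedBall (0 : Space n) 1, g (x + s • z)
      = (s ^ n)⁻¹ * ∫ y in Metric.closedBall x s, g y := by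
  rw [Measure.setIntegral_comp_smul_of_pos volume (fun y => g (x + y)) _ hs,
    _root_.smul_closedBall _ _ zero_le_one]
  have h := (measurePreserving_add_left (volume : Measure (Space n)) x).setIntegral_preimage_emb
    (measurableEmbedding_addLeft x) g (Metric.closedBall x s)
  simp only [preimage_add_closedBall, sub_self] at h
  simp only [smul_zero, Real.norm_eq_abs, abs_of_pos hs, mul_one, finrank_euclideanSpace,
    Fintype.card_fin, smul_eq_mul]
  rw [h]

/-- At scale `s` the mean of `|g|` over a ball is at most a constant times `s^{-n/2} Y`, and
`s^{k-1-n/2}` is integrable at `0` exactly because `n < 2k`. -/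
theorem coneIntegral_le_of_integral_sq (n k : ℕ) (hk : 1 ≤ k) (hnk : n < 2 * k) :
    ∃ C : ℝ, 0 ≤ C ∧ ∀ (g : Space n → ℝ), Continuous g → ∀ (x : Space n) (δ Y : ℝ), 0 < δ →
      0 < Y → ∫ y in Metric.closedBall x δ, g y ^ 2 ≤ Y ^ 2 →
      coneIntegral δ (k - 1) 0 g x ≤ C * δ ^ (k - n / 2 : ℝ) * Y := by
  set v : ℝ := volume.real (Metric.closedBall (0 : Space n) 1)
  have hk' : (0 : ℝ) < k - n / 2 := by
    have : (n : ℝ) < 2 * k := by exact_mod_cast hnk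
    linarith
  refine ⟨(v + 1) / 2 / (k - n / 2), by positivity, fun g hg x δ Y hδ hY h => ?_⟩
  rw [coneIntegral_eq hg]
  have hin : ∀ s ∈ Set.Ioo 0 δ, ∫ z in Metric.closedBall (0 : Space n) 1, |g (x + s • z)|
      ≤ (v + 1) / 2 * Y * s ^ (-(n / 2) : ℝ) := by
    intro s hs
    have hs0 := hs.1
    have hp : 0 < s ^ (-(n / 2) : ℝ) := Real.rpow_pos_of_pos hs0 _
    have hsn : (s ^ n)⁻¹ = s ^ (-(n / 2) : ℝ) * s ^ (-(n / 2) : ℝ) := by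
      rw [← Real.rpow_add hs0, ← Real.rpow_natCast, ← Real.rpow_neg hs0.le]
      ring_nf
    have i1 : IntegrableOn (fun z => |g (x + s • z)|) (Metric.closedBall (0 : Space n) 1) :=
      (Continuous.continuousOn (by fun_prop)).integrableOn_compact (isCompact_closedBall 0 1)
    have i2 : IntegrableOn (fun z => g (x + s • z) ^ 2) (Metric.closedBall (0 : Space n) 1) :=
      (Continuous.continuousOn (by fun_prop)).integrableOn_compact (isCompact_closedBall 0 1)
    have i3 : IntegrableOn (fun _ => s ^ (-(n / 2) : ℝ) * Y / 2)
        (Metric.closedBall (0 : Space n) 1) :=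
      continuousOn_const.integrableOn_compact (isCompact_closedBall 0 1)
    -- In place of Cauchy–Schwarz, `|g| ≤ c/2 + g²/(2c)` with the balancing constant `c = s^{-n/2}
    -- Y`. This is why `Y` must be positive.
    have h1 : ∫ z in Metric.closedBall (0 : Space n) 1, |g (x + s • z)|
        ≤ ∫ z in Metric.closedBall (0 : Space n) 1, (s ^ (-(n / 2) : ℝ) * Y / 2
          + (2 * (s ^ (-(n / 2) : ℝ) * Y))⁻¹ * g (x + s • z) ^ 2) := by
      refine setIntegral_mono i1 (i3.add (i2.const_mul _)) fun z => ?_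
      have hpY : 0 < s ^ (-(n / 2) : ℝ) * Y := mul_pos hp hY
      generalize s ^ (-(n / 2) : ℝ) * Y = c at *
      rw [← sq_abs]
      generalize |g (x + s • z)| = y
      have : c / 2 + (2 * c)⁻¹ * y ^ 2 - y = (2 * c)⁻¹ * (c - y) ^ 2 := by
        field_simp
        ring
      have h2 : 0 ≤ (2 * c)⁻¹ * (c - y) ^ 2 := by positivity
      linarith
    rw [integral_add i3 (i2.const_mul _), setIntegral_const, integral_const_mul, smul_eq_mul,
      integral_closedBall_comp_smul (g := fun y => g y ^ 2) x hs0] at h1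
    have h2 : ∫ y in Metric.closedBall x s, g y ^ 2 ≤ Y ^ 2 := by
      refine (setIntegral_mono_set ?_ (Filter.Eventually.of_forall fun _ => sq_nonneg _)
        (Metric.closedBall_subset_closedBall hs.2.le).eventuallyLE).trans h
      exact (Continuous.continuousOn (by fun_prop)).integrableOn_compact (isCompact_closedBall x δ)
    refine h1.trans ?_
    calc _ ≤ v * (s ^ (-(n / 2) : ℝ) * Y / 2)
          + (2 * (s ^ (-(n / 2) : ℝ) * Y))⁻¹ * ((s ^ n)⁻¹ * Y ^ 2) := by gcongr
      _ = _ := by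
          rw [hsn]
          field_simp
  have hr : (-1 : ℝ) < k - 1 - n / 2 := by linarith
  have hm : ContinuousOn (fun s : ℝ => s ^ (k - 1)
      * ∫ z in Metric.closedBall (0 : Space n) 1, |g (x + s • z)|) (Set.uIcc 0 δ) := by
    refine (continuous_pow _).continuousOn.mul (Continuous.continuousOn ?_)
    exact continuous_parametric_integral_of_continuous (by fun_prop) (isCompact_closedBall 0 1)
  calc _ ≤ ∫ s in (0 : ℝ)..δ, (v + 1) / 2 * Y * s ^ (k - 1 - n / 2 : ℝ) := by
        refine intervalIntegral.integral_mono_on_of_le_Ioo hδ.le hm.intervalIntegrable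
          ((intervalIntegral.intervalIntegrable_rpow' hr).const_mul _) fun s hs => ?_
        have : s ^ (k - 1 - n / 2 : ℝ) = s ^ (k - 1) * s ^ (-(n / 2) : ℝ) := by
          rw [← Real.rpow_natCast s (k - 1), ← Real.rpow_add hs.1, Nat.cast_sub hk]
          push_cast
          ring_nf
        rw [this, mul_left_comm]
        exact mul_le_mul_of_nonneg_left (hin s hs) (pow_nonneg hs.1.le _)
    _ = _ := by
        rw [intervalIntegral.integral_const_mul, integral_rpow (Or.inl hr),
          show (k : ℝ) - 1 - n / 2 + 1 = k - n / 2 by ring, Real.zero_rpow hk'.ne']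
        field_simp
        ring

/-- The bound `log a - log b ≤ (a - b)/b` is used in both directions; since `r ≥ l/2`, the radius
`l/(2τ)` keeps the logarithmic distance below `1/τ`. -/
theorem abs_log_sub_log_le {τ r l : ℝ} (hτ : 1 ≤ τ) (hl : 0 < l) (h : |r - l| ≤ l / (2 * τ)) :
    0 < r ∧ |Real.log r - Real.log l| ≤ 1 / τ ∧ τ * (l / (2 * τ)) ≤ r
      ∧ r ≤ 3 * τ * (l / (2 * τ)) := by
  have hτ0 : 0 < τ := by linarith
  have e : τ * (l / (2 * τ)) = l / 2 := by field_simp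
  have h1 : l / (2 * τ) ≤ l / 2 := by
    rw [← e]
    exact le_mul_of_one_le_left (by positivity) hτ
  obtain ⟨ha, hb⟩ := abs_le.1 h
  have hr : l / 2 ≤ r := by linarith
  have hr0 : 0 < r := by linarith
  have hsub : ∀ a b : ℝ, 0 < a → 0 < b → Real.log a - Real.log b ≤ (a - b) / b := by
    intro a b ha hb
    rw [← Real.log_div ha.ne' hb.ne']
    refine (Real.log_le_sub_one_of_pos (by positivity)).trans (le_of_eq ?_)
    field_simp
  refine ⟨hr0, abs_le.2 ⟨?_, ?_⟩, by rw [e]; exact hr, by rw [mul_assoc, e]; linarith⟩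
  · have h2 := hsub l r hl hr0
    have h3 : (l - r) / r ≤ 1 / τ := by
      rw [div_le_div_iff₀ hr0 hτ0]
      have : (l - r) * τ ≤ l / (2 * τ) * τ := by
        gcongr
        linarith
      have e2 : l / (2 * τ) * τ = l / 2 := by field_simp
      linarith
    linarith
  · have h2 := hsub r l hr0 hl
    have h3 : (r - l) / l ≤ 1 / τ := by
      rw [div_le_div_iff₀ hl hτ0]
      have : (r - l) * τ ≤ l / (2 * τ) * τ := by gcongr
      have e2 : l / (2 * τ) * τ = l / 2 := by field_simp
      linarith
    linarith

/-- The weights are comparable at logarithmic distance `1 / τ`. -/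
theorem profile_le_of_abs_sub_le {τ t t' : ℝ} (m : ℕ) (hτ : 1 ≤ τ) (ht : t ≤ -1) (ht' : t' ≤ -1)
    (h : |t' - t| ≤ 1 / τ) :
    profile τ (2 * τ + m) t ≤ Real.exp (3 + m) * profile τ (2 * τ + m) t' := by
  have hτ0 : 0 < τ := by linarith
  obtain ⟨ha, hb⟩ := abs_le.1 h
  -- An exponent of size `τ` meets a ratio `1 + O(1/τ)`: the logarithmic factor changes by at most
  -- `e^{2+m}`, and `r^{-τ}` by at most `e`.
  have h1 : (-t') ^ (2 * τ + m) ≤ Real.exp (2 + m) * (-t) ^ (2 * τ + m) := by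
    have h2 : -t' ≤ Real.exp (1 / τ) * (-t) := by
      have h3 := Real.add_one_le_exp (1 / τ)
      have h4 : (1 / τ + 1) * (-t) ≤ Real.exp (1 / τ) * (-t) := by
        gcongr
        linarith
      nlinarith [one_div_pos.2 hτ0]
    calc (-t') ^ (2 * τ + m) ≤ (Real.exp (1 / τ) * (-t)) ^ (2 * τ + m) := by
          gcongr
          linarith
      _ = Real.exp ((2 * τ + m) / τ) * (-t) ^ (2 * τ + m) := by
          rw [Real.mul_rpow (Real.exp_pos _).le (by linarith), ← Real.exp_mul]
          ring_nf
      _ ≤ _ := by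
          have : (2 * τ + m) / τ ≤ 2 + m := by
            rw [div_le_iff₀ hτ0]
            have : (m : ℝ) * 1 ≤ m * τ := by gcongr
            linarith
          have h5 : 0 ≤ (-t) ^ (2 * τ + m) := Real.rpow_nonneg (by linarith) _
          gcongr
  have h6 : Real.exp (-τ * t) ≤ Real.exp 1 * Real.exp (-τ * t') := by
    rw [← Real.exp_add]
    gcongr
    have : τ * (t' - t) ≤ τ * (1 / τ) := by gcongr
    rw [mul_one_div_cancel hτ0.ne'] at this
    linarith
  have p1 : 0 < (-t) ^ (2 * τ + m) := Real.rpow_pos_of_pos (by linarith) _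
  have p2 : 0 < (-t') ^ (2 * τ + m) := Real.rpow_pos_of_pos (by linarith) _
  unfold profile
  rw [Real.rpow_neg (by linarith), Real.rpow_neg (by linarith), ← div_eq_mul_inv,
    ← div_eq_mul_inv, div_le_iff₀ p1, show (3 : ℝ) + m = 1 + (2 + m) by ring, Real.exp_add]
  calc Real.exp (-τ * t) ≤ Real.exp 1 * Real.exp (-τ * t') := h6
    _ = Real.exp 1 * Real.exp (-τ * t') / (-t') ^ (2 * τ + m) * (-t') ^ (2 * τ + m) :=
        (div_mul_cancel₀ _ p2.ne').symm
    _ ≤ Real.exp 1 * Real.exp (-τ * t') / (-t') ^ (2 * τ + m)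
        * (Real.exp (2 + m) * (-t) ^ (2 * τ + m)) := by gcongr
    _ = _ := by ring

theorem profile_add (τ ρ a t : ℝ) : profile (τ + a) ρ t = profile τ ρ t * Real.exp (-a * t) := by
  unfold profile
  rw [mul_right_comm, ← Real.exp_add]
  ring_nf

/-- On the ball of radius `δ = r/(2τ)` the weight is comparable to its value at the centre, so the
local Sobolev inequality there can be fed with the global weighted `L²` bounds. Each derivative
costs `τ` and comes with one power of `δ`, comparable to `r/τ`, which balances. -/
theorem wt_mul_le_of_integral_sq (n m k : ℕ) (hn : 2 ≤ n) (hk : 1 ≤ k) (hkm : k ≤ 2 * m)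
    (hnk : n < 2 * k) :
    ∃ C : ℝ, 0 ≤ C ∧ ∀ (x₀ : Space n) (K : Set (Space n)), IsCompact K →
      K ⊆ Metric.ball x₀ (Real.exp (-8)) \ {x₀} → ∀ f, Test K f → ∀ τ : ℝ, 1 ≤ τ → 10 * m ≤ τ →
      ∀ Q : ℝ, 0 < Q →
        ∫ x, (wt x₀ (τ + n / 2 - 2 * m) (2 * τ) x * lap^[m] f x) ^ 2 ≤ Q ^ 2 →
        ∀ x ∈ K, wt x₀ τ (2 * τ + m) x * |f x| ≤ C * τ ^ ((n - 3 * m) / 2 : ℝ) * Q := by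
  obtain ⟨C₁, hC₁, h₁⟩ := abs_le_of_coneIntegral n k hk
  obtain ⟨C₂, hC₂, h₂⟩ := coneIntegral_le_of_integral_sq n k hk hnk
  obtain ⟨C₃, hC₃, h₃⟩ := carleman_wordDeriv n m hn
  refine ⟨C₁ * (C₂ * Real.exp (3 + m) * 3 ^ n * (√C₃ + 1)), by positivity,
    fun x₀ K hK hKR f hf τ hτ1 hτ Q hQ hfQ x hx => ?_⟩
  have hKU := subset_punctured hKR
  have hKc := hK.isClosed
  have hτ0 : 0 < τ := by linarith
  have hW : 0 < wt x₀ τ (2 * τ + m) x := wt_pos (hKU hx) _ _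
  set W := wt x₀ τ (2 * τ + m) x with hWdef
  have hl : 0 < ‖x - x₀‖ := norm_pos_of_mem (hKU hx)
  set δ := ‖x - x₀‖ / (2 * τ) with hδdef
  have hδ : 0 < δ := by positivity
  have key := h₁ f hf.smooth x δ
    (C₂ * Real.exp (3 + m) * 3 ^ n * (√C₃ + 1) * τ ^ ((n - 3 * m) / 2 : ℝ) * Q / W) hδ ?_
  · calc W * |f x| ≤ W * _ := mul_le_mul_of_nonneg_left key hW.le
      _ = _ := by field_simp
  intro J hJ
  set i := J.length with hi
  have hgc : Continuous (wordDeriv J f) := (hf.wordDeriv hKc J).smooth.continuous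
  set M := Real.exp (3 + m) / W * (3 ^ n * (τ * δ) ^ (n / 2 - i : ℝ)) with hM
  have hM0 : 0 < M := by positivity
  have hpt : ∀ y ∈ Metric.closedBall x δ, wordDeriv J f y ^ 2
      ≤ M ^ 2 * (wt x₀ (τ + n / 2 - i) (2 * τ + m) y * wordDeriv J f y) ^ 2 := by
    intro y hy
    by_cases hyK : y ∈ K
    swap
    · rw [(hf.wordDeriv hKc J).zero y hyK]
      simp
    have hd : |‖y - x₀‖ - ‖x - x₀‖| ≤ ‖x - x₀‖ / (2 * τ) := by
      refine (abs_norm_sub_norm_le _ _).trans ?_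
      rw [sub_sub_sub_cancel_right, ← dist_eq_norm]
      exact hy
    obtain ⟨hr, hlog, hr1, hr2⟩ := abs_log_sub_log_le hτ1 hl hd
    rw [← hδdef] at hr1 hr2
    have hp := profile_le_of_abs_sub_le m hτ1 ((log_le_of_mem (hKR hx)).trans (by norm_num))
      ((log_le_of_mem (hKR hyK)).trans (by norm_num)) hlog
    have hrp : ‖y - x₀‖ ^ (n / 2 - i : ℝ) ≤ 3 ^ n * (τ * δ) ^ (n / 2 - i : ℝ) := by
      have hτδ : 0 < τ * δ := by positivity
      have hz1 : 1 ≤ ‖y - x₀‖ / (τ * δ) := by rwa [one_le_div hτδ]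
      have hz3 : ‖y - x₀‖ / (τ * δ) ≤ 3 := by
        rw [div_le_iff₀ hτδ]
        linarith
      have e : ‖y - x₀‖ = ‖y - x₀‖ / (τ * δ) * (τ * δ) := (div_mul_cancel₀ _ hτδ.ne').symm
      -- The exponent `n/2 - i` may be negative, but the base lies in `[1, 3]` because `τδ = r/2`,
      -- so `3^n` bounds it in every case.
      have h4 : (‖y - x₀‖ / (τ * δ)) ^ (n / 2 - i : ℝ) ≤ 3 ^ n := by
        calc _ ≤ (‖y - x₀‖ / (τ * δ)) ^ (n : ℝ) := by
              refine Real.rpow_le_rpow_of_exponent_le hz1 ?_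
              have : (0 : ℝ) ≤ n := by positivity
              have : (0 : ℝ) ≤ i := by positivity
              linarith
          _ ≤ _ := by
              rw [Real.rpow_natCast]
              gcongr
      rw [e, Real.mul_rpow (by positivity) hτδ.le]
      gcongr
    have hwt : W ≤ Real.exp (3 + m) * (wt x₀ (τ + n / 2 - i) (2 * τ + m) y
        * ‖y - x₀‖ ^ (n / 2 - i : ℝ)) := by
      have e1 : wt x₀ (τ + n / 2 - i) (2 * τ + m) y * ‖y - x₀‖ ^ (n / 2 - i : ℝ)
          = profile τ (2 * τ + m) (Real.log ‖y - x₀‖) := by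
        simp only [wt, rad]
        rw [show τ + (n : ℝ) / 2 - i = τ + (n / 2 - i) by ring, profile_add,
          Real.rpow_def_of_pos hr, mul_assoc, ← Real.exp_add]
        ring_nf
        simp
      rw [e1]
      exact hp
    have hw0 := wt_pos (hKU hyK) (τ + n / 2 - i) (2 * τ + m)
    have h1M : 1 ≤ M * wt x₀ (τ + n / 2 - i) (2 * τ + m) y := by
      have : Real.exp (3 + m) * (wt x₀ (τ + n / 2 - i) (2 * τ + m) y
          * ‖y - x₀‖ ^ (n / 2 - i : ℝ)) ≤ Real.exp (3 + m) * (wt x₀ (τ + n / 2 - i) (2 * τ + m) y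
          * (3 ^ n * (τ * δ) ^ (n / 2 - i : ℝ))) := by gcongr
      have h5 := hwt.trans this
      rw [hM, div_mul_eq_mul_div, div_mul_eq_mul_div, one_le_div hW]
      linarith
    rw [← mul_pow, ← mul_assoc, mul_pow]
    exact le_mul_of_one_le_left (sq_nonneg _) (one_le_pow₀ h1M)
  have hT := (hf.wordDeriv hKc J).wt_mul hKc hKU (τ + n / 2 - i) (2 * τ + m)
  have hint : Integrable (fun y => (wt x₀ (τ + n / 2 - i) (2 * τ + m) y * wordDeriv J f y) ^ 2) := by
    simpa only [sq] using (hT.mul hT).integrable hK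
  -- `√C₃ + 1` replaces `√C₃` to keep `Y` positive.
  set Y := M * ((√C₃ + 1) * τ ^ (i - 3 * m / 2 : ℝ) * Q) with hY
  have hY0 : 0 < Y := by positivity
  have hL2 : ∫ y in Metric.closedBall x δ, wordDeriv J f y ^ 2 ≤ Y ^ 2 := by
    calc _ ≤ ∫ y in Metric.closedBall x δ,
          M ^ 2 * (wt x₀ (τ + n / 2 - i) (2 * τ + m) y * wordDeriv J f y) ^ 2 :=
          setIntegral_mono_on ((hgc.pow 2).continuousOn.integrableOn_compact
            (isCompact_closedBall x δ)) (hint.const_mul _).integrableOn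
            Metric.isClosed_closedBall.measurableSet hpt
      _ ≤ ∫ y, M ^ 2 * (wt x₀ (τ + n / 2 - i) (2 * τ + m) y * wordDeriv J f y) ^ 2 :=
          setIntegral_le_integral (hint.const_mul _)
            (Filter.Eventually.of_forall fun _ => by positivity)
      _ = M ^ 2 * ∫ y, (wt x₀ (τ + n / 2 - i) (2 * τ + m) y * wordDeriv J f y) ^ 2 :=
          integral_const_mul _ _
      _ ≤ M ^ 2 * (C₃ * τ ^ (2 * i) * ((τ ^ (3 * m))⁻¹ * Q ^ 2)) := by
          gcongr
          refine (h₃ x₀ K hK hKR f hf τ hτ1 hτ J (hJ.trans hkm)).trans ?_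
          gcongr
      _ ≤ M ^ 2 * ((√C₃ + 1) ^ 2 * τ ^ (2 * i) * ((τ ^ (3 * m))⁻¹ * Q ^ 2)) := by
          gcongr
          nlinarith [Real.sq_sqrt hC₃, Real.sqrt_nonneg C₃]
      _ = Y ^ 2 := by
          clear_value M
          rw [hY, mul_pow, mul_pow, mul_pow, ← Real.rpow_natCast (τ ^ _) 2, ← Real.rpow_mul hτ0.le,
            show ((i : ℝ) - 3 * m / 2) * ((2 : ℕ) : ℝ)
              = ((2 * i : ℕ) : ℝ) - ((3 * m : ℕ) : ℝ) by push_cast; ring,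
            Real.rpow_sub hτ0, Real.rpow_natCast, Real.rpow_natCast]
          ring
  refine (h₂ _ hgc x δ Y hδ hY0 hL2).trans (le_of_eq ?_)
  have e1 : δ ^ (k - i) = δ ^ (k - n / 2 : ℝ) * δ ^ (n / 2 - i : ℝ) := by
    rw [← Real.rpow_add hδ, ← Real.rpow_natCast, Nat.cast_sub hJ]
    ring_nf
  have e2 : τ ^ ((n - 3 * m) / 2 : ℝ) = τ ^ (n / 2 - i : ℝ) * τ ^ (i - 3 * m / 2 : ℝ) := by
    rw [← Real.rpow_add hτ0]
    ring_nf
  rw [hY, hM, e1, e2, Real.mul_rpow hτ0.le hδ.le]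
  field_simp

/-- The pointwise Carleman estimate. -/
theorem carleman_sup (n m k : ℕ) (hn : 2 ≤ n) (hk : 1 ≤ k) (hkm : k ≤ 2 * m)
    (hnk : n < 2 * k) :
    ∃ C : ℝ, 0 ≤ C ∧ ∀ (x₀ : Space n) (K : Set (Space n)), IsCompact K →
      K ⊆ Metric.ball x₀ (Real.exp (-8)) \ {x₀} → ∀ f, Test K f → ∀ τ : ℝ, 1 ≤ τ → 10 * m ≤ τ →
        eLpNorm (fun x => wt x₀ τ (2 * τ + m) x * f x) (⊤ : ℝ≥0∞) volume
          ≤ ENNReal.ofReal (C * τ ^ ((n - 3 * m) / 2 : ℝ)) * lapNorm m x₀ τ f := by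
  obtain ⟨C, hC, h⟩ := wt_mul_le_of_integral_sq n m k hn hk hkm hnk
  refine ⟨C, hC, fun x₀ K hK hKR f hf τ hτ1 hτ => ?_⟩
  have hKU := subset_punctured hKR
  have hKc := hK.isClosed
  have hτ0 : 0 < τ := by linarith
  rw [lapNorm, ((hf.lap_iterate hKc m).wt_mul hKc hKU _ _).eLpNorm_two hK,
    ← ENNReal.ofReal_mul (by positivity), eLpNorm_exponent_top]
  refine eLpNormEssSup_le_of_ae_bound (Filter.Eventually.of_forall fun x => ?_) |>.trans
    (le_of_eq rfl)
  set q := ∫ x, (wt x₀ (τ + n / 2 - 2 * m) (2 * τ) x * lap^[m] f x) ^ 2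
  have hq : 0 ≤ q := integral_nonneg fun _ => sq_nonneg _
  by_cases hx : x ∈ K
  -- The pointwise bound was proved for strictly positive `Q` only, so `Q` decreases to `√q`, which
  -- may be zero.
  · have hlim : Filter.Tendsto (fun Q : ℝ => C * τ ^ ((n - 3 * m) / 2 : ℝ) * Q)
        (nhdsWithin (√q) (Set.Ioi (√q))) (nhds (C * τ ^ ((n - 3 * m) / 2 : ℝ) * √q)) :=
      (Continuous.tendsto (by fun_prop) _).mono_left nhdsWithin_le_nhds
    refine ge_of_tendsto hlim ?_
    filter_upwards [self_mem_nhdsWithin] with Q hQ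
    have hQ' : √q < Q := hQ
    rw [Real.norm_eq_abs, abs_mul, abs_of_pos (wt_pos (hKU hx) _ _)]
    refine h x₀ K hK hKR f hf τ hτ1 hτ Q ((Real.sqrt_nonneg q).trans_lt hQ') ?_ x hx
    refine (Real.sq_sqrt hq).symm.le.trans ?_
    gcongr
  · rw [hf.zero x hx]
    simp only [mul_zero, norm_zero]
    positivity

end

/-! ### Interpolation between the Lebesgue endpoints. -/

section

open scoped NNReal

variable {n m : ℕ}

/-- Interpolation of Lebesgue norms. -/
theorem eLpNorm_le_rpow_mul_rpow {α : Type*} [MeasurableSpace α] {μ : Measure α} {f g h : α → ℝ}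
    (hf : AEStronglyMeasurable f μ) (hg : AEStronglyMeasurable g μ) {p p₀ p₁ : ℝ≥0∞} {a b : ℝ}
    (ha : 0 < a) (hb : 0 < b)
    (hp : ENNReal.ofReal a * p₀⁻¹ + ENNReal.ofReal b * p₁⁻¹ = p⁻¹)
    (hh : ∀ x, ‖h x‖ ≤ ‖f x‖ ^ a * ‖g x‖ ^ b) :
    eLpNorm h p μ ≤ eLpNorm f p₀ μ ^ a * eLpNorm g p₁ μ ^ b := by
  have ha' : ENNReal.ofReal a ≠ 0 := (ENNReal.ofReal_pos.2 ha).ne'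
  have hb' : ENNReal.ofReal b ≠ 0 := (ENNReal.ofReal_pos.2 hb).ne'
  have : ENNReal.HolderTriple (p₀ / ENNReal.ofReal a) (p₁ / ENNReal.ofReal b) p := by
    refine ⟨?_⟩
    rw [← hp, ENNReal.inv_div (Or.inl ENNReal.ofReal_ne_top) (Or.inl ha'),
      ENNReal.inv_div (Or.inl ENNReal.ofReal_ne_top) (Or.inl hb'), div_eq_mul_inv, div_eq_mul_inv]
  have e₀ := eLpNorm_norm_rpow (p := p₀ / ENNReal.ofReal a) (μ := μ) f ha
  have e₁ := eLpNorm_norm_rpow (p := p₁ / ENNReal.ofReal b) (μ := μ) g hb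
  rw [ENNReal.div_mul_cancel ha' ENNReal.ofReal_ne_top] at e₀
  rw [ENNReal.div_mul_cancel hb' ENNReal.ofReal_ne_top] at e₁
  rw [← e₀, ← e₁]
  refine (eLpNorm_mono_real (g := fun x => ‖f x‖ ^ a * ‖g x‖ ^ b) hh).trans ?_
  have hfa : AEStronglyMeasurable (fun x => ‖f x‖ ^ a) μ :=
    (hf.norm.aemeasurable.pow_const a).aestronglyMeasurable
  have hgb : AEStronglyMeasurable (fun x => ‖g x‖ ^ b) μ :=
    (hg.norm.aemeasurable.pow_const b).aestronglyMeasurable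
  have := eLpNorm_smul_le_mul_eLpNorm (p := p₀ / ENNReal.ofReal a) (q := p₁ / ENNReal.ofReal b)
    (r := p) hgb hfa
  simpa using! this

theorem wt_le_wt_left {x₀ x : Space n} (hx : x ∈ punctured x₀) {σ σ' : ℝ} (h : σ ≤ σ') (ρ : ℝ) :
    wt x₀ σ ρ x ≤ wt x₀ σ' ρ x := by
  have hl := log_neg_of_mem hx
  simp only [wt, rad, profile]
  refine mul_le_mul_of_nonneg_right (Real.exp_le_exp.2 ?_) (Real.rpow_nonneg (by linarith) _)
  nlinarith

theorem wt_rpow_mul_wt_rpow {x₀ x : Space n} (hx : x ∈ punctured x₀) (σ σ' ρ a b : ℝ)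
    (hab : a + b = 1) :
    wt x₀ σ ρ x ^ a * wt x₀ σ' ρ x ^ b = wt x₀ (a * σ + b * σ') ρ x := by
  have hl : 0 < -Real.log ‖x - x₀‖ := neg_pos.2 (log_neg_of_mem hx)
  simp only [wt, rad, profile]
  generalize Real.log ‖x - x₀‖ = t at *
  rw [Real.mul_rpow (Real.exp_pos _).le (Real.rpow_nonneg hl.le _),
    Real.mul_rpow (Real.exp_pos _).le (Real.rpow_nonneg hl.le _), mul_mul_mul_comm,
    ← Real.exp_mul, ← Real.exp_mul, ← Real.exp_add, ← Real.rpow_mul hl.le, ← Real.rpow_mul hl.le,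
    ← Real.rpow_add hl, ← mul_add, hab]
  ring_nf

/-- The estimate `‖e^{-τφ} (log r)^{-m} r^{-κ} f‖_{L^p} ≤ C τ^{-e} ‖e^{-τφ} r^{2m} Δ^m f‖`. -/
def CarlemanBound (n m : ℕ) (p : ℝ≥0∞) (κ e : ℝ) : Prop :=
  ∃ C : ℝ, 0 ≤ C ∧ ∀ (x₀ : Space n) (K : Set (Space n)), IsCompact K →
    K ⊆ Metric.ball x₀ (Real.exp (-8)) \ {x₀} → ∀ f, Test K f → ∀ τ : ℝ, 1 ≤ τ → 10 * m ≤ τ →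
      eLpNorm (fun x => wt x₀ (τ + κ) (2 * τ + m) x * f x) p volume
        ≤ ENNReal.ofReal (C * τ ^ (-e)) * lapNorm m x₀ τ f

/-- Here `r < 1` makes the weight increase with `σ`, and `τ ≥ 1` makes a smaller gain weaker. -/
theorem CarlemanBound.mono {p : ℝ≥0∞} {κ κ' e e' : ℝ} (h : CarlemanBound n m p κ' e')
    (hκ : κ ≤ κ') (he : e ≤ e') : CarlemanBound n m p κ e := by
  obtain ⟨C, hC, h⟩ := h
  refine ⟨C, hC, fun x₀ K hK hKR f hf τ hτ1 hτ => ?_⟩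
  have hKU := subset_punctured hKR
  calc _ ≤ eLpNorm (fun x => wt x₀ (τ + κ') (2 * τ + m) x * f x) p volume := by
        refine eLpNorm_mono fun x => ?_
        by_cases hx : x ∈ K
        · have := wt_le_wt_left (hKU hx) (add_le_add_right hκ τ) (2 * τ + m)
          rw [norm_mul, norm_mul, Real.norm_of_nonneg (wt_pos (hKU hx) _ _).le,
            Real.norm_of_nonneg (wt_pos (hKU hx) _ _).le]
          gcongr
        · rw [hf.zero x hx]
          simp
    _ ≤ _ := h x₀ K hK hKR f hf τ hτ1 hτ
    _ ≤ _ := by gcongr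

/-- The weight exponent `κ` and the gain `e` interpolate linearly along with `1/p`, since weights
with common `ρ` multiply geometrically. The endpoints of `θ` are separate because the Hölder step
needs positive powers. -/
theorem CarlemanBound.interpolate {p p₀ p₁ : ℝ≥0∞} {κ κ₀ κ₁ e e₀ e₁ θ : ℝ}
    (h₀ : CarlemanBound n m p₀ κ₀ e₀) (h₁ : CarlemanBound n m p₁ κ₁ e₁)
    (hθ0 : 0 ≤ θ) (hθ1 : θ ≤ 1)
    (hp : ENNReal.ofReal (1 - θ) * p₀⁻¹ + ENNReal.ofReal θ * p₁⁻¹ = p⁻¹)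
    (hκ : κ ≤ (1 - θ) * κ₀ + θ * κ₁) (he : e ≤ (1 - θ) * e₀ + θ * e₁) :
    CarlemanBound n m p κ e := by
  refine CarlemanBound.mono ?_ hκ he
  rcases hθ0.eq_or_lt with rfl | hθ0
  · obtain rfl : p₀ = p := by simpa using hp
    simpa using h₀
  rcases hθ1.eq_or_lt with rfl | hθ1
  · obtain rfl : p₁ = p := by simpa using hp
    simpa using h₁
  obtain ⟨C₀, hC₀, h₀⟩ := h₀
  obtain ⟨C₁, hC₁, h₁⟩ := h₁
  have hθ' : 0 < 1 - θ := by linarith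
  refine ⟨C₀ ^ (1 - θ) * C₁ ^ θ, by positivity, fun x₀ K hK hKR f hf τ hτ1 hτ => ?_⟩
  have hKU := subset_punctured hKR
  have hτ0 : 0 < τ := by linarith
  have hT : ∀ κ, AEStronglyMeasurable (fun x => wt x₀ (τ + κ) (2 * τ + m) x * f x) volume :=
    fun κ => (hf.wt_mul hK.isClosed hKU _ _).smooth.continuous.aestronglyMeasurable
  refine (eLpNorm_le_rpow_mul_rpow (hT κ₀) (hT κ₁) hθ' hθ0 hp fun x => ?_).trans ?_
  · by_cases hx : x ∈ K
    · simp only [norm_mul, Real.norm_of_nonneg (wt_pos (hKU hx) _ _).le]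
      rw [Real.mul_rpow (wt_pos (hKU hx) _ _).le (norm_nonneg _),
        Real.mul_rpow (wt_pos (hKU hx) _ _).le (norm_nonneg _), mul_mul_mul_comm,
        wt_rpow_mul_wt_rpow (hKU hx) _ _ _ _ _ (sub_add_cancel 1 θ),
        ← Real.rpow_add_of_nonneg (norm_nonneg _) hθ'.le hθ0.le, sub_add_cancel, Real.rpow_one]
      refine le_of_eq ?_
      congr 2
      ring
    · rw [hf.zero x hx]
      simp only [mul_zero, norm_zero]
      positivity
  · calc _ ≤ (ENNReal.ofReal (C₀ * τ ^ (-e₀)) * lapNorm m x₀ τ f) ^ (1 - θ)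
          * (ENNReal.ofReal (C₁ * τ ^ (-e₁)) * lapNorm m x₀ τ f) ^ θ := by
          gcongr
          · exact h₀ x₀ K hK hKR f hf τ hτ1 hτ
          · exact h₁ x₀ K hK hKR f hf τ hτ1 hτ
      _ = _ := by
          rw [ENNReal.mul_rpow_of_nonneg _ _ hθ'.le, ENNReal.mul_rpow_of_nonneg _ _ hθ0.le,
            mul_mul_mul_comm, ← ENNReal.rpow_add_of_nonneg _ _ hθ'.le hθ0.le, sub_add_cancel,
            ENNReal.rpow_one, ENNReal.ofReal_rpow_of_nonneg (by positivity) hθ'.le,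
            ENNReal.ofReal_rpow_of_nonneg (by positivity) hθ0.le,
            ← ENNReal.ofReal_mul (by positivity), Real.mul_rpow hC₀ (by positivity),
            Real.mul_rpow hC₁ (by positivity), mul_mul_mul_comm, ← Real.rpow_mul hτ0.le,
            ← Real.rpow_mul hτ0.le, ← Real.rpow_add hτ0]
          congr 4
          ring

theorem carlemanBound_two (n m : ℕ) (hn : 2 ≤ n) : CarlemanBound n m 2 (n / 2) (3 * m / 2) := by
  obtain ⟨C, hC, h⟩ := carleman_eLpNorm n m hn
  refine ⟨C, hC, fun x₀ K hK hKR f hf τ hτ1 hτ => ?_⟩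
  simpa [wordDeriv] using h x₀ K hK hKR f hf τ hτ1 hτ [] (by simp)

theorem ofReal_recip {p : ℝ≥0∞} (hp : p ≠ 0) : ENNReal.ofReal (recip p) = p⁻¹ :=
  ENNReal.ofReal_toReal (ENNReal.inv_ne_top.2 hp)

theorem carlemanBound_low (hn : 2 ≤ n) (hm : 1 ≤ m) (h : n < 4 * m - 2) {p : ℝ≥0∞} (hp : 2 ≤ p) :
    CarlemanBound n m p 0 ((4 * m - 2) * recip p - (m - 2) / 2) := by
  -- The pointwise estimate gives `τ^{(n-3m)/2}`; it is weakened to `τ^{(m-2)/2}` using `n ≤ 4m -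
  -- 2`.
  have hsup : CarlemanBound n m (⊤ : ℝ≥0∞) 0 (-((m - 2) / 2)) := by
    obtain ⟨C, hC, h'⟩ := carleman_sup n m (2 * m - 1) hn (by omega) (by omega) (by omega)
    refine ⟨C, hC, fun x₀ K hK hKR f hf τ hτ1 hτ => ?_⟩
    rw [add_zero]
    refine (h' x₀ K hK hKR f hf τ hτ1 hτ).trans ?_
    gcongr
    · have : (n : ℝ) + 3 ≤ 4 * m := by exact_mod_cast (by omega : n + 3 ≤ 4 * m)
      linarith
  have hp0 : p ≠ 0 := (two_pos.trans_le hp).ne'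
  have hz0 : 0 ≤ recip p := ENNReal.toReal_nonneg
  have hz : recip p ≤ 1 / 2 := by
    rw [recip, one_div]
    refine ENNReal.toReal_le_of_le_ofReal (by norm_num) ?_
    rw [ENNReal.ofReal_inv_of_pos two_pos, ENNReal.ofReal_ofNat]
    exact ENNReal.inv_le_inv.2 hp
  refine (carlemanBound_two n m hn).interpolate hsup (θ := 1 - 2 * recip p) (by linarith)
    (by linarith) ?_ ?_ (le_of_eq ?_)
  · rw [ENNReal.inv_top, mul_zero, add_zero, sub_sub_cancel, ENNReal.ofReal_mul two_pos.le,
      ofReal_recip hp0, ENNReal.ofReal_ofNat, mul_right_comm, ENNReal.mul_inv_cancel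
        two_ne_zero ENNReal.ofNat_ne_top, one_mul]
  · have : (0 : ℝ) ≤ n := by positivity
    nlinarith
  · ring

theorem inv_eq_ofReal {p : ℝ≥0} {z : ℝ} (hz : 0 < z) (h : (p : ℝ)⁻¹ = z) :
    ((p : ℝ≥0∞))⁻¹ = ENNReal.ofReal z := by
  rw [← h, ENNReal.ofReal_inv_of_pos (inv_pos.1 (h ▸ hz)), ENNReal.ofReal_coe_nnreal]

/-- With `z = 1/p`, the line joins `z = 1/2` to the Sobolev endpoint `1/2 - (2m-1)/n`. The weight
exponent `n z` is what `r^{-n} dx` produces in `L^p`. -/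
theorem carlemanBound_high (hn : 2 ≤ n) (hm : 1 ≤ m) (h : 4 * m - 2 < n) {p : ℝ≥0∞}
    {z : ℝ} (hpz : p⁻¹ = ENNReal.ofReal z) (hz : z ≤ 1 / 2) (hz' : 1 / 2 - (2 * m - 1) / n ≤ z) :
    CarlemanBound n m p (n * z) (3 * m / 2 - n / 2 + n * z) := by
  have hm' : (1 : ℝ) ≤ m := by exact_mod_cast hm
  have hn' : (4 * m - 2 : ℝ) < n := by
    have : ((4 * m : ℕ) : ℝ) < (n + 2 : ℕ) := by exact_mod_cast (by omega)
    push_cast at this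
    linarith
  have hn0 : (0 : ℝ) < n := by linarith
  have hm0 : (0 : ℝ) < 2 * m - 1 := by linarith
  have hpos : (0 : ℝ) < 1 / 2 - (2 * m - 1) / n := by
    rw [sub_pos, div_lt_div_iff₀ hn0 two_pos]
    linarith
  obtain ⟨q, hq⟩ : ∃ q : ℝ≥0, (q : ℝ)⁻¹ = 1 / 2 - (2 * m - 1) / n :=
    ⟨⟨_, (inv_pos.2 hpos).le⟩, inv_inv _⟩
  have hsob : CarlemanBound n m q (n / 2 - (2 * m - 1)) (3 * m / 2 - (2 * m - 1)) := by
    have hc : ((2 * m - 1 : ℕ) : ℝ) = 2 * m - 1 := by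
      rw [Nat.cast_sub (by omega)]
      push_cast
      ring
    obtain ⟨C, hC, h'⟩ := sobolev_chain n m hn (2 * m - 1) (by omega) (by omega) q
      (by rw [hq, hc])
    refine ⟨C, hC, fun x₀ K hK hKR f hf τ hτ1 hτ => ?_⟩
    have := h' x₀ K hK hKR f hf τ hτ1 hτ [] (by simp)
    simp only [List.length_nil, Nat.cast_zero, sub_zero, zero_add, hc] at this
    rw [neg_sub, ← add_sub_assoc]
    exact this
  have hz0 : 0 < z := hpos.trans_le hz'
  have hθ0 : 0 ≤ (1 / 2 - z) * n / (2 * m - 1) := by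
    have : 0 ≤ 1 / 2 - z := by linarith
    positivity
  have hθ1 : (1 / 2 - z) * n / (2 * m - 1) ≤ 1 := by
    rw [div_le_one hm0, ← le_div_iff₀ hn0]
    linarith
  refine (carlemanBound_two n m hn).interpolate hsob (θ := (1 / 2 - z) * n / (2 * m - 1)) hθ0 hθ1
    ?_ (le_of_eq ?_) (le_of_eq ?_)
  · rw [inv_eq_ofReal hpos hq, hpz, show (2 : ℝ≥0∞)⁻¹ = ENNReal.ofReal (1 / 2) by
      rw [one_div, ENNReal.ofReal_inv_of_pos two_pos, ENNReal.ofReal_ofNat],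
      ← ENNReal.ofReal_mul (by linarith), ← ENNReal.ofReal_mul hθ0,
      ← ENNReal.ofReal_add (mul_nonneg (by linarith) (by norm_num)) (by positivity)]
    congr 1
    field_simp
    ring
  · field_simp
    ring
  · linear_combination div_mul_cancel₀ ((1 / 2 - z) * n) hm0.ne'

/-- With `n = 4m - 2`, trading `2m - 2` derivatives lands exactly in `L^n`, for the function and its
gradient. One further step at `L^n` is borderline, so the exponent is lowered to `r < n` with `1/r =
z + 1/n`, which reaches any finite `q`. -/
theorem carlemanBound_critical_of_small (hm : 1 ≤ m) (h : n = 4 * m - 2) {q : ℝ≥0} {z : ℝ}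
    (hz : 0 < z) (hz' : z ≤ 1 / 2) (hq : (q : ℝ)⁻¹ = z) :
    CarlemanBound n m q 0 (-((m - 2) / 2)) := by
  have hn : 2 ≤ n := by omega
  have hn0 : (2 : ℝ) ≤ n := by exact_mod_cast hn
  have hnm : (n : ℝ) = 4 * m - 2 := by
    have : ((n + 2 : ℕ) : ℝ) = (4 * m : ℕ) := by exact_mod_cast (by omega)
    push_cast at this
    linarith
  have hc : ((2 * m - 2 : ℕ) : ℝ) = 2 * m - 2 := by
    rw [Nat.cast_sub (by omega)]
    push_cast
    ring
  obtain ⟨C, hC0, hC⟩ := sobolev_chain n m hn (2 * m - 2) (by omega) (by omega) (n : ℝ≥0) (by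
    rw [hc, NNReal.coe_natCast, hnm]
    have : (4 * m - 2 : ℝ) ≠ 0 := by linarith
    field_simp
    ring)
  have hzn : 0 < z + (n : ℝ)⁻¹ := by positivity
  have hn2 : (n : ℝ)⁻¹ ≤ 1 / 2 := by
    rw [one_div]
    exact inv_anti₀ two_pos hn0
  obtain ⟨r, hr⟩ : ∃ r : ℝ≥0, (r : ℝ) = (z + (n : ℝ)⁻¹)⁻¹ := ⟨⟨_, (inv_pos.2 hzn).le⟩, rfl⟩
  obtain ⟨D, hD0, hD⟩ := sobolev_step n (by omega) (p := r) (q := n) (q' := q)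
    (by
      rw [← NNReal.coe_le_coe, hr, NNReal.coe_one]
      exact (one_le_inv₀ hzn).2 (by linarith))
    (by
      rw [← NNReal.coe_le_coe, hr, NNReal.coe_natCast]
      exact inv_le_of_inv_le₀ (by linarith) (by linarith))
    (by
      rw [hq, hr, inv_inv]
      ring)
  refine ⟨D * ((m + 3) * C), by positivity, fun x₀ K hK hKR f hf τ hτ1 hτ => ?_⟩
  have hτ0 : 0 < τ := by linarith
  have h3 : (0 : ℝ) ≤ m := by positivity
  have key := hD x₀ K hK hKR f hf τ (2 * τ + m) ((m + 3) * τ)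
    (ENNReal.ofReal ((m + 3) * C * τ ^ ((m - 2) / 2 : ℝ)) * lapNorm m x₀ τ f) ?_ ?_ ?_
  · rw [add_zero, neg_neg]
    refine key.trans (le_of_eq ?_)
    rw [← mul_assoc, ← ENNReal.ofReal_mul hD0]
    congr 2
    ring
  · rw [abs_of_pos hτ0, abs_of_nonneg (by positivity)]
    nlinarith
  · intro i
    have := hC x₀ K hK hKR f hf τ hτ1 hτ [i] (by simp; omega)
    simp only [List.length_singleton, hc, hnm, Nat.cast_one] at this
    rw [show τ + (4 * (m : ℝ) - 2) / 2 - (2 * m - 2) - 1 = τ by ring,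
      show (1 : ℝ) + (2 * m - 2) - 3 * m / 2 = (m - 2) / 2 by ring] at this
    refine this.trans ?_
    gcongr
    refine le_mul_of_one_le_left hC0 ?_
    linarith
  · have := hC x₀ K hK hKR f hf τ hτ1 hτ [] (by simp)
    simp only [List.length_nil, hc, hnm, Nat.cast_zero] at this
    rw [show τ + (4 * (m : ℝ) - 2) / 2 - (2 * m - 2) - 0 = τ + 1 by ring,
      show (0 : ℝ) + (2 * m - 2) - 3 * m / 2 = (m - 2) / 2 - 1 by ring] at this
    calc _ ≤ _ := mul_le_mul_right this _
      _ = _ := by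
        rw [← mul_assoc, ← ENNReal.ofReal_mul (by positivity)]
        congr 2
        rw [Real.rpow_sub_one hτ0.ne']
        field_simp

theorem carlemanBound_critical (hm : 1 ≤ m) (h : n = 4 * m - 2) {p : ℝ≥0∞} {z ε : ℝ}
    (hpz : p⁻¹ = ENNReal.ofReal z) (hz0 : 0 < z) (hz : z ≤ 1 / 2) (hε0 : 0 < ε) (hε1 : ε < 1) :
    CarlemanBound n m p 0 ((4 * m - 2) * z * (1 - ε) - (m - 2) / 2) := by
  have hn : 2 ≤ n := by omega
  have hm' : (1 : ℝ) ≤ m := by exact_mod_cast hm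
  have hεz : 0 < ε * z := by positivity
  have hεz' : ε * z < z := mul_lt_of_lt_one_left hz0 hε1
  obtain ⟨q, hq⟩ : ∃ q : ℝ≥0, (q : ℝ)⁻¹ = ε * z := ⟨⟨_, (inv_pos.2 hεz).le⟩, inv_inv _⟩
  have hd : 0 < 1 / 2 - ε * z := by linarith
  -- The second endpoint is taken at `1/q = εz`. Then `η` is the share of `L²`, and the gain only
  -- needs `η ≥ 2z(1 - ε)`.
  set η := (z - ε * z) / (1 / 2 - ε * z) with hη
  have hη0 : 0 ≤ η := div_nonneg (by linarith) hd.le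
  have hη1 : η ≤ 1 := (div_le_one hd).2 (by linarith)
  have hη2 : 2 * (z - ε * z) ≤ η := by
    rw [hη, le_div_iff₀ hd]
    nlinarith
  refine (carlemanBound_two n m hn).interpolate
    (carlemanBound_critical_of_small hm h hεz (by linarith) hq) (θ := 1 - η) (by linarith)
    (by linarith) ?_ ?_ ?_
  · rw [sub_sub_cancel, inv_eq_ofReal hεz hq, hpz,
      show (2 : ℝ≥0∞)⁻¹ = ENNReal.ofReal (1 / 2) by
      rw [one_div, ENNReal.ofReal_inv_of_pos two_pos, ENNReal.ofReal_ofNat],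
      ← ENNReal.ofReal_mul hη0, ← ENNReal.ofReal_mul (by linarith),
      ← ENNReal.ofReal_add (by positivity) (mul_nonneg (by linarith) hεz.le)]
    congr 1
    have : η * (1 / 2 - ε * z) = z - ε * z := div_mul_cancel₀ _ hd.ne'
    linarith
  · rw [mul_zero, add_zero, sub_sub_cancel]
    positivity
  · nlinarith

end

/-! ### Passage to complex functions, multi-indices and the original weights. -/

section

variable {n m : ℕ} {K : Set (Space n)} {x₀ : Space n} {a b : Space n → ℝ}

/-- The complex function with real part `a` and imaginary part `b`. -/
def cpx (a b : Space n → ℝ) : Space n → ℂ := fun x => ⟨a x, b x⟩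

theorem contDiff_cpx (ha : ContDiff ℝ ∞ a) (hb : ContDiff ℝ ∞ b) : ContDiff ℝ ∞ (cpx a b) := by
  have h : cpx a b = fun x => Complex.equivRealProdCLM.symm (a x, b x) := by
    funext x
    apply Complex.ext <;> simp [cpx]
  rw [h]
  exact Complex.equivRealProdCLM.symm.contDiff.comp (ha.prodMk hb)

theorem partialDeriv_cpx (ha : ContDiff ℝ ∞ a) (hb : ContDiff ℝ ∞ b) (i : Fin n) :
    partialDeriv i (cpx a b) = cpx (pd i a) (pd i b) := by
  funext x
  have h : HasFDerivAt (cpx a b) (fderiv ℝ (cpx a b) x) x :=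
    ((contDiff_cpx ha hb).differentiable (by simp) x).hasFDerivAt
  have h1 : fderiv ℝ a x = Complex.reCLM.comp (fderiv ℝ (cpx a b) x) :=
    (Complex.reCLM.hasFDerivAt.comp x h).fderiv
  have h2 : fderiv ℝ b x = Complex.imCLM.comp (fderiv ℝ (cpx a b) x) :=
    (Complex.imCLM.hasFDerivAt.comp x h).fderiv
  apply Complex.ext
  · simp [partialDeriv, cpx, pd, h1]
  · simp [partialDeriv, cpx, pd, h2]

theorem partialDeriv_iterate_cpx (ha : ContDiff ℝ ∞ a) (hb : ContDiff ℝ ∞ b) (i : Fin n) (k : ℕ) :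
    (partialDeriv i)^[k] (cpx a b)
      = cpx (wordDeriv (List.replicate k i) a) (wordDeriv (List.replicate k i) b) := by
  induction k with
  | zero => rfl
  | succ k ih =>
    rw [Function.iterate_succ_apply', ih,
      partialDeriv_cpx (contDiff_wordDeriv ha _) (contDiff_wordDeriv hb _)]
    rfl

/-- The word `∂₁ ⋯ ∂₁ ⋯ ∂ₙ ⋯ ∂ₙ` of a multi-index. -/
def multiWord (α : Fin n → ℕ) : List (Fin n) :=
  (List.finRange n).flatMap fun i => List.replicate (α i) i

theorem length_multiWord (α : Fin n → ℕ) : (multiWord α).length = ∑ i, α i := by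
  simp only [multiWord, List.length_flatMap, List.length_replicate]
  rw [← List.sum_ofFn, List.ofFn_eq_map]

theorem multiDeriv_cpx (ha : ContDiff ℝ ∞ a) (hb : ContDiff ℝ ∞ b) (α : Fin n → ℕ) :
    multiDeriv α (cpx a b) = cpx (wordDeriv (multiWord α) a) (wordDeriv (multiWord α) b) := by
  unfold multiDeriv multiWord
  induction List.finRange n with
  | nil => rfl
  | cons i L ih =>
    rw [List.foldr_cons, ih,
      partialDeriv_iterate_cpx (contDiff_wordDeriv ha _) (contDiff_wordDeriv hb _)]
    simp only [wordDeriv, List.flatMap_cons, List.foldr_append]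

theorem laplacian_eq_sum_partialDeriv {f : Space n → ℂ} (hf : ContDiff ℝ ∞ f) :
    Laplacian.laplacian f = fun x => ∑ i, partialDeriv i (partialDeriv i f) x := by
  rw [InnerProductSpace.laplacian_eq_iteratedFDeriv_orthonormalBasis f
    (EuclideanSpace.basisFun (Fin n) ℝ)]
  funext x
  refine Finset.sum_congr rfl fun i _ => ?_
  have hd : DifferentiableAt ℝ (fderiv ℝ f) x :=
    (hf.fderiv_right (m := ∞) (by simp)).differentiable (by simp) x
  rw [iteratedFDeriv_two_apply]
  simp only [Matrix.cons_val_zero, Matrix.cons_val_one, EuclideanSpace.basisFun_apply,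
    partialDeriv]
  change _ = fderiv ℝ (fun y => fderiv ℝ f y (EuclideanSpace.single i 1)) x _
  rw [fderiv_clm_apply hd (differentiableAt_const _)]
  simp

theorem laplacian_cpx (ha : ContDiff ℝ ∞ a) (hb : ContDiff ℝ ∞ b) :
    Laplacian.laplacian (cpx a b) = cpx (lap a) (lap b) := by
  rw [laplacian_eq_sum_partialDeriv (contDiff_cpx ha hb)]
  have h : ∀ i, partialDeriv i (partialDeriv i (cpx a b))
      = cpx (pd i (pd i a)) (pd i (pd i b)) := fun i => by
    rw [partialDeriv_cpx ha hb]
    exact partialDeriv_cpx (contDiff_wordDeriv ha [i]) (contDiff_wordDeriv hb [i]) i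
  funext x
  apply Complex.ext
  · simp [h, cpx, lap]
  · simp [h, cpx, lap]

theorem polyLaplacian_cpx (hK : IsClosed K) (ha : Test K a) (hb : Test K b) :
    polyLaplacian m (cpx a b) = cpx (lap^[m] a) (lap^[m] b) := by
  unfold polyLaplacian
  induction m with
  | zero => rfl
  | succ k ih =>
    rw [Function.iterate_succ_apply', ih, Function.iterate_succ_apply',
      Function.iterate_succ_apply',
      laplacian_cpx (ha.lap_iterate hK k).smooth (hb.lap_iterate hK k).smooth]

theorem eLpNorm_smul_cpx_le {w : Space n → ℝ} (ha : Continuous fun x => w x * a x)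
    (hb : Continuous fun x => w x * b x) {p : ℝ≥0∞} (hp : 1 ≤ p) :
    eLpNorm (fun x => w x • cpx a b x) p volume
      ≤ eLpNorm (fun x => w x * a x) p volume + eLpNorm (fun x => w x * b x) p volume := by
  have h := eLpNorm_add_le ha.norm.aestronglyMeasurable hb.norm.aestronglyMeasurable hp
    (μ := (volume : Measure (Space n)))
  rw [eLpNorm_norm, eLpNorm_norm] at h
  refine (eLpNorm_mono_real fun x => ?_).trans h
  rw [norm_smul, Pi.add_apply, norm_mul, norm_mul, ← mul_add]
  gcongr
  exact Complex.norm_le_abs_re_add_abs_im _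

theorem eLpNorm_mul_re_le (w : Space n → ℝ) (p : ℝ≥0∞) :
    eLpNorm (fun x => w x * a x) p volume ≤ eLpNorm (fun x => w x • cpx a b x) p volume := by
  refine eLpNorm_mono fun x => ?_
  rw [norm_smul, norm_mul]
  gcongr
  exact Complex.abs_re_le_norm (cpx a b x)

theorem eLpNorm_mul_im_le (w : Space n → ℝ) (p : ℝ≥0∞) :
    eLpNorm (fun x => w x * b x) p volume ≤ eLpNorm (fun x => w x • cpx a b x) p volume := by
  refine eLpNorm_mono fun x => ?_
  rw [norm_smul, norm_mul]
  gcongr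
  exact Complex.abs_im_le_norm (cpx a b x)

theorem test_re_im {u : Space n → ℂ} (hu : ContDiff ℝ ∞ u) :
    Test (tsupport u) (fun x => (u x).re) ∧ Test (tsupport u) (fun x => (u x).im) :=
  ⟨⟨Complex.reCLM.contDiff.comp hu, fun x hx => by simp [image_eq_zero_of_notMem_tsupport hx]⟩,
    ⟨Complex.imCLM.contDiff.comp hu, fun x hx => by simp [image_eq_zero_of_notMem_tsupport hx]⟩⟩

/-- The norm of `e^{-τ φ} r^{2m} Δ^m u` in `L²(r^{-n} dx)`, for complex `u`. -/
noncomputable def polyLapNorm (m : ℕ) (x₀ : Space n) (τ : ℝ) (u : Space n → ℂ) : ℝ≥0∞ :=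
  eLpNorm (fun x => wt x₀ (τ + n / 2 - 2 * m) (2 * τ) x • polyLaplacian m u x) 2 volume

section TestFunction

variable {u : Space n → ℂ}

theorem lapNorm_le_polyLapNorm (hu : ContDiff ℝ ∞ u) (τ : ℝ) :
    lapNorm m x₀ τ (fun x => (u x).re) ≤ polyLapNorm m x₀ τ u
      ∧ lapNorm m x₀ τ (fun x => (u x).im) ≤ polyLapNorm m x₀ τ u := by
  obtain ⟨ha, hb⟩ := test_re_im hu
  have h : polyLaplacian m u = _ := polyLaplacian_cpx (m := m) (isClosed_tsupport u) ha hb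
  unfold lapNorm polyLapNorm
  rw [h]
  exact ⟨eLpNorm_mul_re_le _ _, eLpNorm_mul_im_le _ _⟩

/-- Finiteness is what permits absorbing half of this norm into itself. -/
theorem polyLapNorm_ne_top (hu : IsTestFunction x₀ (Real.exp (-8)) u) (τ : ℝ) :
    polyLapNorm m x₀ τ u ≠ (⊤ : ℝ≥0∞) := by
  obtain ⟨ha, hb⟩ := test_re_im hu.1
  have hKU := subset_punctured hu.2.2
  have hKc := isClosed_tsupport u
  have h : polyLaplacian m u = _ := polyLaplacian_cpx (m := m) hKc ha hb
  have ha' := (ha.lap_iterate hKc m).wt_mul hKc hKU (τ + n / 2 - 2 * m) (2 * τ)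
  have hb' := (hb.lap_iterate hKc m).wt_mul hKc hKU (τ + n / 2 - 2 * m) (2 * τ)
  unfold polyLapNorm
  rw [h]
  refine ne_top_of_le_ne_top ?_ (eLpNorm_smul_cpx_le ha'.smooth.continuous hb'.smooth.continuous
    one_le_two)
  rw [ha'.eLpNorm_two hu.2.1, hb'.eLpNorm_two hu.2.1]
  exact ENNReal.add_ne_top.2 ⟨ENNReal.ofReal_ne_top, ENNReal.ofReal_ne_top⟩

theorem carleman_multiDeriv (n m : ℕ) (hn : 2 ≤ n) :
    ∃ C : ℝ, 0 ≤ C ∧ ∀ (x₀ : Space n) (u : Space n → ℂ), IsTestFunction x₀ (Real.exp (-8)) u →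
      ∀ τ : ℝ, 1 ≤ τ → 10 * m ≤ τ → ∀ k ≤ 2 * m, ∀ α ∈ multiIndices n k,
        eLpNorm (fun x => wt x₀ (τ + n / 2 - k) (2 * τ + m) x • multiDeriv α u x) 2 volume
          ≤ ENNReal.ofReal (C * τ ^ (k - 3 * m / 2 : ℝ)) * polyLapNorm m x₀ τ u := by
  obtain ⟨C, hC, h⟩ := carleman_eLpNorm n m hn
  refine ⟨2 * C, by positivity, fun x₀ u hu τ hτ1 hτ k hk α hα => ?_⟩
  obtain ⟨ha, hb⟩ := test_re_im hu.1
  have hKU := subset_punctured hu.2.2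
  have hKc := isClosed_tsupport u
  have hlen : (multiWord α).length = k := by
    rw [length_multiWord]
    exact (Finset.mem_piAntidiag.1 hα).1
  have e : multiDeriv α u = _ := multiDeriv_cpx ha.smooth hb.smooth α
  rw [e]
  refine (eLpNorm_smul_cpx_le ((ha.wordDeriv hKc _).wt_mul hKc hKU _ _).smooth.continuous
    ((hb.wordDeriv hKc _).wt_mul hKc hKU _ _).smooth.continuous one_le_two).trans ?_
  have h1 := h x₀ _ hu.2.1 hu.2.2 _ ha τ hτ1 hτ (multiWord α) (by rwa [hlen])
  have h2 := h x₀ _ hu.2.1 hu.2.2 _ hb τ hτ1 hτ (multiWord α) (by rwa [hlen])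
  rw [hlen] at h1 h2
  obtain ⟨l1, l2⟩ := lapNorm_le_polyLapNorm (m := m) (x₀ := x₀) hu.1 τ
  refine (add_le_add (h1.trans (mul_le_mul_right l1 _)) (h2.trans (mul_le_mul_right l2 _))).trans
    (le_of_eq ?_)
  rw [← two_mul, ← mul_assoc, mul_assoc 2 C, ENNReal.ofReal_mul zero_le_two, ENNReal.ofReal_ofNat]

theorem CarlemanBound.complex {p : ℝ≥0∞} {κ e : ℝ} (h : CarlemanBound n m p κ e) (hp : 1 ≤ p) :
    ∃ C : ℝ, 0 ≤ C ∧ ∀ (x₀ : Space n) (u : Space n → ℂ), IsTestFunction x₀ (Real.exp (-8)) u →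
      ∀ τ : ℝ, 1 ≤ τ → 10 * m ≤ τ →
        eLpNorm (fun x => wt x₀ (τ + κ) (2 * τ + m) x • u x) p volume
          ≤ ENNReal.ofReal (C * τ ^ (-e)) * polyLapNorm m x₀ τ u := by
  obtain ⟨C, hC, h⟩ := h
  refine ⟨2 * C, by positivity, fun x₀ u hu τ hτ1 hτ => ?_⟩
  obtain ⟨ha, hb⟩ := test_re_im hu.1
  have hKU := subset_punctured hu.2.2
  have hKc := isClosed_tsupport u
  refine (eLpNorm_smul_cpx_le (a := fun x => (u x).re) (b := fun x => (u x).im)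
    (ha.wt_mul hKc hKU _ _).smooth.continuous (hb.wt_mul hKc hKU _ _).smooth.continuous hp).trans ?_
  have h1 := h x₀ _ hu.2.1 hu.2.2 _ ha τ hτ1 hτ
  have h2 := h x₀ _ hu.2.1 hu.2.2 _ hb τ hτ1 hτ
  obtain ⟨l1, l2⟩ := lapNorm_le_polyLapNorm (m := m) (x₀ := x₀) hu.1 τ
  refine (add_le_add (h1.trans (mul_le_mul_right l1 _)) (h2.trans (mul_le_mul_right l2 _))).trans
    (le_of_eq ?_)
  rw [← two_mul, ← mul_assoc, mul_assoc 2 C, ENNReal.ofReal_mul zero_le_two, ENNReal.ofReal_ofNat]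

theorem multiDeriv_eq_zero (hu : ContDiff ℝ ∞ u) (α : Fin n → ℕ) {x : Space n}
    (hx : x ∉ tsupport u) : multiDeriv α u x = 0 := by
  obtain ⟨ha, hb⟩ := test_re_im hu
  have e : multiDeriv α u = _ := multiDeriv_cpx ha.smooth hb.smooth α
  rw [e]
  apply Complex.ext
  · exact (ha.wordDeriv (isClosed_tsupport u) _).zero x hx
  · exact (hb.wordDeriv (isClosed_tsupport u) _).zero x hx

theorem continuous_multiDeriv (hu : ContDiff ℝ ∞ u) (α : Fin n → ℕ) :
    Continuous (multiDeriv α u) := by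
  obtain ⟨ha, hb⟩ := test_re_im hu
  have e : multiDeriv α u = _ := multiDeriv_cpx ha.smooth hb.smooth α
  rw [e]
  exact (contDiff_cpx (contDiff_wordDeriv ha.smooth _) (contDiff_wordDeriv hb.smooth _)).continuous

theorem polyLaplacian_eq_zero (hu : ContDiff ℝ ∞ u) {x : Space n}
    (hx : x ∉ tsupport u) : polyLaplacian m u x = 0 := by
  obtain ⟨ha, hb⟩ := test_re_im hu
  have e : polyLaplacian m u = _ := polyLaplacian_cpx (isClosed_tsupport u) ha hb
  rw [e]
  apply Complex.ext
  · exact (ha.lap_iterate (isClosed_tsupport u) _).zero x hx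
  · exact (hb.lap_iterate (isClosed_tsupport u) _).zero x hx

end TestFunction

/-! ### Comparison of the weighted norms of the statement with the weights `wt`. -/

section Weights

variable {f : Space n → ℂ}

/-- No measurability of `f` is assumed: the lemma is applied to the full operator, whose
coefficients are arbitrary outside the ball. -/
theorem eLpNorm_radialMeasure (hn : 0 < n) (x₀ : Space n) {p : ℝ} (hp : 0 < p) (f : Space n → ℂ) :
    eLpNorm f (ENNReal.ofReal p) (radialMeasure x₀)
      = eLpNorm (fun x => ‖x - x₀‖ ^ (-(n / p) : ℝ) • f x) (ENNReal.ofReal p) volume := by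
  have hn0 : (0 : ℝ) < n := by exact_mod_cast hn
  rw [eLpNorm_eq_lintegral_rpow_enorm_toReal (ENNReal.ofReal_pos.2 hp).ne' ENNReal.ofReal_ne_top,
    eLpNorm_eq_lintegral_rpow_enorm_toReal (ENNReal.ofReal_pos.2 hp).ne' ENNReal.ofReal_ne_top,
    ENNReal.toReal_ofReal hp.le, radialMeasure,
    lintegral_withDensity_eq_lintegral_mul_non_measurable _ (by fun_prop)
      (Filter.Eventually.of_forall fun _ => ENNReal.ofReal_lt_top)]
  congr 1
  refine lintegral_congr fun x => ?_
  rw [Pi.mul_apply, enorm_smul, ENNReal.mul_rpow_of_nonneg _ _ hp.le]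
  congr 1
  rw [Real.enorm_of_nonneg (by positivity), ENNReal.ofReal_rpow_of_nonneg (by positivity) hp.le,
    ← Real.rpow_mul (norm_nonneg _), neg_mul, div_mul_cancel₀ _ hp.ne', Real.rpow_neg
    (norm_nonneg _), Real.rpow_natCast]

/-- This is the source of `ρ = 2τ`: `log((log r)²)` is twice the logarithm of `-log r`. -/
theorem exp_phi_eq {r τ : ℝ} (hr : Real.log r < 0) :
    Real.exp (-τ * phi r) = profile τ (2 * τ) (Real.log r) := by
  have h : 0 < -Real.log r := neg_pos.2 hr
  rw [phi, profile, Real.rpow_def_of_pos h, ← Real.exp_add, ← neg_sq, Real.log_pow]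
  congr 1
  push_cast
  ring

theorem rpow_neg_mul_wt {x : Space n} (hx : x ∈ punctured x₀) (σ ρ c : ℝ) :
    ‖x - x₀‖ ^ (-c) * wt x₀ σ ρ x = wt x₀ (σ + c) ρ x := by
  simp only [wt, rad]
  rw [profile_add, Real.rpow_def_of_pos (norm_pos_of_mem hx)]
  ring_nf

theorem wt_add_nat_right {x : Space n} (hx : x ∈ punctured x₀) (σ ρ : ℝ) (m : ℕ) :
    wt x₀ σ (ρ + m) x * (-Real.log ‖x - x₀‖) ^ m = wt x₀ σ ρ x := by
  have h : 0 < -Real.log ‖x - x₀‖ := neg_pos.2 (log_neg_of_mem hx)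
  simp only [wt, rad, profile]
  rw [neg_add, ← sub_eq_add_neg, Real.rpow_sub_natCast h.ne']
  field_simp

theorem norm_leftWeighted {x : Space n} (hx : x ∈ punctured x₀) (τ : ℝ) (k : ℕ) :
    ‖leftWeighted m x₀ τ k f x‖ = wt x₀ (τ - k) (2 * τ + m) x * ‖f x‖ := by
  have hl := log_neg_of_mem hx
  have hr := norm_pos_of_mem hx
  have h : 0 < -Real.log ‖x - x₀‖ := neg_pos.2 hl
  have e : Real.exp (-τ * phi ‖x - x₀‖) = wt x₀ τ (2 * τ) x := exp_phi_eq hl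
  rw [leftWeighted, norm_smul, wt_sub_nat hx, e, ← wt_add_nat_right hx τ (2 * τ) m, norm_mul,
    norm_mul, norm_inv, norm_pow, Real.norm_eq_abs (Real.log _), abs_of_neg hl,
    Real.norm_of_nonneg (by positivity : 0 ≤ ‖x - x₀‖ ^ k), norm_mul,
    Real.norm_of_nonneg (wt_pos hx _ _).le, Real.norm_of_nonneg (by positivity),
    mul_inv_cancel_right₀ (by positivity)]

theorem norm_rightWeighted {x : Space n} (hx : x ∈ punctured x₀) (τ : ℝ) :
    ‖rightWeighted m x₀ τ f x‖ = wt x₀ (τ - 2 * m) (2 * τ) x * ‖f x‖ := by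
  have hl := log_neg_of_mem hx
  have e : Real.exp (-τ * phi ‖x - x₀‖) = wt x₀ τ (2 * τ) x := exp_phi_eq hl
  have := wt_sub_nat hx τ (2 * τ) (2 * m)
  push_cast at this
  rw [rightWeighted, norm_smul, this, e, norm_mul, Real.norm_of_nonneg (wt_pos hx _ _).le,
    Real.norm_of_nonneg (by positivity)]

theorem eLpNorm_leftWeighted (hKU : K ⊆ punctured x₀) (hf : ∀ x ∉ K, f x = 0) (τ : ℝ) (k : ℕ)
    (p : ℝ≥0∞) :
    eLpNorm (leftWeighted m x₀ τ k f) p volume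
      = eLpNorm (fun x => wt x₀ (τ - k) (2 * τ + m) x • f x) p volume := by
  refine eLpNorm_congr_norm_ae (Filter.Eventually.of_forall fun x => ?_)
  by_cases hx : x ∈ K
  · rw [norm_leftWeighted (hKU hx), norm_smul, Real.norm_of_nonneg (wt_pos (hKU hx) _ _).le]
  · simp [leftWeighted, hf x hx]

theorem eLpNorm_leftWeighted_radialMeasure (hn : 0 < n) (hKU : K ⊆ punctured x₀)
    (hf : ∀ x ∉ K, f x = 0) (τ : ℝ) (k : ℕ) {p : ℝ} (hp : 0 < p) :
    eLpNorm (leftWeighted m x₀ τ k f) (ENNReal.ofReal p) (radialMeasure x₀)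
      = eLpNorm (fun x => wt x₀ (τ + n / p - k) (2 * τ + m) x • f x) (ENNReal.ofReal p) volume := by
  rw [eLpNorm_radialMeasure hn x₀ hp]
  refine eLpNorm_congr_norm_ae (Filter.Eventually.of_forall fun x => ?_)
  by_cases hx : x ∈ K
  · rw [norm_smul, norm_leftWeighted (hKU hx), norm_smul,
      Real.norm_of_nonneg (wt_pos (hKU hx) _ _).le, Real.norm_of_nonneg (by positivity),
      ← mul_assoc, rpow_neg_mul_wt (hKU hx), sub_add_eq_add_sub]
  · simp [leftWeighted, hf x hx]

theorem eLpNorm_rightWeighted_radialMeasure (hn : 0 < n) (hKU : K ⊆ punctured x₀)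
    (hf : ∀ x ∉ K, f x = 0) (τ : ℝ) :
    eLpNorm (rightWeighted m x₀ τ f) 2 (radialMeasure x₀)
      = eLpNorm (fun x => wt x₀ (τ + n / 2 - 2 * m) (2 * τ) x • f x) 2 volume := by
  have h := eLpNorm_radialMeasure hn x₀ two_pos (rightWeighted m x₀ τ f)
  rw [ENNReal.ofReal_ofNat] at h
  rw [h]
  refine eLpNorm_congr_norm_ae (Filter.Eventually.of_forall fun x => ?_)
  by_cases hx : x ∈ K
  · rw [norm_smul, norm_rightWeighted (hKU hx), norm_smul,
      Real.norm_of_nonneg (wt_pos (hKU hx) _ _).le, Real.norm_of_nonneg (by positivity),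
      ← mul_assoc, rpow_neg_mul_wt (hKU hx), sub_add_eq_add_sub]
  · simp [rightWeighted, hf x hx]

/-- Losing one power of `r` pays for `|log r|^m`. -/
theorem wt_sub_le {x : Space n} (hx : x ∈ punctured x₀) (σ ρ : ℝ) (m : ℕ) {d : ℝ} (hd : 1 ≤ d) :
    wt x₀ (σ - d) ρ x ≤ m.factorial * wt x₀ σ (ρ + m) x := by
  have hl := log_neg_of_mem hx
  have hr := norm_pos_of_mem hx
  refine (wt_le_wt_left hx (by push_cast; linarith : σ - d ≤ σ - (1 : ℕ)) ρ).trans ?_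
  rw [wt_sub_nat hx, pow_one, ← wt_add_nat_right hx σ ρ m, mul_assoc, mul_comm (m.factorial : ℝ)]
  refine mul_le_mul_of_nonneg_left ?_ (wt_pos hx _ _).le
  have h := Real.pow_div_factorial_le_exp (-Real.log ‖x - x₀‖) (by linarith) m
  rw [Real.exp_neg, Real.exp_log hr, div_le_iff₀ (by positivity), ← div_eq_inv_mul,
    le_div_iff₀ hr] at h
  exact h

end Weights

end

/-! ### Absorption of the lower order terms. -/

section

variable {n m α₀ : ℕ} {x₀ : Space n} {u : Space n → ℂ}

theorem le_two_mul_of_le_add_half {a b : ℝ≥0∞} (ha : a ≠ (⊤ : ℝ≥0∞)) (h : a ≤ b + a / 2) :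
    a ≤ 2 * b := by
  have h2 : a / 2 ≤ b := by
    refine ENNReal.le_of_add_le_add_right (ENNReal.div_ne_top ha two_ne_zero) ?_
    rwa [ENNReal.add_halves]
  calc a = a / 2 + a / 2 := (ENNReal.add_halves a).symm
    _ ≤ b + b := by gcongr
    _ = 2 * b := (two_mul b).symm

/-- The threshold `τ ≥ C v^{1/β}` turns the cost `v τ^{-β}` of a coefficient of size `v` into
`C^{-β}`. Replacing `β` by a common lower bound `γ` makes the smallness uniform over all terms. -/
theorem mul_rpow_neg_le {v C τ β γ : ℝ} (hv : 0 ≤ v) (hC : 1 ≤ C) (hτ : 0 < τ) (hβ : 0 < β)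
    (hγ : γ ≤ β) (h : C * v ^ (1 / β) ≤ τ) : v * τ ^ (-β) ≤ C ^ (-γ) := by
  have hC0 : 0 < C := by linarith
  have h1 : v ≤ τ ^ β * C ^ (-β) := by
    calc v = (v ^ (1 / β)) ^ β := by
          rw [← Real.rpow_mul hv, one_div_mul_cancel hβ.ne', Real.rpow_one]
      _ ≤ (τ / C) ^ β := by
          gcongr
          rw [le_div_iff₀ hC0]
          linarith
      _ = _ := by rw [Real.div_rpow hτ.le hC0.le, Real.rpow_neg hC0.le, div_eq_mul_inv]
  calc v * τ ^ (-β) ≤ τ ^ β * C ^ (-β) * τ ^ (-β) := by gcongr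
    _ = C ^ (-β) := by
        rw [mul_right_comm, ← Real.rpow_add hτ, add_neg_cancel, Real.rpow_zero, one_mul]
    _ ≤ C ^ (-γ) := Real.rpow_le_rpow_of_exponent_le hC (neg_le_neg hγ)

theorem measurable_wt (x₀ : Space n) (σ ρ : ℝ) : Measurable (wt x₀ σ ρ) := by
  unfold wt rad profile
  fun_prop

theorem continuous_wt_smul_multiDeriv (hu : IsTestFunction x₀ (Real.exp (-8)) u)
    (α : Fin n → ℕ) (σ ρ : ℝ) : Continuous fun x => wt x₀ σ ρ x • multiDeriv α u x := by
  obtain ⟨ha, hb⟩ := test_re_im hu.1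
  have hKU := subset_punctured hu.2.2
  have hKc := isClosed_tsupport u
  have e : multiDeriv α u = _ := multiDeriv_cpx ha.smooth hb.smooth α
  rw [e]
  have h := (contDiff_cpx ((ha.wordDeriv hKc (multiWord α)).wt_mul hKc hKU σ ρ).smooth
    ((hb.wordDeriv hKc (multiWord α)).wt_mul hKc hKU σ ρ).smooth).continuous
  refine h.congr fun x => ?_
  apply Complex.ext <;> simp [cpx]

theorem multiDeriv_zero (u : Space n → ℂ) : multiDeriv 0 u = u := by
  unfold multiDeriv
  induction List.finRange n with
  | nil => rfl
  | cons i L ih => rwa [List.foldr_cons]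

theorem continuous_polyLaplacian (hu : ContDiff ℝ ∞ u) : Continuous (polyLaplacian m u) := by
  obtain ⟨ha, hb⟩ := test_re_im hu
  have e : polyLaplacian m u = _ := polyLaplacian_cpx (isClosed_tsupport u) ha hb
  rw [e]
  exact (contDiff_cpx (ha.lap_iterate (isClosed_tsupport u) _).smooth
    (hb.lap_iterate (isClosed_tsupport u) _).smooth).continuous

/-- The contribution of a potential, by Hölder's inequality. -/
theorem eLpNorm_potential_le (hu : IsTestFunction x₀ (Real.exp (-8)) u) (α : Fin n → ℕ)
    {V : Space n → ℂ} {s p : ℝ≥0∞} [ENNReal.HolderTriple s p 2]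
    (hV : AEStronglyMeasurable V (volume.restrict (Metric.ball x₀ (Real.exp (-8)))))
    {σ d ρ : ℝ} (hd : 1 ≤ d) :
    eLpNorm (fun x => wt x₀ (σ - d) ρ x • (V x * multiDeriv α u x)) 2
        (volume.restrict (Metric.ball x₀ (Real.exp (-8))))
      ≤ ENNReal.ofReal m.factorial
        * (eLpNorm V s (volume.restrict (Metric.ball x₀ (Real.exp (-8))))
          * eLpNorm (fun x => wt x₀ σ (ρ + m) x • multiDeriv α u x) p volume) := by
  have hKU := subset_punctured hu.2.2
  set μ := (volume : Measure (Space n)).restrict (Metric.ball x₀ (Real.exp (-8)))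
  have h1 := eLpNorm_smul_le_mul_eLpNorm (p := s) (q := p) (r := 2)
    (continuous_wt_smul_multiDeriv hu α σ (ρ + m)).aestronglyMeasurable hV
  refine (eLpNorm_le_mul_eLpNorm_of_ae_le_mul (c := m.factorial)
    (Filter.Eventually.of_forall fun x => ?_) 2).trans
    (mul_le_mul_right (h1.trans (mul_le_mul_right
      (eLpNorm_mono_measure _ Measure.restrict_le_self) _)) _)
  by_cases hx : x ∈ tsupport u
  · have := wt_sub_le (hKU hx) σ ρ m hd
    rw [Pi.smul_apply', norm_smul, norm_mul, smul_eq_mul, norm_mul, norm_smul,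
      Real.norm_of_nonneg (wt_pos (hKU hx) _ _).le, Real.norm_of_nonneg (wt_pos (hKU hx) _ _).le]
    calc _ ≤ m.factorial * wt x₀ σ (ρ + m) x * (‖V x‖ * ‖multiDeriv α u x‖) := by gcongr
      _ = _ := by ring
  · rw [multiDeriv_eq_zero hu.1 α hx, mul_zero, smul_zero, norm_zero]
    positivity

/-- The coefficients are measurable only on the ball, so the triangle inequality is applied to norms
restricted there. Nothing is lost, as `u` is supported inside. -/
theorem polyLapNorm_le (hn : 0 < n) (hu : IsTestFunction x₀ (Real.exp (-8)) u)
    {V : (Fin n → ℕ) → Space n → ℂ} {V₀ : Space n → ℂ} {s : ℝ≥0∞}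
    (hV : AdmissibleCoeffs α₀ s x₀ (Real.exp (-8)) V V₀) (τ : ℝ) :
    polyLapNorm m x₀ τ u ≤ operatorNorm m α₀ V V₀ x₀ τ u
      + ((∑ k ∈ Finset.Icc 1 α₀, ∑ α ∈ multiIndices n k,
        eLpNorm (fun x => wt x₀ (τ + n / 2 - 2 * m) (2 * τ) x • (V α x * multiDeriv α u x)) 2
          (volume.restrict (Metric.ball x₀ (Real.exp (-8)))))
        + eLpNorm (fun x => wt x₀ (τ + n / 2 - 2 * m) (2 * τ) x • (V₀ x * u x)) 2
          (volume.restrict (Metric.ball x₀ (Real.exp (-8))))) := by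
  have hKU := subset_punctured hu.2.2
  have hw := (measurable_wt x₀ (τ + n / 2 - 2 * m) (2 * τ))
  have hF : operatorNorm m α₀ V V₀ x₀ τ u = eLpNorm (fun x =>
      wt x₀ (τ + n / 2 - 2 * m) (2 * τ) x • fullOperator m α₀ V V₀ u x) 2 volume :=
    eLpNorm_rightWeighted_radialMeasure hn hKU (fun x hx => by
      simp [fullOperator, polyLaplacian_eq_zero hu.1 hx, multiDeriv_eq_zero hu.1 _ hx,
        image_eq_zero_of_notMem_tsupport hx]) τ
  rw [hF]
  unfold polyLapNorm
  set w := wt x₀ (τ + n / 2 - 2 * m) (2 * τ)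
  rw [← eLpNorm_restrict_eq_of_support_subset (s := Metric.ball x₀ (Real.exp (-8)))
    (f := fun x => w x • polyLaplacian m u x)]
  swap
  · intro x hx
    by_contra hx'
    refine hx ?_
    simp only
    rw [polyLaplacian_eq_zero hu.1 fun h => hx' (hu.2.2 h).1, smul_zero]
  refine le_trans ?_ (add_le_add_left (eLpNorm_mono_measure _
    (Measure.restrict_le_self (s := Metric.ball x₀ (Real.exp (-8))))) _)
  set μ := (volume : Measure (Space n)).restrict (Metric.ball x₀ (Real.exp (-8)))
  have hT : ∀ k ∈ Finset.Icc 1 α₀, ∀ α ∈ multiIndices n k,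
      AEStronglyMeasurable (fun x => w x • (V α x * multiDeriv α u x)) μ := fun k hk α hα =>
    hw.aestronglyMeasurable.smul
      ((hV.1 k hk α hα).1.mul (continuous_multiDeriv hu.1 α).aestronglyMeasurable)
  have hT0 : AEStronglyMeasurable (fun x => w x • (V₀ x * u x)) μ :=
    hw.aestronglyMeasurable.smul (hV.2.1.mul hu.1.continuous.aestronglyMeasurable)
  have hS : ∀ k ∈ Finset.Icc 1 α₀, AEStronglyMeasurable
      (∑ α ∈ multiIndices n k, fun x => w x • (V α x * multiDeriv α u x)) μ := fun k hk =>
    Finset.aestronglyMeasurable_sum _ (hT k hk)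
  have hSS := Finset.aestronglyMeasurable_sum (Finset.Icc 1 α₀) hS
  have hP : AEStronglyMeasurable (fun x => w x • polyLaplacian m u x) μ :=
    hw.aestronglyMeasurable.smul (continuous_polyLaplacian hu.1).aestronglyMeasurable
  set S := ∑ k ∈ Finset.Icc 1 α₀, ∑ α ∈ multiIndices n k,
    fun x => w x • (V α x * multiDeriv α u x) with hSdef
  have e : (fun x => w x • fullOperator m α₀ V V₀ u x)
      = (fun x => w x • polyLaplacian m u x) + (S + fun x => w x • (V₀ x * u x)) := by
    funext x
    simp only [hSdef, fullOperator, smul_add, Finset.smul_sum, Pi.add_apply, Finset.sum_apply,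
      add_assoc]
  have hFm : AEStronglyMeasurable (fun x => w x • fullOperator m α₀ V V₀ u x) μ := by
    rw [e]
    exact hP.add (hSS.add hT0)
  rw [show (fun x => w x • polyLaplacian m u x) = (fun x => w x • fullOperator m α₀ V V₀ u x)
      - (S + fun x => w x • (V₀ x * u x)) by rw [e, add_sub_cancel_right]]
  refine (eLpNorm_sub_le hFm (hSS.add hT0) one_le_two).trans (add_le_add le_rfl
    ((eLpNorm_add_le hSS hT0 one_le_two).trans (add_le_add ?_ le_rfl)))
  exact (eLpNorm_sum_le hS one_le_two).trans
    (Finset.sum_le_sum fun k hk => eLpNorm_sum_le (hT k hk) one_le_two)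

theorem rpow_le_coeffSize {s : ℝ≥0∞} {ν R : ℝ} {V : (Fin n → ℕ) → Space n → ℂ} {V₀ : Space n → ℂ}
    {k : ℕ} (hk : k ∈ Finset.Icc 1 α₀) {α : Fin n → ℕ} (hα : α ∈ multiIndices n k) :
    (eLpNorm (V α) (⊤ : ℝ≥0∞) (volume.restrict (Metric.ball x₀ R))).toReal ^ (2 / (3 * m - 2 * k : ℝ))
      ≤ coeffSize m α₀ s ν x₀ R V V₀ := by
  have h1 := Finset.single_le_sum (s := multiIndices n k) (f := fun α =>
    (eLpNorm (V α) (⊤ : ℝ≥0∞) (volume.restrict (Metric.ball x₀ R))).toReal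
      ^ (2 / (3 * m - 2 * k : ℝ))) (fun _ _ => by positivity) hα
  have h2 := Finset.single_le_sum (s := Finset.Icc 1 α₀) (f := fun k : ℕ => ∑ α ∈ multiIndices n k,
    (eLpNorm (V α) (⊤ : ℝ≥0∞) (volume.restrict (Metric.ball x₀ R))).toReal
      ^ (2 / (3 * m - 2 * k : ℝ))) (fun _ _ => Finset.sum_nonneg fun _ _ => by positivity) hk
  have h3 : 0 ≤ (eLpNorm V₀ s (volume.restrict (Metric.ball x₀ R))).toReal ^ ν := by positivity
  unfold coeffSize
  linarith

theorem rpow_le_coeffSize_zero {s : ℝ≥0∞} {ν R : ℝ} {V : (Fin n → ℕ) → Space n → ℂ}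
    {V₀ : Space n → ℂ} :
    1 ≤ coeffSize m α₀ s ν x₀ R V V₀ ∧
    (eLpNorm V₀ s (volume.restrict (Metric.ball x₀ R))).toReal ^ ν
      ≤ coeffSize m α₀ s ν x₀ R V V₀ := by
  have h2 : 0 ≤ ∑ k ∈ Finset.Icc 1 α₀, ∑ α ∈ multiIndices n k,
    (eLpNorm (V α) (⊤ : ℝ≥0∞) (volume.restrict (Metric.ball x₀ R))).toReal
      ^ (2 / (3 * m - 2 * k : ℝ)) :=
    Finset.sum_nonneg fun _ _ => Finset.sum_nonneg fun _ _ => by positivity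
  have h3 : 0 ≤ (eLpNorm V₀ s (volume.restrict (Metric.ball x₀ R))).toReal ^ ν := by positivity
  unfold coeffSize
  constructor <;> linarith

/-- For large `τ` the lower order terms are absorbed. -/
theorem polyLapNorm_le_operatorNorm (hn : 2 ≤ n) (hα₀ : 2 * α₀ + 1 ≤ 3 * m) {s p : ℝ≥0∞}
    [ENNReal.HolderTriple s p 2] (hp : 1 ≤ p) {κ e : ℝ} (hB : CarlemanBound n m p κ e)
    (he : 0 < e) (hκ : n / 2 - 2 * m + 1 ≤ κ) :
    ∃ C₀ : ℝ, 0 < C₀ ∧ ∀ (x₀ : Space n) (V : (Fin n → ℕ) → Space n → ℂ) (V₀ : Space n → ℂ),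
      AdmissibleCoeffs α₀ s x₀ (Real.exp (-8)) V V₀ →
      ∀ u : Space n → ℂ, IsTestFunction x₀ (Real.exp (-8)) u →
      ∀ τ : ℝ, C₀ * coeffSize m α₀ s (1 / e) x₀ (Real.exp (-8)) V V₀ < τ →
        1 ≤ τ ∧ 10 * m ≤ τ ∧
          polyLapNorm m x₀ τ u ≤ 2 * operatorNorm m α₀ V V₀ x₀ τ u := by
  obtain ⟨C₁, hC₁, h₁⟩ := carleman_multiDeriv n m hn
  obtain ⟨C₂, hC₂, h₂⟩ := hB.complex hp
  obtain ⟨N, hN⟩ : ∃ N : ℕ, N = ∑ k ∈ Finset.Icc 1 α₀, (multiIndices n k).card := ⟨_, rfl⟩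
  -- Every `β_α = (3m - 2|α|)/2` is at least `1/2`, because `3m - 2|α|` is a positive integer; the
  -- potential contributes the exponent `e`.
  set γ : ℝ := min (1 / 2) e
  have hγ : 0 < γ := lt_min (by norm_num) he
  have hγ1 : γ ≤ 1 / 2 := min_le_left _ _
  have hγ2 : γ ≤ e := min_le_right _ _
  -- There are `N + 1` lower order terms, each at most `m! (C₁ + C₂) C₀^{-γ}` times the norm of `Δ^m
  -- u`. This `A`, with `C₀ ≥ A^{1/γ}`, makes their sum at most one half of it.
  set A : ℝ := 2 * (N + 1) * (m.factorial * (C₁ + C₂)) + 1 with hA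
  have hA0 : 0 < A := by positivity
  clear_value A γ
  set C₀ : ℝ := A ^ (1 / γ) + 10 * m + 1 with hC₀
  have hA1 : 0 < A ^ (1 / γ) := by positivity
  have hm0 : (0 : ℝ) ≤ m := by positivity
  have hC₀1 : 1 ≤ C₀ := by linarith
  have hC₀A : C₀ ^ (-γ) ≤ A⁻¹ := by
    calc C₀ ^ (-γ) ≤ (A ^ (1 / γ)) ^ (-γ) :=
          Real.rpow_le_rpow_of_nonpos hA1 (by linarith) (by linarith)
      _ = A⁻¹ := by
          rw [← Real.rpow_mul hA0.le, mul_neg, one_div_mul_cancel hγ.ne', Real.rpow_neg_one]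
  refine ⟨C₀, by linarith, fun x₀ V V₀ hV u hu τ hτ => ?_⟩
  have hcs := rpow_le_coeffSize_zero (m := m) (α₀ := α₀) (s := s) (ν := 1 / e) (x₀ := x₀)
    (R := Real.exp (-8)) (V := V) (V₀ := V₀)
  have hτC : C₀ ≤ τ := (le_mul_of_one_le_right (by linarith) hcs.1).trans hτ.le
  have hτ1 : 1 ≤ τ := hC₀1.trans hτC
  have hτm : 10 * m ≤ τ := by linarith
  have hτ0 : 0 < τ := by linarith
  refine ⟨hτ1, hτm, le_two_mul_of_le_add_half (polyLapNorm_ne_top hu τ) ?_⟩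
  refine (polyLapNorm_le (by omega) hu hV τ).trans (add_le_add le_rfl ?_)
  set Q := polyLapNorm m x₀ τ u
  set q : ℝ≥0∞ := ENNReal.ofReal (m.factorial * (C₁ + C₂) * A⁻¹) * Q with hq
  have hpot : ∀ (v : ℝ≥0∞) (C β : ℝ) (X : ℝ≥0∞), v ≠ (⊤ : ℝ≥0∞) → 0 ≤ C → C ≤ C₁ + C₂ →
      γ ≤ β → C₀ * v.toReal ^ (1 / β) ≤ τ → X ≤ ENNReal.ofReal (C * τ ^ (-β)) * Q →
      ENNReal.ofReal m.factorial * (v * X) ≤ q := by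
    intro v C β X hv hC hCC hβ hvτ hX
    have h := mul_rpow_neg_le ENNReal.toReal_nonneg hC₀1 hτ0 (hγ.trans_le hβ) hβ hvτ
    calc ENNReal.ofReal m.factorial * (v * X)
        ≤ ENNReal.ofReal m.factorial * (ENNReal.ofReal v.toReal
          * (ENNReal.ofReal (C * τ ^ (-β)) * Q)) := by
          rw [ENNReal.ofReal_toReal hv]
          gcongr
      _ = ENNReal.ofReal (m.factorial * C * (v.toReal * τ ^ (-β))) * Q := by
          rw [← mul_assoc (ENNReal.ofReal v.toReal), ← mul_assoc,
            ← ENNReal.ofReal_mul ENNReal.toReal_nonneg, ← ENNReal.ofReal_mul (by positivity)]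
          congr 2
          ring
      _ ≤ q := by
          have := h.trans hC₀A
          rw [hq]
          gcongr
  have hterm : ∀ k ∈ Finset.Icc 1 α₀, ∀ α ∈ multiIndices n k,
      eLpNorm (fun x => wt x₀ (τ + n / 2 - 2 * m) (2 * τ) x • (V α x * multiDeriv α u x)) 2
        (volume.restrict (Metric.ball x₀ (Real.exp (-8)))) ≤ q := by
    intro k hk α hα
    have hk1 : 2 * k + 1 ≤ 3 * m := by
      have := (Finset.mem_Icc.1 hk).2
      omega
    have hk2 : 2 * (k : ℝ) + 1 ≤ 3 * m := by exact_mod_cast hk1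
    have hk3 : (k : ℝ) + 1 ≤ 2 * m := by exact_mod_cast (by omega : k + 1 ≤ 2 * m)
    -- The spare powers of `r` number `2m - k`, at least one since `2k + 1 ≤ 3m`; one of them pays
    -- for `(log r)^m`.
    have hp1 := eLpNorm_potential_le (m := m) (s := (⊤ : ℝ≥0∞)) (p := 2) hu α (hV.1 k hk α hα).1
      (σ := τ + n / 2 - k) (d := 2 * m - k) (ρ := 2 * τ) (by linarith)
    rw [show τ + (n : ℝ) / 2 - k - (2 * m - k) = τ + n / 2 - 2 * m by ring] at hp1
    refine hp1.trans (hpot _ C₁ ((3 * m - 2 * k) / 2) _ (hV.1 k hk α hα).2.ne hC₁ (by linarith)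
      (by linarith) ?_ ?_)
    · rw [one_div_div]
      exact (mul_le_mul_of_nonneg_left (rpow_le_coeffSize hk hα) (by linarith)).trans hτ.le
    · refine (h₁ x₀ u hu τ hτ1 hτm k (by omega) α hα).trans (le_of_eq ?_)
      congr 4
      ring
  have hterm0 : eLpNorm (fun x => wt x₀ (τ + n / 2 - 2 * m) (2 * τ) x • (V₀ x * u x)) 2
        (volume.restrict (Metric.ball x₀ (Real.exp (-8)))) ≤ q := by
    -- For the potential, `hκ` says precisely that at least one power of `r` is left to pay for the
    -- logarithms.
    have hp1 := eLpNorm_potential_le (m := m) (s := s) (p := p) hu 0 hV.2.1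
      (σ := τ + κ) (d := κ - n / 2 + 2 * m) (ρ := 2 * τ) (by linarith)
    rw [show τ + κ - (κ - n / 2 + 2 * m) = τ + n / 2 - 2 * m by ring, multiDeriv_zero] at hp1
    refine hp1.trans (hpot _ C₂ e _ hV.2.2.ne hC₂ (by linarith) hγ2 ?_ ?_)
    · exact (mul_le_mul_of_nonneg_left hcs.2 (by linarith)).trans hτ.le
    · exact h₂ x₀ u hu τ hτ1 hτm
  calc _ ≤ (∑ k ∈ Finset.Icc 1 α₀, ∑ α ∈ multiIndices n k, q) + q :=
        add_le_add (Finset.sum_le_sum fun k hk => Finset.sum_le_sum (hterm k hk)) hterm0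
    _ = (N + 1 : ℕ) * q := by
        simp only [Finset.sum_const, nsmul_eq_mul, ← Finset.sum_mul]
        rw [hN]
        push_cast
        ring
    _ = ENNReal.ofReal ((N + 1) * (m.factorial * (C₁ + C₂) * A⁻¹)) * Q := by
        rw [hq, ← mul_assoc, ENNReal.ofReal_mul (p := (N : ℝ) + 1) (by positivity)]
        congr 2
        rw [← ENNReal.ofReal_natCast]
        push_cast
        rfl
    _ ≤ ENNReal.ofReal (1 / 2) * Q := by
        gcongr
        rw [← mul_assoc, ← div_eq_mul_inv, div_le_iff₀ hA0]
        linarith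
    _ = Q / 2 := by
        rw [one_div, ENNReal.ofReal_inv_of_pos two_pos, ENNReal.ofReal_ofNat, mul_comm,
          div_eq_mul_inv]

/-- Two bounds enter independently: the one at `p'`, conjugate to `s`, absorbs `V₀` and sets the
threshold exponent `1/e'`, while the one at `p` is the conclusion. -/
theorem carleman_perturbed (hn : 2 ≤ n) (hα₀ : 2 * α₀ + 1 ≤ 3 * m) {s p' p : ℝ≥0∞}
    (hs : s⁻¹ + p'⁻¹ = 2⁻¹) (hp' : 1 ≤ p') {κ' e' κ e : ℝ} (hB' : CarlemanBound n m p' κ' e')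
    (he' : 0 < e') (hκ' : n / 2 - 2 * m + 1 ≤ κ') (hp : 1 ≤ p) (hB : CarlemanBound n m p κ e)
    (j : ℕ) :
    ∃ C₀ C₁ R₀ : ℝ, 0 < C₀ ∧ 0 < C₁ ∧ 0 < R₀ ∧ R₀ < 1 ∧
      ∀ (x₀ : Space n) (V : (Fin n → ℕ) → Space n → ℂ) (V₀ : Space n → ℂ),
        AdmissibleCoeffs α₀ s x₀ R₀ V V₀ →
        ∀ u : Space n → ℂ, IsTestFunction x₀ R₀ u → tsupport u ⊆ punctured x₀ ∧
        ∀ τ : ℝ, C₀ * coeffSize m α₀ s (1 / e') x₀ R₀ V V₀ < τ →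
          ENNReal.ofReal (τ ^ e)
              * eLpNorm (fun x => wt x₀ (τ + κ) (2 * τ + m) x • u x) p volume
            + derivSum j m x₀ τ u
          ≤ ENNReal.ofReal C₁ * operatorNorm m α₀ V V₀ x₀ τ u := by
  have hol : ENNReal.HolderTriple s p' 2 := ⟨hs⟩
  obtain ⟨C₀, hC₀, h₀⟩ := polyLapNorm_le_operatorNorm hn hα₀ hp' hB' he' hκ' (s := s)
  obtain ⟨C₁, hC₁, h₁⟩ := carleman_multiDeriv n m hn
  obtain ⟨C₂, hC₂, h₂⟩ := hB.complex hp
  obtain ⟨N, hN⟩ : ∃ N : ℕ, N = ∑ k ∈ Finset.Icc j (2 * m - 1), (multiIndices n k).card :=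
    ⟨_, rfl⟩
  refine ⟨C₀, 2 * (C₂ + N * C₁) + 1, Real.exp (-8), hC₀, by positivity, Real.exp_pos _,
    by rw [Real.exp_lt_one_iff]; norm_num,
    fun x₀ V V₀ hV u hu => ⟨subset_punctured hu.2.2, fun τ hτ => ?_⟩⟩
  obtain ⟨hτ1, hτm, hQ⟩ := h₀ x₀ V V₀ hV u hu τ hτ
  have hτ0 : 0 < τ := by linarith
  have hKU := subset_punctured hu.2.2
  set Q := polyLapNorm m x₀ τ u
  have hfac : ∀ (C a : ℝ) (X : ℝ≥0∞), 0 ≤ C → X ≤ ENNReal.ofReal (C * τ ^ (-a)) * Q →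
      ENNReal.ofReal (τ ^ a) * X ≤ ENNReal.ofReal C * Q := by
    intro C a X hC hX
    refine (mul_le_mul_right hX _).trans (le_of_eq ?_)
    rw [← mul_assoc, ← ENNReal.ofReal_mul (by positivity), mul_left_comm, ← Real.rpow_add hτ0,
      add_neg_cancel, Real.rpow_zero, mul_one]
  have hsum : derivSum j m x₀ τ u ≤ (N : ℝ≥0∞) * (ENNReal.ofReal C₁ * Q) := by
    calc derivSum j m x₀ τ u ≤ ∑ k ∈ Finset.Icc j (2 * m - 1), ∑ α ∈ multiIndices n k,
          ENNReal.ofReal C₁ * Q := by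
          refine Finset.sum_le_sum fun k hk => Finset.sum_le_sum fun α hα => ?_
          have hk' := (Finset.mem_Icc.1 hk).2
          refine hfac C₁ _ _ hC₁ ?_
          have h := eLpNorm_leftWeighted_radialMeasure (m := m) (by omega) hKU
            (fun x hx => multiDeriv_eq_zero hu.1 α hx) τ k two_pos
          rw [ENNReal.ofReal_ofNat] at h
          rw [h]
          refine (h₁ x₀ u hu τ hτ1 hτm k (by omega) α hα).trans (le_of_eq ?_)
          congr 4
          ring
      _ = _ := by
          simp only [Finset.sum_const, nsmul_eq_mul, ← Finset.sum_mul]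
          rw [hN]
          push_cast
          rfl
  calc _ ≤ ENNReal.ofReal C₂ * Q + (N : ℝ≥0∞) * (ENNReal.ofReal C₁ * Q) :=
        add_le_add (hfac C₂ e _ hC₂ (h₂ x₀ u hu τ hτ1 hτm)) hsum
    _ = ENNReal.ofReal (C₂ + N * C₁) * Q := by
        rw [ENNReal.ofReal_add hC₂ (by positivity), ENNReal.ofReal_mul (by positivity),
          ENNReal.ofReal_natCast]
        ring
    _ ≤ ENNReal.ofReal (C₂ + N * C₁) * (2 * operatorNorm m α₀ V V₀ x₀ τ u) := by gcongr
    _ = ENNReal.ofReal (2 * (C₂ + N * C₁)) * operatorNorm m α₀ V V₀ x₀ τ u := by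
        rw [ENNReal.ofReal_mul two_pos.le, ENNReal.ofReal_ofNat]
        ring
    _ ≤ _ := by
        gcongr
        linarith

end

/-! ### Exponent arithmetic. -/

section

theorem recip_nonneg (s : ℝ≥0∞) : 0 ≤ recip s := ENNReal.toReal_nonneg

theorem recip_lt_of_ofReal_lt {s : ℝ≥0∞} {c : ℝ} (hc : 0 < c) (h : ENNReal.ofReal c < s) :
    s ≠ 0 ∧ recip s < 1 / c := by
  have hs : s ≠ 0 := (bot_lt_of_lt h).ne'
  refine ⟨hs, ?_⟩
  have h2 := ENNReal.inv_lt_inv.2 h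
  rw [← ENNReal.ofReal_inv_of_pos hc, ← ofReal_recip hs] at h2
  rw [one_div]
  exact (ENNReal.ofReal_lt_ofReal_iff (inv_pos.2 hc)).1 h2

theorem exists_holder_exponent {s : ℝ≥0∞} (hs : s ≠ 0) (h : recip s ≤ 1 / 2) :
    ∃ p : ℝ≥0∞, s⁻¹ + p⁻¹ = 2⁻¹ ∧ p⁻¹ = ENNReal.ofReal (1 / 2 - recip s) ∧ 2 ≤ p
      ∧ recip p = 1 / 2 - recip s := by
  have h2 : (2 : ℝ≥0∞)⁻¹ = ENNReal.ofReal (1 / 2) := by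
    rw [one_div, ENNReal.ofReal_inv_of_pos two_pos, ENNReal.ofReal_ofNat]
  refine ⟨(ENNReal.ofReal (1 / 2 - recip s))⁻¹, ?_, inv_inv _, ?_, ?_⟩
  · rw [inv_inv, ← ofReal_recip hs, ← ENNReal.ofReal_add (recip_nonneg s) (by linarith), h2]
    congr 1
    ring
  · rw [ENNReal.le_inv_iff_le_inv, h2]
    exact ENNReal.ofReal_le_ofReal (by linarith [recip_nonneg s])
  · rw [recip, inv_inv, ENNReal.toReal_ofReal (by linarith)]

end

end Polyharmonic

/-! ### The three dimensional regimes. -/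

theorem theorem4 (n m α₀ : ℕ) (hn : 2 ≤ n) (hm : 2 ≤ m) (hα₀ : 1 ≤ α₀)
    (hα₀_even : Even m → α₀ ≤ 3 * m / 2 - 1) (hα₀_odd : Odd m → α₀ ≤ 3 * m / 2) :
    (4 * m - 2 < n →
      ∀ s : ℝ≥0∞, ENNReal.ofReal (2 * n / (3 * m)) < s →
      ∀ p : ℝ, 2 ≤ p → p ≤ 2 * n / (n - 4 * m + 2) →
      ∃ C₀ C₁ R₀ : ℝ, 0 < C₀ ∧ 0 < C₁ ∧ 0 < R₀ ∧ R₀ < 1 ∧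
        ∀ (x₀ : Space n) (V : (Fin n → ℕ) → Space n → ℂ) (V₀ : Space n → ℂ),
          AdmissibleCoeffs α₀ s x₀ R₀ V V₀ →
          ∀ u : Space n → ℂ, IsTestFunction x₀ R₀ u →
          ∀ τ : ℝ, C₀ * coeffSize m α₀ s (nuHigh n m s) x₀ R₀ V V₀ < τ →
            ENNReal.ofReal (τ ^ ((3 * m * p - n * (p - 2)) / (2 * p)))
                * eLpNorm (leftWeighted m x₀ τ 0 u) (ENNReal.ofReal p) (radialMeasure x₀)
              + derivSum 1 m x₀ τ u
            ≤ ENNReal.ofReal C₁ * operatorNorm m α₀ V V₀ x₀ τ u) ∧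
    (n = 4 * m - 2 →
      ∀ s : ℝ≥0∞, ENNReal.ofReal (4 * (2 * m - 1) / (3 * m)) < s →
      ∀ p : ℝ, 2 ≤ p →
      ∀ ε : ℝ, 0 < ε → ε < 1 → 0 < critGap m s ε →
      ∃ C₀ C₁ R₀ : ℝ, 0 < C₀ ∧ 0 < C₁ ∧ 0 < R₀ ∧ R₀ < 1 ∧
        ∀ (x₀ : Space n) (V : (Fin n → ℕ) → Space n → ℂ) (V₀ : Space n → ℂ),
          AdmissibleCoeffs α₀ s x₀ R₀ V V₀ →
          ∀ u : Space n → ℂ, IsTestFunction x₀ R₀ u →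
          ∀ τ : ℝ, C₀ * coeffSize m α₀ s (nuCrit m s ε) x₀ R₀ V V₀ < τ →
            ENNReal.ofReal (τ ^ ((4 * m - 2) / p * (1 - ε) - (m - 2) / 2))
                * eLpNorm (leftWeighted m x₀ τ 0 u) (ENNReal.ofReal p) volume
              + derivSum 0 m x₀ τ u
            ≤ ENNReal.ofReal C₁ * operatorNorm m α₀ V V₀ x₀ τ u) ∧
    (n < 4 * m - 2 →
      ∀ s : ℝ≥0∞, ENNReal.ofReal (4 * (2 * m - 1) / (3 * m)) < s →
      ∀ p : ℝ≥0∞, 2 ≤ p →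
      ∃ C₀ C₁ R₀ : ℝ, 0 < C₀ ∧ 0 < C₁ ∧ 0 < R₀ ∧ R₀ < 1 ∧
        ∀ (x₀ : Space n) (V : (Fin n → ℕ) → Space n → ℂ) (V₀ : Space n → ℂ),
          AdmissibleCoeffs α₀ s x₀ R₀ V V₀ →
          ∀ u : Space n → ℂ, IsTestFunction x₀ R₀ u →
          ∀ τ : ℝ, C₀ * coeffSize m α₀ s (nuLow m s) x₀ R₀ V V₀ < τ →
            ENNReal.ofReal (τ ^ ((4 * m - 2) * recip p - (m - 2) / 2))
                * eLpNorm (leftWeighted m x₀ τ 0 u) p volume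
              + derivSum 0 m x₀ τ u
            ≤ ENNReal.ofReal C₁ * operatorNorm m α₀ V V₀ x₀ τ u) := by
  -- Both parity bounds say `α₀ < 3m/2`, so all the exponents `β_α` are positive.
  have hα : 2 * α₀ + 1 ≤ 3 * m := by
    rcases Nat.even_or_odd m with h | h
    · have := hα₀_even h
      omega
    · have := hα₀_odd h
      obtain ⟨l, rfl⟩ := h
      omega
  have hm' : (2 : ℝ) ≤ m := by exact_mod_cast hm
  have hn0 : (0 : ℝ) < n := by exact_mod_cast (by omega : 0 < n)
  refine ⟨fun hnm s hs p hp hpn => ?_, fun hnm s hs p hp ε hε0 hε1 hgap => ?_,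
    fun hnm s hs p hp => ?_⟩
  · have hnm' : (4 * m - 2 : ℝ) < n := by
      have : ((4 * m : ℕ) : ℝ) < (n + 2 : ℕ) := by exact_mod_cast (by omega)
      push_cast at this
      linarith
    have hp0 : 0 < p := by linarith
    obtain ⟨hs0, hsr⟩ := recip_lt_of_ofReal_lt (by positivity) hs
    rw [one_div_div, lt_div_iff₀ (by positivity)] at hsr
    -- From `n/s < 3m/2 ≤ 2m - 1`, where `m ≥ 2` enters. It places the Hölder conjugate of `s`
    -- within the Sobolev range and leaves the spare power of `r`.
    have hsr2 : n * recip s ≤ 2 * m - 1 := by linarith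
    have hsr3 : recip s ≤ (2 * m - 1) / n := by
      rw [le_div_iff₀ hn0]
      linarith
    have hsr1 : recip s ≤ 1 / 2 := by
      refine hsr3.trans ?_
      rw [div_le_div_iff₀ hn0 two_pos]
      linarith
    obtain ⟨p', hsp, hp', hp'2, -⟩ := exists_holder_exponent hs0 hsr1
    have hB' := carlemanBound_high hn (by omega) hnm hp' (by linarith [recip_nonneg s])
      (by linarith)
    have hpinv : (ENNReal.ofReal p)⁻¹ = ENNReal.ofReal (1 / p) := by
      rw [one_div, ENNReal.ofReal_inv_of_pos hp0]
    have hB := carlemanBound_high hn (by omega) hnm (z := 1 / p) hpinv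
      (one_div_le_one_div_of_le two_pos hp) (by
        rw [le_div_iff₀ (by linarith)] at hpn
        rw [le_div_iff₀ hp0]
        field_simp
        linarith)
    obtain ⟨C₀, C₁, R₀, h0, h1, hR, hR1, h⟩ := carleman_perturbed hn hα hsp
      (one_le_two.trans hp'2) hB' (by linarith) (by linarith)
      (by rw [← ENNReal.ofReal_one]; exact ENNReal.ofReal_le_ofReal (by linarith)) hB 1
    refine ⟨C₀, C₁, R₀, h0, h1, hR, hR1, fun x₀ V V₀ hV u hu τ hτ => ?_⟩
    obtain ⟨hKU, h⟩ := h x₀ V V₀ hV u hu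
    rw [eLpNorm_leftWeighted_radialMeasure (by omega) hKU
      (fun x hx => image_eq_zero_of_notMem_tsupport hx) τ 0 hp0]
    -- The gain at `1/p' = 1/2 - 1/s` is `3m/2 - n/s`, and its reciprocal is `ν`.
    have e1 : (1 : ℝ) / (3 * m / 2 - n / 2 + n * (1 / 2 - recip s)) = nuHigh n m s := by
      rw [nuHigh, show 3 * (m : ℝ) / 2 - n / 2 + n * (1 / 2 - recip s)
        = (3 * m - 2 * n * recip s) / 2 by ring, one_div_div]
    have e2 : 3 * (m : ℝ) / 2 - n / 2 + n * (1 / p) = (3 * m * p - n * (p - 2)) / (2 * p) := by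
      field_simp
      ring
    have h2 := h τ (by rwa [e1])
    rw [e2] at h2
    simpa only [mul_one_div, Nat.cast_zero, sub_zero] using h2
  · have hnm' : (n : ℝ) = 4 * m - 2 := by
      have : ((n + 2 : ℕ) : ℝ) = (4 * m : ℕ) := by exact_mod_cast (by omega)
      push_cast at this
      linarith
    have hp0 : 0 < p := by linarith
    obtain ⟨hs0, hsr⟩ := recip_lt_of_ofReal_lt
      (div_pos (by linarith) (by linarith)) hs
    rw [one_div_div, lt_div_iff₀ (by linarith)] at hsr
    -- For `m ≥ 2` the hypothesis on `s` forces `s > 2`, so `1/p' = 1/2 - 1/s` is positive and `p'`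
    -- is finite, as the critical estimate requires.
    have hsr1 : recip s < 1 / 2 := by
      by_contra! hc
      nlinarith
    obtain ⟨p', hsp, hp', hp'2, -⟩ := exists_holder_exponent hs0 hsr1.le
    have hB' := carlemanBound_critical (by omega) hnm hp' (by linarith)
      (by linarith [recip_nonneg s]) hε0 hε1
    have hpinv : (ENNReal.ofReal p)⁻¹ = ENNReal.ofReal (1 / p) := by
      rw [one_div, ENNReal.ofReal_inv_of_pos hp0]
    have hB := carlemanBound_critical (by omega) hnm (z := 1 / p) hpinv (by positivity)
      (one_div_le_one_div_of_le two_pos hp) hε0 hε1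
    -- The gain at `p'` is half of `critGap`, so the smallness condition on `ε` is exactly the
    -- positivity needed for absorption.
    have e1 : (4 * (m : ℝ) - 2) * (1 / 2 - recip s) * (1 - ε) - (m - 2) / 2
        = critGap m s ε / 2 := by
      rw [critGap]
      ring
    obtain ⟨C₀, C₁, R₀, h0, h1, hR, hR1, h⟩ := carleman_perturbed hn hα hsp
      (one_le_two.trans hp'2) hB' (by rw [e1]; linarith) (by linarith)
      (by rw [← ENNReal.ofReal_one]; exact ENNReal.ofReal_le_ofReal (by linarith)) hB 0
    refine ⟨C₀, C₁, R₀, h0, h1, hR, hR1, fun x₀ V V₀ hV u hu τ hτ => ?_⟩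
    obtain ⟨hKU, h⟩ := h x₀ V V₀ hV u hu
    rw [eLpNorm_leftWeighted hKU (fun x hx => image_eq_zero_of_notMem_tsupport hx) τ 0]
    have h2 := h τ (by rwa [e1, one_div_div])
    simpa only [mul_one_div, Nat.cast_zero, sub_zero, add_zero] using h2
  · have hnm' : (n : ℝ) + 2 ≤ 4 * m := by exact_mod_cast (by omega : n + 2 ≤ 4 * m)
    obtain ⟨hs0, hsr⟩ := recip_lt_of_ofReal_lt
      (div_pos (by linarith) (by linarith)) hs
    rw [one_div_div, lt_div_iff₀ (by linarith)] at hsr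
    have hsr1 : recip s < 1 / 2 := by
      by_contra! hc
      nlinarith
    obtain ⟨p', hsp, hp', hp'2, hp'r⟩ := exists_holder_exponent hs0 hsr1.le
    have hB' := carlemanBound_low hn (by omega) hnm hp'2
    have hB := carlemanBound_low hn (by omega) hnm hp
    have e1 : (4 * (m : ℝ) - 2) * recip p' - (m - 2) / 2
        = (3 * m - 4 * (2 * m - 1) * recip s) / 2 := by
      rw [hp'r]
      ring
    obtain ⟨C₀, C₁, R₀, h0, h1, hR, hR1, h⟩ := carleman_perturbed hn hα hsp
      (one_le_two.trans hp'2) hB' (by rw [e1]; linarith) (by linarith)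
      (one_le_two.trans hp) hB 0
    refine ⟨C₀, C₁, R₀, h0, h1, hR, hR1, fun x₀ V V₀ hV u hu τ hτ => ?_⟩
    obtain ⟨hKU, h⟩ := h x₀ V V₀ hV u hu
    rw [eLpNorm_leftWeighted hKU (fun x hx => image_eq_zero_of_notMem_tsupport hx) τ 0]
    have h2 := h τ (by rwa [e1, one_div_div])
    simpa only [Nat.cast_zero, sub_zero, add_zero] using h2
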